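/- **Setting.** Let $\mathcal X=\mathbb K_1\times\mathbb K_2$, where each $\mathbb K_i$ is either $\mathbb R$ or the torus $\mathbb T=\mathbb R/2\pi\mathbb Z$, with the Euclidean distance and Lebesgue measure. Let $\mathcal P(\mathcal X)$ be the set of Borel probability measures on $\mathcal X$, and $$d_W(\nu_1,\nu_2)=\sup\Big\{\int\psi\,d(\nu_2-\nu_1):\ \psi\in C_b(\mathcal X),\ |\psi(x)-\psi(y)|\le|x-y|\ \ \forall x,y\Big\}\in[0,\infty].$$ Let $V:\nu\mapsto V[\nu]=(V^1[\nu],V^2[\nu])$ assign to each $\nu\in\mathcal P(\mathcal X)$ a vector field $V[\nu]:\mathcal X\to\mathbb R^2$, and suppose there are constants $C_1,\dots,C_4>0$ such that for all $\nu,\nu_1,\nu_2\in\mathcal P(\mathcal X)$ and $x,y\in\mathcal X$: - (A1) $|V[\nu](x)|\le C_1$; - (A2) $|V[\nu](x)-V[\nu](y)|\le C_2|x-y|$; - (A3) $|V[\nu_1](x)-V[\nu_2](x)|\le C_3\,d_W(\nu_1,\nu_2)$; - (A4) $V[\nu]$ is differentiable and $\nabla V[\nu]$ is Lipschitz continuous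 with constant $C_4$. A *measure-valued solution* of $\partial_t\mu+\nabla\cdot(V[\mu]\mu)=0$ with initial datum $\mu_0\in\mathcal P(\mathcal X)$ is a map $[0,\infty)\ni t\mapsto\mu_t\in\mathcal P(\mathcal X)$ such that $t\mapsto\int\phi\,d\mu_t$ is continuous for every $\phi\in C_0(\mathcal X)$ and $$\int_0^\infty\!\int_{\mathcal X}\big(\partial_t\phi(x,t)+V[\mu_t](x)\cdot\nabla\phi(x,t)\big)\,d\mu_t(x)\,dt+\int_{\mathcal X}\phi(x,0)\,d\mu_0(x)=0$$ for every $\phi\in C_c^\infty(\mathcal X\times[0,\infty))$, the time integral being absolutely convergent. **Scheme.** Take uniform meshes of $\mathbb K_1$, $\mathbb K_2$ with cells $[x_{i-1/2},x_{i+1/2})$, $[y_{j-1/2},y_{j+1/2})$ of lengths $\Delta x,\Delta y$ and midpoints $x_i,y_j$. The indices run over $\mathbb Z$ for the line, and cyclically over a finite set for the torus. Write $Q_{i,j}$ for the product of the two cells, and let $\Delta t>0$, $t^n=n\Delta t$. For $\mu_0$ with Lebesgue density $\mu_0(x,y)$, set $$\hat\mu^0_{i,j}=\frac1{\Delta x\Delta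 y}\int_{Q_{i,j}}\mu_0(x,y)\,dx\,dy,$$ $$\begin{aligned}\hat\mu^{n+1}_{i,j}={}&\frac{\hat\mu^n_{i-1,j}+\hat\mu^n_{i+1,j}+\hat\mu^n_{i,j-1}+\hat\mu^n_{i,j+1}}4-\Delta t\,\frac{V^1[\mu^n]_{i+1,j}\hat\mu^n_{i+1,j}-V^1[\mu^n]_{i-1,j}\hat\mu^n_{i-1,j}}{2\Delta x}\\&-\Delta t\,\frac{V^2[\mu^n]_{i,j+1}\hat\mu^n_{i,j+1}-V^2[\mu^n]_{i,j-1}\hat\mu^n_{i,j-1}}{2\Delta y},\end{aligned}$$ where $V[\mu^n]_{i,j}=V[\mu^n](x_i,y_j)$. Here $\mu^n$ is either of the following two probability measures (the same choice for all $n$): the atomic measure $\sum_{i,j}\hat\mu^n_{i,j}\,\Delta x\,\Delta y\,\delta_{(x_i,y_j)}$, or the measure with density $\hat\mu^n=\sum_{i,j}\hat\mu^n_{i,j}\mathbf 1_{Q_{i,j}}$. The approximate solution is $$\hat\mu^{\Delta x,\Delta y}_t=\frac{t^{n+1}-t}{\Delta t}\hat\mu^n+\frac{t-t^n}{\Delta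 t}\hat\mu^{n+1},\qquad t\in[t^n,t^{n+1}).$$ **Theorem 2.11.** Let $V$ satisfy (A1)–(A4), and let $\mu_0\in\mathcal P(\mathcal X)$ be compactly supported and absolutely continuous with respect to Lebesgue measure, with density in $\mathrm{BV}(\mathcal X)$. Then there is a unique measure-valued solution $\mu$ with initial datum $\mu_0$; for every $t\ge0$ the measure $\mu_t$ is absolutely continuous, i.e. $\mu_t\in L^1(\mathcal X)$; and, for either choice of $\mu^n$ in the scheme and for all $\lambda_0,\kappa,T>0$, $$\sup_{t\in[0,T]}\big\|\hat\mu_t^{\Delta x,\Delta y}-\mu_t\big\|_{L^1(\mathcal X)}\to0\qquad\text{as }\Delta x,\Delta y\to0,$$ uniformly over all meshes and time steps that satisfy the CFL condition $$\lambda_0\le\frac{\Delta t}{\min(\Delta x,\Delta y)}\,C_1\le\frac12$$ and the mesh ratio condition $\max(\Delta x,\Delta y)\le\kappa\min(\Delta x,\Delta y)$. -/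

import Mathlib

open MeasureTheory
open scoped ENNReal NNReal ContDiff ZeroAtInfty BoundedContinuousFunction

noncomputable section

namespace NonlocalLF

/-! ### The domain -/

/-- The two admissible factors of the domain: the real line or the torus `ℝ/2πℤ`. -/
inductive Axis
  | line
  | circle

/-- The space `𝕂`: either `ℝ` or `𝕋 = ℝ/2πℤ`. -/
def Axis.Space : Axis → Type
  | .line => ℝ
  | .circle => AddCircle (2 * Real.pi)

instance Axis.instNormedAddCommGroup : (k : Axis) → NormedAddCommGroup k.Space
  | .line => inferInstanceAs (NormedAddCommGroup ℝ)
  | .circle => inferInstanceAs (NormedAddCommGroup (AddCircle (2 * Real.pi)))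

/-- Lebesgue measure on `𝕂` (total mass `2π` on the torus). -/
instance Axis.instMeasureSpace : (k : Axis) → MeasureSpace k.Space
  | .line => inferInstanceAs (MeasureSpace ℝ)
  | .circle =>
    haveI : Fact (0 < 2 * Real.pi) := ⟨Real.two_pi_pos⟩
    inferInstanceAs (MeasureSpace (AddCircle (2 * Real.pi)))

instance Axis.instBorelSpace : (k : Axis) → BorelSpace k.Space
  | .line => inferInstanceAs (BorelSpace ℝ)
  | .circle => inferInstanceAs (BorelSpace (AddCircle (2 * Real.pi)))

/-- The canonical projection `ℝ → 𝕂`. -/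
def Axis.proj : (k : Axis) → ℝ → k.Space
  | .line => fun x => x
  | .circle => fun x => (x : AddCircle (2 * Real.pi))

/-- The length of the period; `0` for the line. -/
def Axis.period : Axis → ℝ
  | .line => 0
  | .circle => 2 * Real.pi

/-- The domain `𝕂₁ × 𝕂₂`. Topology and Lebesgue measure are those of the product. -/
abbrev Dom (k₁ k₂ : Axis) : Type := k₁.Space × k₂.Space

/-- `ℝ²` with the Euclidean norm. -/
abbrev Plane : Type := EuclideanSpace ℝ (Fin 2)

variable {k₁ k₂ : Axis}

/-- The Euclidean distance `|x - y|` on `𝕂₁ × 𝕂₂`. -/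
def euclDist (x y : Dom k₁ k₂) : ℝ :=
  Real.sqrt (dist x.1 y.1 ^ 2 + dist x.2 y.2 ^ 2)

/-- First partial derivative of a function on `𝕂₁ × 𝕂₂`. -/
def pderiv₁ (f : Dom k₁ k₂ → ℝ) (x : Dom k₁ k₂) : ℝ :=
  deriv (fun h : ℝ => f (x.1 + k₁.proj h, x.2)) 0

/-- Second partial derivative of a function on `𝕂₁ × 𝕂₂`. -/
def pderiv₂ (f : Dom k₁ k₂ → ℝ) (x : Dom k₁ k₂) : ℝ :=
  deriv (fun h : ℝ => f (x.1, x.2 + k₂.proj h)) 0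

/-- `φ ∈ C_c^∞(𝕂₁ × 𝕂₂)`; smoothness is that of the (periodic) lift to `ℝ²`. -/
def IsTest (φ : Dom k₁ k₂ → ℝ) : Prop :=
  ContDiff ℝ ∞ (fun u : ℝ × ℝ => φ (k₁.proj u.1, k₂.proj u.2)) ∧ HasCompactSupport φ

/-- Space-time test functions. Those on `𝕂₁ × 𝕂₂ × [0, ∞)` are the restrictions of these. -/
def IsSpaceTimeTest (φ : Dom k₁ k₂ × ℝ → ℝ) : Prop :=
  ContDiff ℝ ∞ (fun u : (ℝ × ℝ) × ℝ => φ ((k₁.proj u.1.1, k₂.proj u.1.2), u.2)) ∧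
    HasCompactSupport φ

/-! ### Functions of bounded variation, densities, Wasserstein distance -/

/-- The total variation `sup {∫ f div φ : φ ∈ C_c^∞(𝕂₁ × 𝕂₂; ℝ²), |φ| ≤ 1}`. -/
def totalVariation (f : Dom k₁ k₂ → ℝ) : ℝ≥0∞ :=
  ⨆ (φ₁ : Dom k₁ k₂ → ℝ) (φ₂ : Dom k₁ k₂ → ℝ) (_ : IsTest φ₁) (_ : IsTest φ₂)
    (_ : ∀ x, φ₁ x ^ 2 + φ₂ x ^ 2 ≤ 1),
    ENNReal.ofReal (∫ x, f x * (pderiv₁ φ₁ x + pderiv₂ φ₂ x))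

/-- `f ∈ BV(𝕂₁ × 𝕂₂)`. -/
def IsBV (f : Dom k₁ k₂ → ℝ) : Prop :=
  Integrable f ∧ totalVariation f < ⊤

/-- The Lebesgue density of (the absolutely continuous part of) a probability measure. -/
def density (ν : ProbabilityMeasure (Dom k₁ k₂)) (x : Dom k₁ k₂) : ℝ :=
  ((ν : Measure (Dom k₁ k₂)).rnDeriv volume x).toReal

/-- The `1`-Wasserstein distance, a supremum over bounded `1`-Lipschitz functions. It may be `∞`
for measures without a first moment. -/
def dW (ν₁ ν₂ : ProbabilityMeasure (Dom k₁ k₂)) : ℝ≥0∞ :=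
  ⨆ (ψ : Dom k₁ k₂ →ᵇ ℝ) (_ : ∀ x y, |ψ x - ψ y| ≤ euclDist x y),
    ENNReal.ofReal ((∫ x, ψ x ∂(ν₂ : Measure (Dom k₁ k₂))) -
      ∫ x, ψ x ∂(ν₁ : Measure (Dom k₁ k₂)))

/-! ### The nonlocal velocity field and measure-valued solutions -/

/-- A nonlocal velocity field `ν ↦ V[ν]`. -/
abbrev Velocity (k₁ k₂ : Axis) : Type :=
  ProbabilityMeasure (Dom k₁ k₂) → Dom k₁ k₂ → Plane

/-- (A1) with constant `C`. -/
def Velocity.BoundedBy (V : Velocity k₁ k₂) (C : ℝ) : Prop :=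
  ∀ ν x, ‖V ν x‖ ≤ C

/-- (A2) with constant `C`. -/
def Velocity.SpaceLipschitz (V : Velocity k₁ k₂) (C : ℝ) : Prop :=
  ∀ ν x y, ‖V ν x - V ν y‖ ≤ C * euclDist x y

/-- (A3) with constant `C`. -/
def Velocity.MeasureLipschitz (V : Velocity k₁ k₂) (C : ℝ) : Prop :=
  ∀ ν₁ ν₂ x, ENNReal.ofReal ‖V ν₁ x - V ν₂ x‖ ≤ ENNReal.ofReal C * dW ν₁ ν₂

/-- The lift of `V[ν]` to the plane. -/
def Velocity.lift (V : Velocity k₁ k₂) (ν : ProbabilityMeasure (Dom k₁ k₂)) (u : Plane) : Plane :=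
  V ν (k₁.proj (u 0), k₂.proj (u 1))

/-- (A4) with constant `C`: `V[ν]` is differentiable and `∇V[ν]` is `C`-Lipschitz. -/
def Velocity.GradientLipschitz (V : Velocity k₁ k₂) (C : ℝ) : Prop :=
  ∀ ν, Differentiable ℝ (V.lift ν) ∧
    ∀ u w : Plane, ‖fderiv ℝ (V.lift ν) u - fderiv ℝ (V.lift ν) w‖ ≤ C * ‖u - w‖

/-- `∫ ∂ₜφ(x,t) + V[μₜ](x) · ∇φ(x,t) dμₜ(x)`. -/
def weakIntegrand (V : Velocity k₁ k₂) (μ : ℝ≥0 → ProbabilityMeasure (Dom k₁ k₂))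
    (φ : Dom k₁ k₂ × ℝ → ℝ) (t : ℝ≥0) : ℝ :=
  ∫ x, (deriv (fun s : ℝ => φ (x, s)) t
      + V (μ t) x 0 * pderiv₁ (fun z => φ (z, (t : ℝ))) x
      + V (μ t) x 1 * pderiv₂ (fun z => φ (z, (t : ℝ))) x) ∂(μ t : Measure (Dom k₁ k₂))

/-- `μ` is a measure-valued solution of `∂ₜμ + ∇·(V[μ]μ) = 0` with initial datum `μ₀`: a weakly
continuous map into the probability measures that satisfies the equation in the sense of
distributions. -/
structure IsMeasureValuedSolution (V : Velocity k₁ k₂) (μ₀ : ProbabilityMeasure (Dom k₁ k₂))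
    (μ : ℝ≥0 → ProbabilityMeasure (Dom k₁ k₂)) : Prop where
  weakly_continuous : ∀ φ : C₀(Dom k₁ k₂, ℝ),
    Continuous fun t : ℝ≥0 => ∫ x, φ x ∂(μ t : Measure (Dom k₁ k₂))
  integrable : ∀ φ : Dom k₁ k₂ × ℝ → ℝ, IsSpaceTimeTest φ →
    IntegrableOn (fun t : ℝ => weakIntegrand V μ φ t.toNNReal) (Set.Ioi 0)
  equation : ∀ φ : Dom k₁ k₂ × ℝ → ℝ, IsSpaceTimeTest φ →
    (∫ t in Set.Ioi (0 : ℝ), weakIntegrand V μ φ t.toNNReal)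
      + ∫ x, φ (x, 0) ∂(μ₀ : Measure (Dom k₁ k₂)) = 0

/-! ### The Lax–Friedrichs scheme -/

/-- A uniform mesh of `𝕂`, with midpoints `origin + i * step`. On the torus there are finitely many
cells, whose lengths add up to `2π`. On the line the last condition forces `cells = 0`. -/
structure Mesh (k : Axis) where
  step : ℝ
  step_pos : 0 < step
  origin : ℝ
  cells : ℕ
  cells_mul_step : (cells : ℝ) * step = k.period

/-- The index set: cyclic on the torus, and `ZMod 0 = ℤ` on the line. -/
abbrev Mesh.Index {k : Axis} (m : Mesh k) : Type := ZMod m.cells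

/-- A real representative of the midpoint `x_i`. -/
def Mesh.coord {k : Axis} (m : Mesh k) (i : m.Index) : ℝ :=
  m.origin + ((ZMod.cast i : ℤ) : ℝ) * m.step

/-- The midpoint `x_i ∈ 𝕂`. -/
def Mesh.point {k : Axis} (m : Mesh k) (i : m.Index) : k.Space :=
  k.proj (m.coord i)

/-- The cell `[x_{i-1/2}, x_{i+1/2}) ⊆ 𝕂`. -/
def Mesh.cell {k : Axis} (m : Mesh k) (i : m.Index) : Set k.Space :=
  k.proj '' Set.Ico (m.coord i - m.step / 2) (m.coord i + m.step / 2)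

/-- Coefficients of a grid function. -/
abbrev GridFun (m₁ : Mesh k₁) (m₂ : Mesh k₂) : Type := m₁.Index → m₂.Index → ℝ

variable {m₁ : Mesh k₁} {m₂ : Mesh k₂}

/-- The piecewise constant function `∑ a_{i,j} 1_{cell (i,j)}`. -/
def piecewiseConst (a : GridFun m₁ m₂) (x : Dom k₁ k₂) : ℝ :=
  ∑' p : m₁.Index × m₂.Index, (m₁.cell p.1 ×ˢ m₂.cell p.2).indicator (fun _ => a p.1 p.2) x

/-- The two ways to regard cell densities `a_{i,j}` as a measure when evaluating `V`. -/
inductive Realization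
  | pointMasses
  | cellwise

/-- The measure represented by cell densities `a_{i,j}`: either the point masses
`∑ a_{i,j} Δx Δy δ_{(x_i, y_j)}`, or the measure with density `∑ a_{i,j} 1_{cell (i,j)}`. -/
def Realization.measure (r : Realization) (a : GridFun m₁ m₂) : Measure (Dom k₁ k₂) :=
  match r with
  | .pointMasses => Measure.sum fun p : m₁.Index × m₂.Index =>
      ENNReal.ofReal (a p.1 p.2 * (m₁.step * m₂.step)) •
        Measure.dirac (m₁.point p.1, m₂.point p.2)
  | .cellwise => volume.withDensity fun x => ENNReal.ofReal (piecewiseConst a x)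

open Classical in
/-- `V[m]` for a measure `m`; it is only of interest when `m` is a probability measure, which the
CFL condition guarantees for the measures produced by the scheme. -/
def Velocity.eval (V : Velocity k₁ k₂) (m : Measure (Dom k₁ k₂)) (x : Dom k₁ k₂) : Plane :=
  if h : IsProbabilityMeasure m then V ⟨m, h⟩ x else 0

/-- One step of the unstaggered two-dimensional Lax–Friedrichs method, with time step `τ`. -/
def lfStep (V : Velocity k₁ k₂) (r : Realization) (τ : ℝ) (a : GridFun m₁ m₂) : GridFun m₁ m₂ :=
  let W : m₁.Index → m₂.Index → Plane :=
    fun i j => V.eval (r.measure a) (m₁.point i, m₂.point j)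
  fun i j =>
    (a (i - 1) j + a (i + 1) j + a i (j - 1) + a i (j + 1)) / 4
    - τ * (W (i + 1) j 0 * a (i + 1) j - W (i - 1) j 0 * a (i - 1) j) / (2 * m₁.step)
    - τ * (W i (j + 1) 1 * a i (j + 1) - W i (j - 1) 1 * a i (j - 1)) / (2 * m₂.step)

/-- The cell averages of the density of `μ₀`. -/
def cellAverages (m₁ : Mesh k₁) (m₂ : Mesh k₂) (μ₀ : ProbabilityMeasure (Dom k₁ k₂)) :
    GridFun m₁ m₂ :=
  fun i j => (∫ x in m₁.cell i ×ˢ m₂.cell j, density μ₀ x) / (m₁.step * m₂.step)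

/-- The numerical solution at time `n * τ`. -/
def laxFriedrichs (V : Velocity k₁ k₂) (r : Realization) (m₁ : Mesh k₁) (m₂ : Mesh k₂) (τ : ℝ)
    (μ₀ : ProbabilityMeasure (Dom k₁ k₂)) : ℕ → GridFun m₁ m₂
  | 0 => cellAverages m₁ m₂ μ₀
  | n + 1 => lfStep V r τ (laxFriedrichs V r m₁ m₂ τ μ₀ n)

/-- The approximate solution at time `t`: piecewise constant in space, and linear in time between
`t^n = n * τ` and `t^{n+1}`, where `t ∈ [t^n, t^{n+1})`. -/
def approxSolution (V : Velocity k₁ k₂) (r : Realization) (m₁ : Mesh k₁) (m₂ : Mesh k₂) (τ : ℝ)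
    (μ₀ : ProbabilityMeasure (Dom k₁ k₂)) (t : ℝ) (x : Dom k₁ k₂) : ℝ :=
  let n : ℕ := ⌊t / τ⌋₊
  (((n : ℝ) + 1) * τ - t) / τ * piecewiseConst (laxFriedrichs V r m₁ m₂ τ μ₀ n) x
    + (t - n * τ) / τ * piecewiseConst (laxFriedrichs V r m₁ m₂ τ μ₀ (n + 1)) x

end NonlocalLF

end

noncomputable section

namespace NonlocalLF

section

/-! ### Topology and measure on the domain -/

/-! One stability principle yields uniqueness, existence and convergence together. A curve of
probability measures is an approximate solution with error `h` (`IsApprox`) if it is Lipschitz in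
the Wasserstein distance up to `h` and if, for every bounded `φ` of class `C^{1,1}` with Lipschitz
constant `L` and second-order constant `K`, the increment of `∫ φ` over a short interval `[s, t]` is
`(t - s) ∫ V[ν_s] · ∇φ dν_s` up to `O((t - s)² + h)(L + K)`. By `exists_stability`, two such curves
with small `h` and close initial data stay close in the Wasserstein distance on bounded time
intervals. The proof is a discrete Gronwall argument in dual form (`abs_oneStep_sub_le`). Composing
a test function with `id + σ V` keeps it `C^{1,1}` with constants that grow by `1 + O(σ)`. The
nonlocal difference of the velocities is a Wasserstein distance, and it is estimated by the same
family of test functions after a mollification at a fixed scale.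

Wasserstein closeness improves to closeness in `L¹` when both densities satisfy `‖f(· + w) - f‖₁ ≤ M
|w|`: pair the difference with its mollified sign (`integral_abs_le_of_shiftBound`).

The scheme provides both ingredients. Read as a random walk, a step moves the mass of a grid point
to its four neighbours with weights `1/4 ± u`, `1/4 ± w`; these are nonnegative by the CFL
condition, and the mean displacement is `τ V`. The remainder per step is `O(h²)` for the mesh size
`h`, and the lower CFL bound turns this into `O(τ²)`, so the numerical solution is an approximate
solution whose error tends to 0 (`isApprox_laxFriedrichs`). The weights also make the step a
contraction for the `ℓ¹` norm of differences; the commutator with a translation costs first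
differences of `V` times the variation and second differences of `V` times the mass. Hence the
variation stays bounded on bounded time intervals (`gridTV_laxFriedrichs_le`), which gives the
translation estimate.

Numerical solutions on finer and finer meshes are therefore Cauchy in `L¹` at each time, and their
limit is an approximate solution with error 0 (`exists_isDensityCurve`). Error 0 means that `∫ φ(·,
t) dμ_t` has the expected right derivative, so the limit is a measure-valued solution
(`IsApprox.isMeasureValuedSolution`). Conversely, every measure-valued solution has error 0
(`IsMeasureValuedSolution.isApprox`), so stability gives uniqueness. Convergence is stability again,
applied to the numerical and the exact curve. -/

instance factPeriodPos : Fact (0 < 2 * Real.pi) := ⟨Real.two_pi_pos⟩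

instance Axis.instSecondCountableTopology : (k : Axis) → SecondCountableTopology k.Space
  | .line => inferInstanceAs (SecondCountableTopology ℝ)
  | .circle => inferInstanceAs (SecondCountableTopology (AddCircle (2 * Real.pi)))

instance Axis.instProperSpace : (k : Axis) → ProperSpace k.Space
  | .line => inferInstanceAs (ProperSpace ℝ)
  | .circle => inferInstanceAs (ProperSpace (AddCircle (2 * Real.pi)))

instance Axis.instIsAddHaarMeasure : (k : Axis) → (volume : Measure k.Space).IsAddHaarMeasure
  | .line => inferInstanceAs ((volume : Measure ℝ).IsAddHaarMeasure)
  | .circle => inferInstanceAs ((volume : Measure (AddCircle (2 * Real.pi))).IsAddHaarMeasure)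

theorem Axis.proj_add (k : Axis) (a b : ℝ) : k.proj (a + b) = k.proj a + k.proj b := by
  cases k
  · rfl
  · exact AddCircle.coe_add _ a b

theorem Axis.proj_zero (k : Axis) : k.proj 0 = 0 := by
  have := k.proj_add 0 0
  simpa using this

theorem Axis.proj_neg (k : Axis) (a : ℝ) : k.proj (-a) = -k.proj a := by
  have := k.proj_add a (-a)
  rw [add_neg_cancel, proj_zero] at this
  exact (neg_eq_of_add_eq_zero_right this.symm).symm

theorem Axis.proj_sub (k : Axis) (a b : ℝ) : k.proj (a - b) = k.proj a - k.proj b := by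
  rw [sub_eq_add_neg, proj_add, proj_neg, sub_eq_add_neg]

theorem Axis.norm_proj_le (k : Axis) (a : ℝ) : ‖k.proj a‖ ≤ |a| := by
  cases k
  · exact le_rfl
  · exact QuotientAddGroup.norm_mk_le_norm

/-- On the torus, the representative nearest to 0 realizes the quotient norm. -/
theorem Axis.exists_proj (k : Axis) (z : k.Space) : ∃ a : ℝ, k.proj a = z ∧ |a| = ‖z‖ := by
  cases k
  · exact ⟨z, rfl, rfl⟩
  · obtain ⟨x, rfl⟩ := QuotientAddGroup.mk_surjective z
    refine ⟨x - round ((2 * Real.pi)⁻¹ * x) * (2 * Real.pi), ?_, (AddCircle.norm_eq _).symm⟩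
    change ((x - round ((2 * Real.pi)⁻¹ * x) * (2 * Real.pi) : ℝ) : AddCircle (2 * Real.pi)) = x
    rw [← zsmul_eq_mul, AddCircle.coe_sub, AddCircle.coe_zsmul, AddCircle.coe_period, smul_zero,
      sub_zero]

theorem Axis.proj_surjective (k : Axis) : Function.Surjective k.proj := fun z =>
  let ⟨a, h, _⟩ := k.exists_proj z; ⟨a, h⟩

theorem Axis.continuous_proj (k : Axis) : Continuous k.proj := by
  refine Metric.continuous_iff.2 fun b ε hε => ⟨ε, hε, fun a ha => ?_⟩
  rw [dist_eq_norm, ← proj_sub]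
  exact (k.norm_proj_le _).trans_lt ha

/-- Since the line has period 0, one formula serves both kinds of axis. -/
theorem Axis.proj_eq_proj_iff (k : Axis) (a b : ℝ) :
    k.proj a = k.proj b ↔ ∃ n : ℤ, a = b + n * k.period := by
  cases k
  · simp only [Axis.proj, Axis.period, mul_zero, add_zero, exists_const]
    rfl
  · constructor
    · intro h
      obtain ⟨n, hn⟩ := (QuotientAddGroup.eq_iff_sub_mem.1 h : a - b ∈ AddSubgroup.zmultiples (2 * Real.pi))
      refine ⟨n, ?_⟩
      simp only [zsmul_eq_mul] at hn
      simp only [Axis.period]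
      linarith
    · rintro ⟨n, rfl⟩
      change ((b + n * (2 * Real.pi) : ℝ) : AddCircle (2 * Real.pi)) = b
      rw [← zsmul_eq_mul, AddCircle.coe_add, AddCircle.coe_zsmul, AddCircle.coe_period]
      simp

variable {k₁ k₂ : Axis}

/-- The projection of the plane onto `𝕂₁ × 𝕂₂`. -/
def pr (v : Plane) : Dom k₁ k₂ := (k₁.proj (v 0), k₂.proj (v 1))

theorem pr_add (v w : Plane) : (pr (v + w) : Dom k₁ k₂) = pr v + pr w := by
  simp [pr, Axis.proj_add]

theorem pr_zero : (pr 0 : Dom k₁ k₂) = 0 := by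
  simp [pr, Axis.proj_zero]

theorem pr_neg (v : Plane) : (pr (-v) : Dom k₁ k₂) = -pr v := by
  simp [pr, Axis.proj_neg]

theorem pr_surjective : Function.Surjective (pr : Plane → Dom k₁ k₂) := fun z => by
  obtain ⟨a, ha⟩ := k₁.proj_surjective z.1
  obtain ⟨b, hb⟩ := k₂.proj_surjective z.2
  exact ⟨!₂[a, b], by simp [pr, ha, hb]⟩

theorem continuous_pr : Continuous (pr : Plane → Dom k₁ k₂) :=
  (k₁.continuous_proj.comp (by fun_prop)).prodMk (k₂.continuous_proj.comp (by fun_prop))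

theorem norm_plane (v : Plane) : ‖v‖ = √(v 0 ^ 2 + v 1 ^ 2) := by
  rw [EuclideanSpace.norm_eq, Fin.sum_univ_two]
  simp

theorem abs_coord_le (v : Plane) (i : Fin 2) : |v i| ≤ ‖v‖ := by
  simpa using PiLp.norm_apply_le v i

theorem euclDist_add_pr_le (x : Dom k₁ k₂) (v : Plane) : euclDist x (x + pr v) ≤ ‖v‖ := by
  rw [norm_plane, euclDist]
  refine Real.sqrt_le_sqrt (add_le_add ?_ ?_) <;>
  · rw [sq_le_sq, abs_of_nonneg dist_nonneg, dist_eq_norm]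
    simpa [pr] using Axis.norm_proj_le _ _

/-- Any two points differ by a plane vector as long as their distance. Lipschitz and Taylor
estimates can thus be written with `x + pr v`, and line and torus need no separate treatment. -/
theorem exists_pr (x y : Dom k₁ k₂) : ∃ v : Plane, y = x + pr v ∧ ‖v‖ = euclDist x y := by
  obtain ⟨a, ha, ha'⟩ := k₁.exists_proj (y.1 - x.1)
  obtain ⟨b, hb, hb'⟩ := k₂.exists_proj (y.2 - x.2)
  refine ⟨!₂[a, b], ?_, ?_⟩
  · ext <;> simp [pr, ha, hb]
  · rw [norm_plane, euclDist, dist_comm, dist_comm x.2, dist_eq_norm, dist_eq_norm, ← ha', ← hb']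
    simp

theorem euclDist_le_two_mul_dist (x y : Dom k₁ k₂) : euclDist x y ≤ 2 * dist x y := by
  rw [euclDist]
  refine Real.sqrt_le_iff.2 ⟨by positivity, ?_⟩
  have h1 : dist x.1 y.1 ≤ dist x y := by rw [Prod.dist_eq]; exact le_max_left _ _
  have h2 : dist x.2 y.2 ≤ dist x y := by rw [Prod.dist_eq]; exact le_max_right _ _
  nlinarith [dist_nonneg (x := x.1) (y := y.1), dist_nonneg (x := x.2) (y := y.2),
    dist_nonneg (x := x) (y := y)]

/-- Lipschitz continuity for the Euclidean distance, in terms of translations. -/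
def LipC {E : Type*} [NormedAddCommGroup E] (f : Dom k₁ k₂ → E) (L : ℝ) : Prop :=
  ∀ x v, ‖f (x + pr v) - f x‖ ≤ L * ‖v‖

section LipC
variable {E : Type*} [NormedAddCommGroup E] {f g : Dom k₁ k₂ → E} {L L' : ℝ}

theorem lipC_iff (hL : 0 ≤ L) : LipC f L ↔ ∀ x y, ‖f x - f y‖ ≤ L * euclDist x y := by
  constructor
  · intro h x y
    obtain ⟨v, rfl, hv⟩ := exists_pr x y
    rw [← hv, norm_sub_rev]
    exact h x v
  · intro h x v
    rw [norm_sub_rev]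
    exact (h _ _).trans (by gcongr; exact euclDist_add_pr_le x v)

theorem LipC.mono (h : LipC f L) (hL : L ≤ L') : LipC f L' := fun x v =>
  (h x v).trans (by gcongr)

theorem LipC.nonneg (h : LipC f L) : 0 ≤ L := by
  have := (norm_nonneg _).trans (h 0 (!₂[1, 0]))
  have h2 : ‖(!₂[1, 0] : Plane)‖ = 1 := by simp [norm_plane]
  simpa [h2] using this

theorem LipC.continuous (h : LipC f L) : Continuous f := by
  have h' := (lipC_iff h.nonneg).1 h
  refine (LipschitzWith.of_dist_le_mul (K := (2 * L).toNNReal) fun x y => ?_).continuous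
  rw [dist_eq_norm, Real.coe_toNNReal _ (by linarith [h.nonneg])]
  calc _ ≤ L * euclDist x y := h' x y
    _ ≤ L * (2 * dist x y) := by gcongr; exacts [h.nonneg, euclDist_le_two_mul_dist x y]
    _ = _ := by ring

theorem LipC.comp_add_pr (hf : LipC f L) {S : Dom k₁ k₂ → Plane} (hS : LipC S L') :
    LipC (fun x => f (x + pr (S x))) (L * (1 + L')) := fun x v => by
  have : x + pr v + pr (S (x + pr v)) = x + pr (S x) + pr (v + (S (x + pr v) - S x)) := by
    rw [sub_eq_add_neg]
    simp only [pr_add, pr_neg]; abel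
  change ‖f (x + pr v + pr (S (x + pr v))) - f (x + pr (S x))‖ ≤ _
  rw [this]
  refine (hf _ _).trans ?_
  rw [mul_assoc]
  refine mul_le_mul_of_nonneg_left ?_ hf.nonneg
  rw [add_mul, one_mul]
  exact (norm_add_le _ _).trans (by gcongr; exact hS x v)

end LipC

/-! ### Closeness of measures in the Wasserstein distance -/

/-- The `1`-Wasserstein distance is at most `δ`. -/
def WClose (μ ν : Measure (Dom k₁ k₂)) (δ : ℝ) : Prop :=
  ∀ ψ : Dom k₁ k₂ → ℝ, (∃ B, ∀ x, |ψ x| ≤ B) → LipC ψ 1 → |∫ x, ψ x ∂μ - ∫ x, ψ x ∂ν| ≤ δ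

theorem integrable_of_bdd {μ : Measure (Dom k₁ k₂)} [IsFiniteMeasure μ] {ψ : Dom k₁ k₂ → ℝ}
    (hb : ∃ B, ∀ x, |ψ x| ≤ B) (hc : Measurable ψ) : Integrable ψ μ := by
  obtain ⟨B, hB⟩ := hb
  exact Integrable.of_bound hc.aestronglyMeasurable B (Filter.Eventually.of_forall hB)

section WClose
variable {μ ν ρ : Measure (Dom k₁ k₂)} {δ δ' : ℝ}

theorem WClose.nonneg (h : WClose μ ν δ) : 0 ≤ δ := by
  have := h (fun _ => 0) ⟨0, by simp⟩ (fun x v => by simp)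
  simpa using this

theorem WClose.mono (h : WClose μ ν δ) (hd : δ ≤ δ') : WClose μ ν δ' :=
  fun ψ hb hl => (h ψ hb hl).trans hd

theorem WClose.symm (h : WClose μ ν δ) : WClose ν μ δ := fun ψ hb hl => by
  rw [abs_sub_comm]; exact h ψ hb hl

theorem WClose.trans (h : WClose μ ν δ) (h' : WClose ν ρ δ') : WClose μ ρ (δ + δ') :=
  fun ψ hb hl => (abs_sub_le _ _ _).trans (add_le_add (h ψ hb hl) (h' ψ hb hl))

theorem WClose.refl (μ : Measure (Dom k₁ k₂)) : WClose μ μ 0 := fun ψ _ _ => by simp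

theorem WClose.integral_le (h : WClose μ ν δ) {ψ : Dom k₁ k₂ → ℝ} {L : ℝ}
    (hb : ∃ B, ∀ x, |ψ x| ≤ B) (hl : LipC ψ L) : |∫ x, ψ x ∂μ - ∫ x, ψ x ∂ν| ≤ L * δ := by
  -- `L` may be 0, so `ψ` is rescaled by a positive `L' ≥ L`, which is then brought arbitrarily
  -- close to `L`.
  have key : ∀ L' > 0, L ≤ L' → |∫ x, ψ x ∂μ - ∫ x, ψ x ∂ν| ≤ L' * δ := by
    intro L' hL' hLL
    have h1 := h (fun x => L'⁻¹ * ψ x) ?_ ?_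
    · rw [integral_const_mul, integral_const_mul, ← mul_sub, abs_mul,
        abs_of_pos (inv_pos.2 hL'), inv_mul_le_iff₀ hL'] at h1
      exact h1
    · obtain ⟨B, hB⟩ := hb
      refine ⟨L'⁻¹ * B, fun x => ?_⟩
      rw [abs_mul, abs_of_pos (inv_pos.2 hL')]
      gcongr; exact hB x
    · intro x v
      rw [← mul_sub, norm_mul, Real.norm_of_nonneg (inv_pos.2 hL').le, inv_mul_le_iff₀ hL', one_mul]
      exact hl.mono hLL x v
  refine le_of_forall_pos_le_add fun e he => ?_
  have hd := h.nonneg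
  refine (key (L + e / (δ + 1)) ?_ ?_).trans ?_
  · have := hl.nonneg; positivity
  · have : 0 ≤ e / (δ + 1) := by positivity
    linarith
  · rw [add_mul]
    have : e / (δ + 1) * δ ≤ e := by
      rw [div_mul_eq_mul_div, div_le_iff₀ (by linarith)]
      nlinarith
    linarith

theorem dW_le_of_wClose {μ ν : ProbabilityMeasure (Dom k₁ k₂)}
    (h : WClose (μ : Measure (Dom k₁ k₂)) ν δ) : dW μ ν ≤ ENNReal.ofReal δ := by
  refine iSup₂_le fun ψ hψ => ENNReal.ofReal_le_ofReal ?_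
  refine (le_abs_self _).trans ?_
  rw [abs_sub_comm]
  refine h ψ ⟨‖ψ‖, fun x => ψ.norm_coe_le_norm x⟩ ((lipC_iff zero_le_one).2 ?_)
  simpa using hψ

end WClose

theorem Velocity.MeasureLipschitz.norm_sub_le {V : Velocity k₁ k₂} {C δ : ℝ} (hC : 0 ≤ C)
    (hV : V.MeasureLipschitz C) {μ ν : ProbabilityMeasure (Dom k₁ k₂)}
    (h : WClose (μ : Measure (Dom k₁ k₂)) ν δ) (x : Dom k₁ k₂) : ‖V μ x - V ν x‖ ≤ C * δ := by
  have h1 := (hV μ ν x).trans (mul_le_mul_right (dW_le_of_wClose h) _)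
  rw [← ENNReal.ofReal_mul hC] at h1
  exact (ENNReal.ofReal_le_ofReal_iff (mul_nonneg hC h.nonneg)).1 h1

theorem Velocity.SpaceLipschitz.lipC {V : Velocity k₁ k₂} {C : ℝ} (hC : 0 ≤ C)
    (hV : V.SpaceLipschitz C) (ν : ProbabilityMeasure (Dom k₁ k₂)) : LipC (V ν) C :=
  (lipC_iff hC).2 (hV ν)

end

section

variable {k₁ k₂ : Axis}

/-! ### Functions of class `C^{1,1}` -/

/-- `φ` is bounded and of class `C^{1,1}` with gradient `G`, Lipschitz constant `L` and second-order
constant `K`. -/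
structure IsC11 (φ : Dom k₁ k₂ → ℝ) (G : Dom k₁ k₂ → Plane) (L K : ℝ) : Prop where
  bdd : ∃ B, ∀ x, |φ x| ≤ B
  lip : LipC φ L
  norm_le : ∀ x, ‖G x‖ ≤ L
  taylor : ∀ x v, |φ (x + pr v) - φ x - inner ℝ (G x) v| ≤ K * ‖v‖ ^ 2

section IsC11
variable {φ : Dom k₁ k₂ → ℝ} {G : Dom k₁ k₂ → Plane} {L K : ℝ}

theorem IsC11.nonneg_lip (h : IsC11 φ G L K) : 0 ≤ L := h.lip.nonneg

theorem IsC11.nonneg_taylor (h : IsC11 φ G L K) : 0 ≤ K := by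
  have := (abs_nonneg _).trans (h.taylor 0 (!₂[1, 0]))
  have h2 : ‖(!₂[1, 0] : Plane)‖ = 1 := by simp [norm_plane]
  simpa [h2] using this

theorem IsC11.mono (h : IsC11 φ G L K) {L' K' : ℝ} (hL : L ≤ L') (hK : K ≤ K') :
    IsC11 φ G L' K' where
  bdd := h.bdd
  lip := h.lip.mono hL
  norm_le x := (h.norm_le x).trans hL
  taylor x v := (h.taylor x v).trans (by gcongr)

/-- Let `w` be parallel to `G(x + v) - G(x)` with `|w| = |v|`. The Taylor formulas at `x + v` along
`w`, at `x` along `v` and at `x` along `v + w` combine to `|v| |G(x + v) - G(x)| ≤ K (1 + 1 + 4)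
|v|²`. -/
theorem IsC11.lip_gradient (h : IsC11 φ G L K) : LipC G (6 * K) := fun x v => by
  rcases eq_or_ne (G (x + pr v) - G x) 0 with h0 | h0
  · rw [h0, norm_zero]
    have := h.nonneg_taylor
    positivity
  set g := G (x + pr v) - G x with hg
  have hgn : 0 < ‖g‖ := norm_pos_iff.2 h0
  rcases eq_or_ne v 0 with rfl | hv
  · simp [pr_zero] at hg
    exact absurd hg h0
  have hvn : 0 < ‖v‖ := norm_pos_iff.2 hv
  set w : Plane := (‖v‖ / ‖g‖) • g with hw
  have hwn : ‖w‖ = ‖v‖ := by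
    rw [hw, norm_smul, Real.norm_of_nonneg (by positivity)]
    field_simp
  have t1 := h.taylor (x + pr v) w
  have t2 := h.taylor x v
  have t3 := h.taylor x (v + w)
  rw [pr_add, ← add_assoc, inner_add_right] at t3
  have hin : inner ℝ g w = ‖v‖ * ‖g‖ := by
    rw [hw, inner_smul_right, real_inner_self_eq_norm_sq]
    field_simp
  rw [hg, inner_sub_left] at hin
  have hvw : ‖v + w‖ ^ 2 ≤ 4 * ‖v‖ ^ 2 := by
    have : ‖v + w‖ ≤ 2 * ‖v‖ := (norm_add_le _ _).trans (by rw [hwn]; linarith)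
    nlinarith [norm_nonneg (v + w)]
  have hK := h.nonneg_taylor
  have t3' := t3.trans (mul_le_mul_of_nonneg_left hvw hK)
  rw [hwn] at t1
  rw [abs_le] at t1 t2 t3'
  have : ‖v‖ * ‖g‖ ≤ ‖v‖ * (6 * K * ‖v‖) := by
    rw [← hg] at hin
    nlinarith [t1.1, t1.2, t2.1, t2.2, t3'.1, t3'.2]
  exact le_of_mul_le_mul_left this hvn

theorem IsC11.continuous (h : IsC11 φ G L K) : Continuous φ := h.lip.continuous

theorem IsC11.continuous_gradient (h : IsC11 φ G L K) : Continuous G := h.lip_gradient.continuous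

end IsC11

/-! ### Regular velocity fields -/

/-- The assumptions on the velocity field, with a single constant. -/
structure Velocity.Regular (V : Velocity k₁ k₂) (C : ℝ) : Prop where
  one_le : 1 ≤ C
  bdd : ∀ ν x, ‖V ν x‖ ≤ C
  lip : ∀ ν, LipC (V ν) C
  meas : ∀ (μ ν : ProbabilityMeasure (Dom k₁ k₂)) (δ : ℝ),
    WClose (μ : Measure (Dom k₁ k₂)) ν δ → ∀ x, ‖V μ x - V ν x‖ ≤ C * δ
  taylor : ∀ ν, ∃ D : Dom k₁ k₂ → Plane →L[ℝ] Plane, (∀ x, ‖D x‖ ≤ C) ∧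
    ∀ x v, ‖V ν (x + pr v) - V ν x - D x v‖ ≤ C * ‖v‖ ^ 2

theorem Velocity.lift_eq (V : Velocity k₁ k₂) (ν : ProbabilityMeasure (Dom k₁ k₂)) (u : Plane) :
    V.lift ν u = V ν (pr u) := rfl

/-- A differentiable map with `K`-Lipschitz derivative satisfies Taylor's formula. -/
theorem norm_taylor_le {E F : Type*} [NormedAddCommGroup E] [NormedSpace ℝ E]
    [NormedAddCommGroup F] [NormedSpace ℝ F] {f : E → F} {K : ℝ} (hK : 0 ≤ K)
    (hf : Differentiable ℝ f)
    (hL : ∀ u w, ‖fderiv ℝ f u - fderiv ℝ f w‖ ≤ K * ‖u - w‖) (u v : E) :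
    ‖f (u + v) - f u - fderiv ℝ f u v‖ ≤ K * ‖v‖ ^ 2 := by
  have := (convex_closedBall u ‖v‖).norm_image_sub_le_of_norm_hasFDerivWithin_le'
    (f := f) (f' := fderiv ℝ f) (φ := fderiv ℝ f u) (C := K * ‖v‖) (x := u) (y := u + v)
    (fun x _ => (hf x).hasFDerivAt.hasFDerivWithinAt) (fun x hx => ?_)
    (Metric.mem_closedBall_self (norm_nonneg v)) (by simp)
  · simpa [pow_two, mul_assoc] using this
  · refine (hL x u).trans ?_
    rw [mem_closedBall_iff_norm] at hx
    gcongr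

theorem Velocity.regular_of {V : Velocity k₁ k₂} {C₁ C₂ C₃ C₄ C : ℝ} (hC₂ : 0 < C₂)
    (hC₃ : 0 < C₃) (hC₄ : 0 < C₄) (hA1 : V.BoundedBy C₁) (hA2 : V.SpaceLipschitz C₂)
    (hA3 : V.MeasureLipschitz C₃) (hA4 : V.GradientLipschitz C₄) (h : 1 ≤ C) (h₁ : C₁ ≤ C)
    (h₂ : C₂ ≤ C) (h₃ : C₃ ≤ C) (h₄ : C₄ ≤ C) : V.Regular C where
  one_le := h
  bdd ν x := (hA1 ν x).trans h₁
  lip ν := (hA2.lipC hC₂.le ν).mono h₂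
  meas μ ν δ hd x := (hA3.norm_sub_le hC₃.le hd x).trans (by have := hd.nonneg; gcongr)
  taylor ν := by
    -- The derivative is taken at an arbitrary lift of `x`. Only its norm and Taylor's formula are
    -- used, so its periodicity need not be shown.
    choose r hr using (pr_surjective : Function.Surjective (pr : Plane → Dom k₁ k₂))
    refine ⟨fun x => fderiv ℝ (V.lift ν) (r x), fun x => ?_, fun x v => ?_⟩
    · refine (norm_fderiv_le_of_lipschitz ℝ (C := C.toNNReal)
        (LipschitzWith.of_dist_le_mul fun u w => ?_)).trans ?_
      · rw [Real.coe_toNNReal _ (by linarith), dist_eq_norm, dist_eq_norm]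
        have := (hA2.lipC hC₂.le ν).mono h₂ (pr w) (u - w)
        rwa [← pr_add, add_sub_cancel] at this
      · rw [Real.coe_toNNReal _ (by linarith)]
    · have := norm_taylor_le hC₄.le (hA4 ν).1 (hA4 ν).2 (r x) v
      rw [V.lift_eq, V.lift_eq, pr_add, hr] at this
      exact this.trans (by gcongr)

section Regular
variable {V : Velocity k₁ k₂} {C : ℝ}

theorem Velocity.Regular.nonneg (hV : V.Regular C) : 0 ≤ C := zero_le_one.trans hV.one_le

theorem LipC.smul_const {E : Type*} [NormedAddCommGroup E] [NormedSpace ℝ E]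
    {f : Dom k₁ k₂ → E} {L c : ℝ} (hf : LipC f L) (hc : 0 ≤ c) :
    LipC (fun x => c • f x) (c * L) := fun x v => by
  rw [← smul_sub, norm_smul, Real.norm_of_nonneg hc, mul_assoc]
  gcongr; exact hf x v

/-- The chain rule for `φ ∘ (id + σ V)`: the gradient is `(1 + σ D*) G`, evaluated at the image
point. Both constants grow by `1 + O(σ)`, and the Taylor remainder of `V` adds `σ C L` to the
second-order constant. Iterating over `T / σ` steps therefore keeps them bounded. -/
theorem IsC11.comp_flow {φ : Dom k₁ k₂ → ℝ} {G : Dom k₁ k₂ → Plane} {L K σ : ℝ}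
    (h : IsC11 φ G L K) (hV : V.Regular C) (hσ : 0 ≤ σ) (ν : ProbabilityMeasure (Dom k₁ k₂)) :
    ∃ G', IsC11 (fun x => φ (x + pr (σ • V ν x))) G' (L * (1 + σ * C))
      (K * (1 + σ * C) ^ 2 + σ * C * L) := by
  obtain ⟨D, hD, hDT⟩ := hV.taylor ν
  have hC := hV.nonneg
  have hL := h.nonneg_lip
  refine ⟨fun x => G (x + pr (σ • V ν x)) +
    σ • (ContinuousLinearMap.adjoint (D x)) (G (x + pr (σ • V ν x))), ?_, ?_, ?_, ?_⟩
  · obtain ⟨B, hB⟩ := h.bdd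
    exact ⟨B, fun x => hB _⟩
  · exact h.lip.comp_add_pr ((hV.lip ν).smul_const hσ)
  · intro x
    refine (norm_add_le _ _).trans ?_
    rw [mul_add, mul_one, norm_smul, Real.norm_of_nonneg hσ]
    refine add_le_add (h.norm_le _) ?_
    have h1 := (ContinuousLinearMap.adjoint (D x)).le_opNorm (G (x + pr (σ • V ν x)))
    rw [LinearIsometryEquiv.norm_map] at h1
    calc σ * _ ≤ σ * (C * L) := by
          gcongr; exact h1.trans (mul_le_mul (hD x) (h.norm_le _) (norm_nonneg _) hC)
      _ = _ := by ring
  · intro x v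
    set S := x + pr (σ • V ν x)
    set w := v + σ • (V ν (x + pr v) - V ν x) with hw
    have hS : x + pr v + pr (σ • V ν (x + pr v)) = S + pr w := by
      simp only [S, hw, sub_eq_add_neg, smul_add, smul_neg, pr_add, pr_neg]; abel
    have hwn : ‖w‖ ≤ (1 + σ * C) * ‖v‖ := by
      refine (norm_add_le _ _).trans ?_
      rw [norm_smul, Real.norm_of_nonneg hσ, add_mul, one_mul, mul_assoc]
      gcongr; exact hV.lip ν x v
    have t1 := (h.taylor S w).trans (mul_le_mul_of_nonneg_left
      (pow_le_pow_left₀ (norm_nonneg _) hwn 2) h.nonneg_taylor)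
    -- After the linear part of `V` has moved to `G` through the adjoint, only the Taylor remainder
    -- of `V` is left.
    have hin : inner ℝ (G S) w - inner ℝ (G S + σ • ContinuousLinearMap.adjoint (D x) (G S)) v =
        σ * inner ℝ (G S) (V ν (x + pr v) - V ν x - D x v) := by
      rw [hw, inner_add_right, inner_add_left, inner_smul_left, inner_smul_right,
        ContinuousLinearMap.adjoint_inner_left, inner_sub_right _ _ (D x v)]
      simp only [conj_trivial]; ring
    have t2 : |σ * inner ℝ (G S) (V ν (x + pr v) - V ν x - D x v)| ≤ σ * (L * (C * ‖v‖ ^ 2)) := by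
      rw [abs_mul, abs_of_nonneg hσ]
      gcongr
      exact (abs_real_inner_le_norm _ _).trans
        (mul_le_mul (h.norm_le _) (hDT x v) (norm_nonneg _) hL)
    change |φ (x + pr v + pr (σ • V ν (x + pr v))) - φ S -
      inner ℝ (G S + σ • ContinuousLinearMap.adjoint (D x) (G S)) v| ≤ _
    rw [hS]
    have : φ (S + pr w) - φ S - inner ℝ (G S + σ • ContinuousLinearMap.adjoint (D x) (G S)) v =
      (φ (S + pr w) - φ S - inner ℝ (G S) w) +
        σ * inner ℝ (G S) (V ν (x + pr v) - V ν x - D x v) := by rw [← hin]; ring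
    rw [this]
    refine (abs_add_le _ _).trans ((add_le_add t1 t2).trans (le_of_eq ?_))
    ring

/-- The pairing of the velocity with a `C^{1,1}` gradient is bounded and Lipschitz. -/
theorem Velocity.Regular.abs_inner_le {φ : Dom k₁ k₂ → ℝ} {G : Dom k₁ k₂ → Plane} {L K : ℝ}
    (h : IsC11 φ G L K) (hV : V.Regular C) (ν : ProbabilityMeasure (Dom k₁ k₂)) (x : Dom k₁ k₂) :
    |inner ℝ (V ν x) (G x)| ≤ C * L :=
  (abs_real_inner_le_norm _ _).trans (mul_le_mul (hV.bdd ν x) (h.norm_le x) (norm_nonneg _)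
    hV.nonneg)

theorem Velocity.Regular.lip_inner {φ : Dom k₁ k₂ → ℝ} {G : Dom k₁ k₂ → Plane} {L K : ℝ}
    (h : IsC11 φ G L K) (hV : V.Regular C) (ν : ProbabilityMeasure (Dom k₁ k₂)) :
    LipC (fun x => inner ℝ (V ν x) (G x)) (C * (L + 6 * K)) := fun x v => by
  have : inner ℝ (V ν (x + pr v)) (G (x + pr v)) - inner ℝ (V ν x) (G x) =
      inner ℝ (V ν (x + pr v) - V ν x) (G (x + pr v)) +
      inner ℝ (V ν x) (G (x + pr v) - G x) := by
    rw [inner_sub_left, inner_sub_right]; ring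
  have hK := h.nonneg_taylor
  rw [this, mul_add, add_mul]
  refine (norm_add_le _ _).trans (add_le_add ((norm_inner_le_norm _ _).trans ?_)
    ((norm_inner_le_norm _ _).trans ?_))
  · calc _ ≤ (C * ‖v‖) * L := mul_le_mul (hV.lip ν x v) (h.norm_le _) (norm_nonneg _)
          (by have := hV.nonneg; positivity)
      _ = _ := by ring
  · calc _ ≤ C * (6 * K * ‖v‖) := mul_le_mul (hV.bdd ν x) (h.lip_gradient x v) (norm_nonneg _)
          hV.nonneg
      _ = _ := by ring

theorem Velocity.Regular.integrable_inner {φ : Dom k₁ k₂ → ℝ} {G : Dom k₁ k₂ → Plane} {L K : ℝ}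
    (h : IsC11 φ G L K) (hV : V.Regular C) (ν : ProbabilityMeasure (Dom k₁ k₂))
    (μ : Measure (Dom k₁ k₂)) [IsFiniteMeasure μ] :
    Integrable (fun x => inner ℝ (V ν x) (G x)) μ :=
  integrable_of_bdd ⟨_, hV.abs_inner_le h ν⟩ (hV.lip_inner h ν).continuous.measurable

/-- Stability of the flux `∫ V[μ] · ∇φ dμ` in the Wasserstein distance. -/
theorem Velocity.Regular.abs_flux_sub_le {φ : Dom k₁ k₂ → ℝ} {G : Dom k₁ k₂ → Plane} {L K δ : ℝ}
    (h : IsC11 φ G L K) (hV : V.Regular C) {μ ν : ProbabilityMeasure (Dom k₁ k₂)}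
    (hd : WClose (μ : Measure (Dom k₁ k₂)) ν δ) :
    |∫ x, inner ℝ (V μ x) (G x) ∂(μ : Measure (Dom k₁ k₂)) -
      ∫ x, inner ℝ (V ν x) (G x) ∂(ν : Measure (Dom k₁ k₂))| ≤ 6 * C * (L + K) * δ := by
  -- The measure changes first, with the velocity fixed at `V μ`, and the velocity second. The costs
  -- `C (L + 6 K) δ` and `C L δ` add up to at most `6 C (L + K) δ`.
  have h1 := hd.integral_le ⟨_, hV.abs_inner_le h μ⟩ (hV.lip_inner h μ)
  have h2 : |∫ x, inner ℝ (V μ x) (G x) ∂(ν : Measure (Dom k₁ k₂)) -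
      ∫ x, inner ℝ (V ν x) (G x) ∂(ν : Measure (Dom k₁ k₂))| ≤ C * δ * L := by
    rw [← integral_sub (hV.integrable_inner h _ _) (hV.integrable_inner h _ _)]
    have := norm_integral_le_of_norm_le_const (μ := (ν : Measure (Dom k₁ k₂)))
      (f := fun x => inner ℝ (V μ x) (G x) - inner ℝ (V ν x) (G x)) (C := C * δ * L)
      (Filter.Eventually.of_forall fun x => ?_)
    · simpa using this
    · rw [← inner_sub_left]
      exact (norm_inner_le_norm _ _).trans (mul_le_mul (hV.meas μ ν δ hd x) (h.norm_le x)
        (norm_nonneg _) (mul_nonneg hV.nonneg hd.nonneg))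
  refine (abs_sub_le _ _ _).trans ((add_le_add h1 h2).trans ?_)
  have := mul_nonneg (mul_nonneg hV.nonneg h.nonneg_lip) hd.nonneg
  nlinarith

/-- First-order expansion of the push-forward along the velocity. -/
theorem Velocity.Regular.abs_flow_sub_le {φ : Dom k₁ k₂ → ℝ} {G : Dom k₁ k₂ → Plane} {L K : ℝ}
    (h : IsC11 φ G L K) (hV : V.Regular C) {σ : ℝ} (hσ : 0 ≤ σ)
    (ν : ProbabilityMeasure (Dom k₁ k₂)) :
    |∫ x, φ (x + pr (σ • V ν x)) ∂(ν : Measure (Dom k₁ k₂)) -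
      ∫ x, φ x ∂(ν : Measure (Dom k₁ k₂)) -
      σ * ∫ x, inner ℝ (V ν x) (G x) ∂(ν : Measure (Dom k₁ k₂))| ≤ K * (σ * C) ^ 2 := by
  obtain ⟨G', h'⟩ := h.comp_flow hV hσ ν
  have i1 := integrable_of_bdd (μ := (ν : Measure (Dom k₁ k₂))) h'.bdd h'.continuous.measurable
  have i2 := integrable_of_bdd (μ := (ν : Measure (Dom k₁ k₂))) h.bdd h.continuous.measurable
  have i3 : Integrable (fun x => φ (x + pr (σ • V ν x)) - φ x) (ν : Measure (Dom k₁ k₂)) :=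
    i1.sub i2
  rw [← integral_const_mul, ← integral_sub i1 i2, ← integral_sub i3
    ((hV.integrable_inner h ν ν).const_mul σ)]
  have := norm_integral_le_of_norm_le_const (μ := (ν : Measure (Dom k₁ k₂)))
    (f := fun x => φ (x + pr (σ • V ν x)) - φ x - σ * inner ℝ (V ν x) (G x))
    (C := K * (σ * C) ^ 2) (Filter.Eventually.of_forall fun x => ?_)
  · simpa using this
  · have t := h.taylor x (σ • V ν x)
    rw [inner_smul_right, real_inner_comm, norm_smul, Real.norm_of_nonneg hσ] at t
    refine t.trans ?_
    have := hV.bdd ν x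
    have := h.nonneg_taylor
    gcongr

end Regular

/-! ### Stability of one-step schemes -/

/-- `μ` follows the push-forward along `V[μ n]` up to an error `E` in each step of length `σ`. -/
def OneStep (V : Velocity k₁ k₂) (σ E : ℝ) (μ : ℕ → ProbabilityMeasure (Dom k₁ k₂)) : Prop :=
  ∀ n φ G L K, IsC11 φ G L K →
    |∫ x, φ x ∂(μ (n + 1) : Measure (Dom k₁ k₂)) -
      ∫ x, φ (x + pr (σ • V (μ n) x)) ∂(μ n : Measure (Dom k₁ k₂))| ≤ E * (L + K)

/-- Every bounded `1`-Lipschitz function is within `ε` of a `C^{1,1}` function with second-order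
constant `K`. -/
def Smoothable (k₁ k₂ : Axis) (ε K : ℝ) : Prop :=
  ∀ ψ : Dom k₁ k₂ → ℝ, (∃ B, ∀ x, |ψ x| ≤ B) → LipC ψ 1 →
    ∃ φ G, IsC11 φ G 1 K ∧ ∀ x, |φ x - ψ x| ≤ ε

theorem abs_integral_sub_le_of_abs_sub_le {μ : Measure (Dom k₁ k₂)} [IsProbabilityMeasure μ]
    {f g : Dom k₁ k₂ → ℝ} {ε : ℝ} (hf : Integrable f μ) (hg : Integrable g μ)
    (h : ∀ x, |f x - g x| ≤ ε) : |∫ x, f x ∂μ - ∫ x, g x ∂μ| ≤ ε := by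
  rw [← integral_sub hf hg]
  have := norm_integral_le_of_norm_le_const (μ := μ) (f := fun x => f x - g x) (C := ε)
    (Filter.Eventually.of_forall h)
  simpa using this

theorem wClose_of_smoothable {ε K d : ℝ} (hs : Smoothable k₁ k₂ ε K) {μ ν : Measure (Dom k₁ k₂)}
    [IsProbabilityMeasure μ] [IsProbabilityMeasure ν]
    (h : ∀ φ G, IsC11 φ G 1 K → |∫ x, φ x ∂μ - ∫ x, φ x ∂ν| ≤ d) :
    WClose μ ν (d + 2 * ε) := by
  intro ψ hb hl
  obtain ⟨φ, G, hφ, hε⟩ := hs ψ hb hl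
  have h1 := h φ G hφ
  have h2 := abs_integral_sub_le_of_abs_sub_le (μ := μ)
    (integrable_of_bdd hφ.bdd hφ.continuous.measurable)
    (integrable_of_bdd hb hl.continuous.measurable) hε
  have h3 := abs_integral_sub_le_of_abs_sub_le (μ := ν)
    (integrable_of_bdd hφ.bdd hφ.continuous.measurable)
    (integrable_of_bdd hb hl.continuous.measurable) hε
  rw [abs_le] at *
  constructor <;> linarith

/-- Gronwall's inequality in dual form. To test level `N + 1` with `φ` is to test level `N` with `φ`
composed with a step of the flow; the change from `V (μ N)` to `V (ν N)` costs `L σ C` times the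
Wasserstein distance at level `N`, which the induction hypothesis bounds at `L = 1`, `K = Kε`, up to
the smoothing loss `2 ε`. The coefficients of `L` and `K` are kept apart: `K` only meets the
accumulated error `N (2 E)`, so a large `Kε` does no harm once `M E` is small. The number `a`
collects what one step adds to the coefficient of `L`: the inflow of `L` into the second-order
constant, the two consistency errors, and the two error parts `M (2 E) Kε` and `2 ε` of the
Wasserstein bound, both weighted by `σ C`. -/
theorem abs_oneStep_sub_le {V : Velocity k₁ k₂} {C σ E ε Kε d₀ a : ℝ} (hV : V.Regular C)
    (hσ : 0 ≤ σ) (hσ1 : σ ≤ 1) (hE : 0 ≤ E) (hε : 0 ≤ ε) (hKε : 0 ≤ Kε)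
    (hs : Smoothable k₁ k₂ ε Kε) {μ ν : ℕ → ProbabilityMeasure (Dom k₁ k₂)}
    (hμ : OneStep V σ E μ) (hν : OneStep V σ E ν) (hd₀ : WClose (μ 0 : Measure (Dom k₁ k₂)) (ν 0) d₀)
    {M : ℕ} (ha : a = σ * C * (M * (2 * E)) + 2 * E + σ * C * (M * (2 * E) * Kε) +
      2 * (σ * C * ε)) :
    ∀ N : ℕ, N ≤ M → ∀ φ G L K, IsC11 φ G L K →
      |∫ x, φ x ∂(μ N : Measure (Dom k₁ k₂)) - ∫ x, φ x ∂(ν N : Measure (Dom k₁ k₂))| ≤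
        (1 + 3 * C ^ 2 * σ) ^ N * ((d₀ + N * a) * L + N * (2 * E) * K) := by
  have hC := hV.nonneg
  have hC1 := hV.one_le
  have hd0 := hd₀.nonneg
  have ha0 : 0 ≤ a := by rw [ha]; positivity
  intro N
  induction N with
  | zero =>
    intro _ φ G L K h
    have := hd₀.integral_le h.bdd h.lip
    simpa [mul_comm] using this
  | succ N ih =>
    intro hN φ G L K h
    have ih' := ih (by omega)
    have hL := h.nonneg_lip
    have hK := h.nonneg_taylor
    set q := 1 + 3 * C ^ 2 * σ with hq
    have hNM : (N : ℝ) ≤ M := by exact_mod_cast (by omega : N ≤ M)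
    have hqN : 1 ≤ q ^ N := one_le_pow₀ (by rw [hq]; nlinarith [sq_nonneg C])
    -- the current distance
    have hdN : WClose (μ N : Measure (Dom k₁ k₂)) (ν N)
        (q ^ N * ((d₀ + N * a) + N * (2 * E) * Kε) + 2 * ε) := by
      refine wClose_of_smoothable hs fun φ' G' h' => ?_
      simpa using ih' φ' G' 1 Kε h'
    obtain ⟨G', h'⟩ := h.comp_flow hV hσ (μ N)
    have e1 := hμ N φ G L K h
    have e2 := hν N φ G L K h
    have e3 := ih' _ _ _ _ h'
    obtain ⟨G'', h''⟩ := h.comp_flow hV hσ (ν N)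
    have e4 := abs_integral_sub_le_of_abs_sub_le (μ := (ν N : Measure (Dom k₁ k₂)))
      (integrable_of_bdd h'.bdd h'.continuous.measurable)
      (integrable_of_bdd h''.bdd h''.continuous.measurable)
      (ε := L * (σ * (C * (q ^ N * ((d₀ + N * a) + N * (2 * E) * Kε) + 2 * ε)))) (fun x => by
        have e : x + pr (σ • V (μ N) x) = x + pr (σ • V (ν N) x) +
            pr (σ • (V (μ N) x - V (ν N) x)) := by
          rw [smul_sub, sub_eq_add_neg, pr_add, pr_neg]; abel
        rw [e]
        refine (h.lip _ _).trans ?_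
        rw [norm_smul, Real.norm_of_nonneg hσ]
        gcongr
        exact hV.meas _ _ _ hdN x)
    have e5 : |∫ x, φ x ∂(μ (N + 1) : Measure (Dom k₁ k₂)) -
        ∫ x, φ x ∂(ν (N + 1) : Measure (Dom k₁ k₂))| ≤ 2 * (E * (L + K)) +
        q ^ N * ((d₀ + N * a) * (L * (1 + σ * C)) + N * (2 * E) *
          (K * (1 + σ * C) ^ 2 + σ * C * L)) +
        L * (σ * (C * (q ^ N * ((d₀ + N * a) + N * (2 * E) * Kε) + 2 * ε))) := by
      rw [abs_le] at *
      constructor <;> linarith [e1.1, e1.2, e2.1, e2.2, e3.1, e3.2, e4.1, e4.2]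
    refine e5.trans ?_
    push_cast
    have hCC : C ≤ C ^ 2 := by nlinarith
    -- `q` dominates both growth rates: `1 + 2 σ C` for `L`, from the flow and from the difference
    -- of the velocities, and `(1 + σ C)²` for `K`. The constant `3 C²` suffices because `1 ≤ C` and
    -- `σ ≤ 1`.
    have hq1 : 1 + 2 * (σ * C) ≤ q := by rw [hq]; nlinarith
    have hq2 : (1 + σ * C) ^ 2 ≤ q := by
      have : σ ^ 2 * C ^ 2 ≤ σ * C ^ 2 := by
        have : σ ^ 2 ≤ σ := by nlinarith
        gcongr
      rw [hq]; nlinarith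
    have hq0 : 1 ≤ q := by nlinarith [mul_nonneg hσ hC]
    -- second-order part
    have i1 : q ^ N * (N * (2 * E) * (K * (1 + σ * C) ^ 2)) + 2 * E * K ≤
        q ^ (N + 1) * ((N + 1) * (2 * E) * K) := by
      have j1 : q ^ N * (N * (2 * E) * (K * (1 + σ * C) ^ 2)) ≤ q ^ N * (N * (2 * E) * (K * q)) := by
        gcongr
      have j2 : 2 * E * K ≤ q ^ (N + 1) * (2 * E * K) :=
        le_mul_of_one_le_left (by positivity) (one_le_pow₀ hq0)
      calc _ ≤ q ^ N * (N * (2 * E) * (K * q)) + q ^ (N + 1) * (2 * E * K) := add_le_add j1 j2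
        _ = _ := by ring
    -- first-order part
    have i2 : q ^ N * ((d₀ + N * a) * (L * (1 + 2 * (σ * C)))) ≤
        q ^ N * ((d₀ + N * a) * (L * q)) := by gcongr
    have i3 : 2 * E * L + q ^ N * (N * (2 * E) * (σ * C * L)) +
        L * (σ * (C * (q ^ N * (N * (2 * E) * Kε) + 2 * ε))) ≤ q ^ (N + 1) * (a * L) := by
      have j1 : 2 * E * L ≤ q ^ N * (2 * E * L) := le_mul_of_one_le_left (by positivity) hqN
      have j2 : L * (σ * (C * (2 * ε))) ≤ q ^ N * (L * (σ * (C * (2 * ε)))) :=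
        le_mul_of_one_le_left (by positivity) hqN
      have j3 : q ^ N * (N * (2 * E) * (σ * C * L)) ≤ q ^ N * (M * (2 * E) * (σ * C * L)) := by
        gcongr
      have j4 : L * (σ * (C * (q ^ N * (N * (2 * E) * Kε)))) ≤
          L * (σ * (C * (q ^ N * (M * (2 * E) * Kε)))) := by gcongr
      have j5 : q ^ N * (a * L) ≤ q ^ (N + 1) * (a * L) := by
        gcongr; exact Nat.le_succ N
      refine le_trans ?_ j5
      rw [ha]
      calc _ = 2 * E * L + q ^ N * (N * (2 * E) * (σ * C * L)) +
          (L * (σ * (C * (q ^ N * (N * (2 * E) * Kε)))) + L * (σ * (C * (2 * ε)))) := by ring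
        _ ≤ q ^ N * (2 * E * L) + q ^ N * (M * (2 * E) * (σ * C * L)) +
          (L * (σ * (C * (q ^ N * (M * (2 * E) * Kε)))) + q ^ N * (L * (σ * (C * (2 * ε))))) := by
            gcongr
        _ = _ := by ring
    calc _ = (q ^ N * (N * (2 * E) * (K * (1 + σ * C) ^ 2)) + 2 * E * K) +
        q ^ N * ((d₀ + N * a) * (L * (1 + 2 * (σ * C)))) +
        (2 * E * L + q ^ N * (N * (2 * E) * (σ * C * L)) +
          L * (σ * (C * (q ^ N * (N * (2 * E) * Kε) + 2 * ε)))) := by ring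
      _ ≤ q ^ (N + 1) * ((N + 1) * (2 * E) * K) + q ^ N * ((d₀ + N * a) * (L * q)) +
        q ^ (N + 1) * (a * L) := add_le_add (add_le_add i1 i2) i3
      _ = _ := by ring

end

section

variable {k₁ k₂ : Axis}

/-! ### Mollification -/

/-- A smooth even probability density on the plane, supported in the ball of radius `δ`. -/
structure IsKernel (η : Plane → ℝ) (δ : ℝ) : Prop where
  contDiff : ContDiff ℝ ∞ η
  nonneg : ∀ w, 0 ≤ η w
  even : ∀ w, η (-w) = η w
  integral_eq : ∫ w, η w = 1
  eq_zero : ∀ w, δ < ‖w‖ → η w = 0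

theorem exists_isKernel {δ : ℝ} (hδ : 0 < δ) : ∃ η, IsKernel η δ := by
  let b : ContDiffBump (0 : Plane) := ⟨δ / 2, δ, by linarith, by linarith⟩
  refine ⟨b.normed volume, b.contDiff_normed, b.nonneg_normed, b.normed_neg, b.integral_normed,
    fun w hw => ?_⟩
  by_contra h
  have : w ∈ Function.support (b.normed volume) := h
  rw [b.support_normed_eq, mem_ball_zero_iff] at this
  exact absurd this (not_lt.2 hw.le)

section Kernel
variable {η : Plane → ℝ} {δ : ℝ}

theorem IsKernel.hasCompactSupport (h : IsKernel η δ) : HasCompactSupport η :=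
  HasCompactSupport.of_support_subset_isCompact (isCompact_closedBall (0 : Plane) δ) fun w hw => by
    rw [mem_closedBall_zero_iff]
    by_contra hc
    exact hw (h.eq_zero w (not_le.1 hc))

theorem IsKernel.continuous (h : IsKernel η δ) : Continuous η := h.contDiff.continuous

theorem IsKernel.integrable (h : IsKernel η δ) : Integrable η :=
  h.continuous.integrable_of_hasCompactSupport h.hasCompactSupport

/-- For `|v| ≤ 1` both supports lie in a ball of radius `δ + 1`, and the Lipschitz constant of `η`
gives the bound. For `|v| > 1` the trivial bound 2 is below `2 |v|`. -/
theorem IsKernel.exists_lip (h : IsKernel η δ) :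
    ∃ K : ℝ, 0 ≤ K ∧ ∀ v : Plane, ∫ w, |η (w - v) - η w| ≤ K * ‖v‖ := by
  obtain ⟨Λ, hΛ⟩ := (h.contDiff.of_le (n := (∞ : WithTop ℕ∞)) (m := 1) (by simp)).lipschitzWith_of_hasCompactSupport
    h.hasCompactSupport one_ne_zero
  set B : Set Plane := Metric.closedBall 0 (δ + 1)
  refine ⟨Λ * volume.real B + 2, by positivity, fun v => ?_⟩
  rcases le_or_gt ‖v‖ 1 with hv | hv
  · have h1 : ∀ w, |η (w - v) - η w| ≤ B.indicator (fun _ => Λ * ‖v‖) w := by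
      intro w
      by_cases hw : w ∈ B
      · rw [Set.indicator_of_mem hw]
        have := hΛ.dist_le_mul (w - v) w
        rwa [Real.dist_eq, dist_eq_norm, sub_sub_cancel_left, norm_neg] at this
      · rw [Set.indicator_of_notMem hw]
        rw [mem_closedBall_zero_iff, not_le] at hw
        rw [h.eq_zero w (by linarith), h.eq_zero (w - v)]
        · simp
        · have := norm_sub_norm_le w v
          linarith
    refine (integral_mono_of_nonneg (Filter.Eventually.of_forall fun w => abs_nonneg _) ?_
      (Filter.Eventually.of_forall h1)).trans ?_
    · exact (integrable_indicator_iff measurableSet_closedBall).2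
        (integrableOn_const (measure_closedBall_lt_top.ne))
    · rw [integral_indicator measurableSet_closedBall, setIntegral_const, smul_eq_mul]
      nlinarith [norm_nonneg v]
  · have i1 : Integrable (fun w => η (w - v)) := h.integrable.comp_sub_right v
    calc ∫ w, |η (w - v) - η w| ≤ ∫ w, (η (w - v) + η w) := by
          refine integral_mono (i1.sub h.integrable).abs (i1.add h.integrable) fun w => ?_
          refine (abs_sub _ _).trans ?_
          rw [abs_of_nonneg (h.nonneg _), abs_of_nonneg (h.nonneg _)]
      _ = 2 := by
          rw [integral_add i1 h.integrable, integral_sub_right_eq_self, h.integral_eq]; norm_num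
      _ ≤ (Λ * volume.real B + 2) * ‖v‖ := by
          have : 0 ≤ Λ * volume.real B := by positivity
          nlinarith

/-- The average `∫ η(w) ψ(x + w) dw`. -/
def moll (η : Plane → ℝ) (ψ : Dom k₁ k₂ → ℝ) (x : Dom k₁ k₂) : ℝ :=
  ∫ w, η w * ψ (x + pr w)

variable {ψ φ : Dom k₁ k₂ → ℝ} {B L K : ℝ}

theorem measurable_pr : Measurable (pr : Plane → Dom k₁ k₂) := continuous_pr.measurable

theorem IsKernel.integrable_mul (h : IsKernel η δ) {g : Plane → ℝ} (hb : ∃ B, ∀ x, |g x| ≤ B)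
    (hm : Measurable g) : Integrable (fun w => η w * g w) := by
  obtain ⟨B, hB⟩ := hb
  exact h.integrable.mul_bdd (c := B) hm.aestronglyMeasurable (Filter.Eventually.of_forall hB)

theorem IsKernel.integrable_shift (h : IsKernel η δ) (hb : ∃ B, ∀ x, |ψ x| ≤ B)
    (hm : Measurable ψ) (x : Dom k₁ k₂) : Integrable (fun w => η w * ψ (x + pr w)) := by
  obtain ⟨B, hB⟩ := hb
  exact h.integrable_mul ⟨B, fun w => hB _⟩ (hm.comp (measurable_pr.const_add x))

theorem IsKernel.abs_integral_mul_le (h : IsKernel η δ) {g : Plane → ℝ} {c : ℝ}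
    (hg : ∀ w, ‖w‖ ≤ δ → |g w| ≤ c) : |∫ w, η w * g w| ≤ c := by
  have : ‖∫ w, η w * g w‖ ≤ ∫ w, η w * c := by
    refine norm_integral_le_of_norm_le (h.integrable.mul_const c)
      (Filter.Eventually.of_forall fun w => ?_)
    rw [Real.norm_eq_abs, abs_mul, abs_of_nonneg (h.nonneg w)]
    rcases le_or_gt ‖w‖ δ with hw | hw
    · exact mul_le_mul_of_nonneg_left (hg w hw) (h.nonneg w)
    · simp [h.eq_zero w hw]
  rwa [integral_mul_const, h.integral_eq, one_mul] at this

theorem IsKernel.abs_moll_le (h : IsKernel η δ) (hb : ∀ x, |ψ x| ≤ B) (x : Dom k₁ k₂) :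
    |moll η ψ x| ≤ B := h.abs_integral_mul_le fun _ _ => hb _

theorem IsKernel.abs_moll_sub_le (h : IsKernel η δ) (hb : ∃ B, ∀ x, |ψ x| ≤ B)
    (hm : Measurable ψ) {c : ℝ} {x : Dom k₁ k₂}
    (hc : ∀ w : Plane, ‖w‖ ≤ δ → |ψ (x + pr w) - ψ x| ≤ c) : |moll η ψ x - ψ x| ≤ c := by
  have : moll η ψ x - ψ x = ∫ w, η w * (ψ (x + pr w) - ψ x) := by
    simp_rw [mul_sub]
    rw [integral_sub (h.integrable_shift hb hm x) (h.integrable.mul_const _), integral_mul_const,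
      h.integral_eq, one_mul, moll]
  rw [this]
  exact h.abs_integral_mul_le hc

theorem IsKernel.abs_moll_sub_le_of_lip (h : IsKernel η δ) (hb : ∃ B, ∀ x, |ψ x| ≤ B)
    (hl : LipC ψ L) (x : Dom k₁ k₂) : |moll η ψ x - ψ x| ≤ L * δ :=
  h.abs_moll_sub_le hb hl.continuous.measurable fun w hw =>
    (hl x w).trans (mul_le_mul_of_nonneg_left hw hl.nonneg)

theorem IsKernel.moll_sub (h : IsKernel η δ) (hb : ∃ B, ∀ x, |ψ x| ≤ B) (hm : Measurable ψ)
    (hb' : ∃ B, ∀ x, |φ x| ≤ B) (hm' : Measurable φ) (x : Dom k₁ k₂) :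
    moll η (fun y => ψ y - φ y) x = moll η ψ x - moll η φ x := by
  simp only [moll, mul_sub]
  exact integral_sub (h.integrable_shift hb hm x) (h.integrable_shift hb' hm' x)

theorem moll_shift (x : Dom k₁ k₂) (v : Plane) :
    moll η (fun y => ψ (y + pr v)) x = moll η ψ (x + pr v) := by
  simp only [moll, add_right_comm]

theorem IsKernel.lipC_moll (h : IsKernel η δ) (hb : ∃ B, ∀ x, |ψ x| ≤ B) (hl : LipC ψ L) :
    LipC (moll η ψ) L := fun x v => by
  have hm := hl.continuous.measurable
  have hb' : ∃ B, ∀ x, |ψ (x + pr v)| ≤ B := hb.imp fun B hB x => hB _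
  rw [← moll_shift, ← h.moll_sub hb' (hm.comp (measurable_id.add_const _)) hb hm]
  exact h.abs_moll_le (fun y => hl y v) x

/-- The translation passes from `ψ` to the kernel, so boundedness of `ψ` is enough; this applies to
sign functions. -/
theorem IsKernel.lipC_moll_of_bdd (h : IsKernel η δ)
    (hK : ∀ v : Plane, ∫ w, |η (w - v) - η w| ≤ K * ‖v‖) (hb : ∀ x, |ψ x| ≤ B)
    (hm : Measurable ψ) (hB : 0 ≤ B) : LipC (moll η ψ) (B * K) := fun x v => by
  have e : moll η ψ (x + pr v) = ∫ w, η (w - v) * ψ (x + pr w) := by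
    rw [moll, ← integral_sub_right_eq_self _ v]
    refine integral_congr_ae (Filter.Eventually.of_forall fun w => ?_)
    simp only [add_assoc, ← pr_add]
    rw [add_sub_cancel]
  have i1 : Integrable (fun w => η (w - v) * ψ (x + pr w)) :=
    (h.integrable.comp_sub_right v).mul_bdd (c := B)
      (hm.comp (measurable_pr.const_add x)).aestronglyMeasurable
      (Filter.Eventually.of_forall fun w => hb _)
  have i2 : Integrable (fun w => |η (w - v) - η w|) :=
    ((h.integrable.comp_sub_right v).sub h.integrable).abs
  rw [e, moll, ← integral_sub i1 (h.integrable_shift ⟨B, hb⟩ hm x)]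
  have : ‖∫ w, (η (w - v) * ψ (x + pr w) - η w * ψ (x + pr w))‖ ≤
      ∫ w, |η (w - v) - η w| * B := by
    refine norm_integral_le_of_norm_le (i2.mul_const B) (Filter.Eventually.of_forall fun w => ?_)
    rw [← sub_mul, Real.norm_eq_abs, abs_mul]
    gcongr; exact hb _
  refine this.trans ?_
  rw [integral_mul_const]
  calc _ ≤ K * ‖v‖ * B := by gcongr; exact hK v
    _ = _ := by ring

open scoped Convolution in
-- Lifted to the plane, the average is a convolution, since evenness turns `η(w - u)` into `η(u -
-- w)`.
theorem IsKernel.contDiff_moll (h : IsKernel η δ) (hb : ∃ B, ∀ x, |ψ x| ≤ B) (hm : Measurable ψ) :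
    ContDiff ℝ ∞ (fun u : Plane => moll η ψ (pr u)) := by
  obtain ⟨B, hB⟩ := hb
  have hl : LocallyIntegrable (fun u : Plane => ψ (pr u)) := by
    refine (locallyIntegrable_const B).mono (hm.comp measurable_pr).aestronglyMeasurable
      (Filter.Eventually.of_forall fun u => ?_)
    exact (hB _).trans (le_abs_self B)
  have := h.hasCompactSupport.contDiff_convolution_right (ContinuousLinearMap.mul ℝ ℝ) hl
    (n := ⊤) (μ := volume) h.contDiff
  convert this using 2 with u
  rw [moll, MeasureTheory.convolution_def, ← integral_sub_right_eq_self _ u]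
  refine integral_congr_ae (Filter.Eventually.of_forall fun w => ?_)
  simp only [ContinuousLinearMap.mul_apply', ← pr_add, add_sub_cancel]
  rw [← h.even, neg_sub, mul_comm]

/-- The gradient of a function on `𝕂₁ × 𝕂₂`. -/
def grad (φ : Dom k₁ k₂ → ℝ) (x : Dom k₁ k₂) : Plane :=
  gradient (fun v : Plane => φ (x + pr v)) 0

theorem grad_pr (φ : Dom k₁ k₂ → ℝ) (u : Plane) :
    grad φ (pr u) = gradient (fun u : Plane => φ (pr u)) u := by
  have := fderiv_comp_add_left (𝕜 := ℝ) (f := fun u : Plane => φ (pr u)) u (x := 0)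
  simp only [pr_add, add_zero] at this
  rw [grad, gradient, gradient, this]

theorem isC11_of_smooth (hb : ∃ B, ∀ x, |φ x| ≤ B) (hl : LipC φ L) (hK : 0 ≤ K)
    (hd : Differentiable ℝ (fun u : Plane => φ (pr u)))
    (hL : ∀ u w, ‖fderiv ℝ (fun u : Plane => φ (pr u)) u - fderiv ℝ (fun u : Plane => φ (pr u)) w‖
      ≤ K * ‖u - w‖) : IsC11 φ (grad φ) L K := by
  refine ⟨hb, hl, fun x => ?_, fun x v => ?_⟩
  · obtain ⟨u, rfl⟩ := pr_surjective x
    rw [grad_pr, gradient, LinearIsometryEquiv.norm_map]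
    refine (norm_fderiv_le_of_lipschitz ℝ (C := L.toNNReal)
        (LipschitzWith.of_dist_le_mul fun u w => ?_)).trans ?_
    · rw [Real.coe_toNNReal _ hl.nonneg, dist_eq_norm, dist_eq_norm]
      have := hl (pr w) (u - w)
      rwa [← pr_add, add_sub_cancel] at this
    · rw [Real.coe_toNNReal _ hl.nonneg]
  · obtain ⟨u, rfl⟩ := pr_surjective x
    have := norm_taylor_le hK hd hL u v
    rw [grad_pr, gradient, InnerProductSpace.toDual_symm_apply, ← pr_add]
    exact this

/-- An increment of the gradient is the gradient of the mollified increment `ψ(· + v) - ψ`. This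
increment is bounded by `L |v|`, so by `lipC_moll_of_bdd` its mollification has Lipschitz constant
`L |v| K`. -/
theorem IsKernel.isC11_moll (h : IsKernel η δ)
    (hK : ∀ v : Plane, ∫ w, |η (w - v) - η w| ≤ K * ‖v‖) (hK0 : 0 ≤ K)
    (hb : ∃ B, ∀ x, |ψ x| ≤ B) (hl : LipC ψ L) :
    IsC11 (moll η ψ) (grad (moll η ψ)) L (L * K) := by
  have hm := hl.continuous.measurable
  have hL := hl.nonneg
  have hd : Differentiable ℝ (fun u : Plane => moll η ψ (pr u)) :=
    (h.contDiff_moll hb hm).differentiable (by simp)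
  refine isC11_of_smooth ?_ (h.lipC_moll hb hl) (by positivity) hd fun u w => ?_
  · obtain ⟨B, hB⟩ := hb
    exact ⟨B, h.abs_moll_le hB⟩
  · set v := u - w with hv
    have hb' : ∃ B, ∀ x, |ψ (x + pr v)| ≤ B := hb.imp fun B hB x => hB _
    have hm' : Measurable fun x => ψ (x + pr v) := hm.comp (measurable_id.add_const _)
    have e1 : fderiv ℝ (fun u : Plane => moll η ψ (pr u)) u -
        fderiv ℝ (fun u : Plane => moll η ψ (pr u)) w =
        fderiv ℝ (fun z : Plane => moll η (fun y => ψ (y + pr v) - ψ y) (pr z)) w := by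
      have e2 : (fun z : Plane => moll η (fun y => ψ (y + pr v) - ψ y) (pr z)) =
          fun z : Plane => moll η ψ (pr (z + v)) - moll η ψ (pr z) := by
        ext z
        rw [h.moll_sub hb' hm' hb hm, moll_shift, pr_add]
      rw [e2, fderiv_fun_sub, fderiv_comp_add_right (f := fun u : Plane => moll η ψ (pr u)), hv,
        add_sub_cancel]
      · exact hd.differentiableAt.comp w (by fun_prop)
      · exact hd.differentiableAt
    rw [e1]
    have hlip := h.lipC_moll_of_bdd hK (ψ := fun y => ψ (y + pr v) - ψ y) (B := L * ‖v‖)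
      (fun y => hl y v) (hm'.sub hm) (by positivity)
    refine (norm_fderiv_le_of_lipschitz ℝ (C := (L * ‖v‖ * K).toNNReal)
      (LipschitzWith.of_dist_le_mul fun a b => ?_)).trans ?_
    · rw [Real.coe_toNNReal _ (by positivity), dist_eq_norm, dist_eq_norm]
      have := hlip (pr b) (a - b)
      rwa [← pr_add, add_sub_cancel] at this
    · rw [Real.coe_toNNReal _ (by positivity)]
      exact le_of_eq (by ring)

theorem IsC11.integrable_gradient {G : Dom k₁ k₂ → Plane} (hφ : IsC11 φ G L K)
    (h : IsKernel η δ) (x : Dom k₁ k₂) : Integrable (fun w => η w • G (x + pr w)) := by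
  refine (h.integrable.mul_const L).mono' ((h.continuous.smul (hφ.continuous_gradient.comp
    (continuous_pr.const_add x))).aestronglyMeasurable) (Filter.Eventually.of_forall fun w => ?_)
  rw [norm_smul, Real.norm_of_nonneg (h.nonneg w)]
  exact mul_le_mul_of_nonneg_left (hφ.norm_le _) (h.nonneg w)

theorem IsKernel.norm_integral_smul_le (h : IsKernel η δ) {g : Plane → Plane} {c : ℝ}
    (hg : ∀ w, ‖w‖ ≤ δ → ‖g w‖ ≤ c) : ‖∫ w, η w • g w‖ ≤ c := by
  have : ‖∫ w, η w • g w‖ ≤ ∫ w, η w * c := by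
    refine norm_integral_le_of_norm_le (h.integrable.mul_const c)
      (Filter.Eventually.of_forall fun w => ?_)
    rw [norm_smul, Real.norm_of_nonneg (h.nonneg w)]
    rcases le_or_gt ‖w‖ δ with hw | hw
    · exact mul_le_mul_of_nonneg_left (hg w hw) (h.nonneg w)
    · simp [h.eq_zero w hw]
  rwa [integral_mul_const, h.integral_eq, one_mul] at this

/-- Mollification preserves the constants of a `C^{1,1}` function. -/
theorem IsC11.mollify {G : Dom k₁ k₂ → Plane} (hφ : IsC11 φ G L K) (h : IsKernel η δ) :
    IsC11 (moll η φ) (fun x => ∫ w, η w • G (x + pr w)) L K := by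
  have hL := hφ.nonneg_lip
  have hi := hφ.integrable_gradient h
  have hm := hφ.continuous.measurable
  refine ⟨?_, h.lipC_moll hφ.bdd hφ.lip, fun x => ?_, fun x v => ?_⟩
  · obtain ⟨B, hB⟩ := hφ.bdd
    exact ⟨B, h.abs_moll_le hB⟩
  · exact h.norm_integral_smul_le fun _ _ => hφ.norm_le _
  · have e : moll η φ (x + pr v) - moll η φ x -
        inner ℝ (∫ w, η w • G (x + pr w)) v =
        ∫ w, η w * (φ (x + pr w + pr v) - φ (x + pr w) - inner ℝ (G (x + pr w)) v) := by
      simp_rw [mul_sub]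
      have i1 := h.integrable_shift hφ.bdd hm (x + pr v)
      simp_rw [add_right_comm x (pr v)] at i1
      have i2 := h.integrable_shift hφ.bdd hm x
      have i3 : Integrable (fun w => η w * inner ℝ (G (x + pr w)) v) := by
        have := (hi x).inner_const (𝕜 := ℝ) v
        simpa only [inner_smul_left, conj_trivial] using this
      have i12 : Integrable (fun w => η w * φ (x + pr w + pr v) - η w * φ (x + pr w)) := i1.sub i2
      rw [integral_sub i12 i3, integral_sub i1 i2, real_inner_comm,
        ← integral_inner (hi x)]
      simp only [moll, add_right_comm x (pr v), inner_smul_right, real_inner_comm]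
    rw [e]
    exact h.abs_integral_mul_le fun w _ => hφ.taylor _ v

theorem IsC11.moll_gradient_sub_le {G : Dom k₁ k₂ → Plane} (hφ : IsC11 φ G L K)
    (h : IsKernel η δ) (x : Dom k₁ k₂) : ‖(∫ w, η w • G (x + pr w)) - G x‖ ≤ 6 * K * δ := by
  have : (∫ w, η w • G (x + pr w)) - G x = ∫ w, η w • (G (x + pr w) - G x) := by
    simp_rw [smul_sub]
    rw [integral_sub (hφ.integrable_gradient h x) (h.integrable.smul_const _), integral_smul_const,
      h.integral_eq, one_smul]
  rw [this]
  have := hφ.lip_gradient.nonneg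
  exact h.norm_integral_smul_le fun w hw => (hφ.lip_gradient x w).trans (by gcongr)

/-- `K` depends on `ε` alone and not on the function to be smoothed; the Gronwall argument relies on
this uniformity. -/
theorem exists_smoothable {ε : ℝ} (hε : 0 < ε) : ∃ K, 0 ≤ K ∧ Smoothable k₁ k₂ ε K := by
  obtain ⟨η, h⟩ := exists_isKernel hε
  obtain ⟨K, hK0, hK⟩ := h.exists_lip
  refine ⟨K, hK0, fun ψ hb hl => ⟨moll η ψ, grad (moll η ψ), ?_, fun x => ?_⟩⟩
  · simpa using h.isC11_moll hK hK0 hb hl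
  · simpa using h.abs_moll_sub_le_of_lip hb hl x

end Kernel

end

section

variable {k₁ k₂ : Axis}

instance instIsAddHaarMeasureDom : (volume : Measure (Dom k₁ k₂)).IsAddHaarMeasure :=
  inferInstanceAs ((volume.prod volume : Measure (k₁.Space × k₂.Space)).IsAddHaarMeasure)

/-! ### Approximate solutions and their stability -/

/-- A curve of measures that solves the continuity equation up to an error governed by `h`. -/
structure IsApprox (V : Velocity k₁ k₂) (A h : ℝ) (ν : ℝ → ProbabilityMeasure (Dom k₁ k₂)) :
    Prop where
  close : ∀ s t, 0 ≤ s → s ≤ t →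
    WClose (ν s : Measure (Dom k₁ k₂)) (ν t) (A * (t - s + h))
  step : ∀ s t, 0 ≤ s → s ≤ t → t ≤ s + 1 → ∀ φ G L K, IsC11 φ G L K →
    |∫ x, φ x ∂(ν t : Measure (Dom k₁ k₂)) - ∫ x, φ x ∂(ν s : Measure (Dom k₁ k₂)) -
      (t - s) * ∫ x, inner ℝ (V (ν s) x) (G x) ∂(ν s : Measure (Dom k₁ k₂))| ≤
      A * ((t - s) ^ 2 + h) * (L + K)

section
variable {V : Velocity k₁ k₂} {C A h : ℝ} {ν : ℝ → ProbabilityMeasure (Dom k₁ k₂)}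

theorem IsApprox.mono (hν : IsApprox V A h ν) (hh : 0 ≤ h) {A' h' : ℝ} (hA : A ≤ A')
    (hA0 : 0 ≤ A') (hh' : h ≤ h') : IsApprox V A' h' ν where
  close s t hs hst := (hν.close s t hs hst).mono (by gcongr)
  step s t hs hst ht φ G L K hφ := (hν.step s t hs hst ht φ G L K hφ).trans (by
    have := hφ.nonneg_lip
    have := hφ.nonneg_taylor
    gcongr)

/-- The curve and the push-forward along `id + σ V` have the same first-order expansion. The term `C
^ 2 * σ ^ 2` is the second-order remainder of the push-forward. -/
theorem IsApprox.oneStep (hV : V.Regular C) (hν : IsApprox V A h ν)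
    {σ : ℝ} (hσ : 0 ≤ σ) (hσ1 : σ ≤ 1) :
    OneStep V σ (A * (σ ^ 2 + h) + C ^ 2 * σ ^ 2) (fun n => ν (n * σ)) := by
  intro n φ G L K hφ
  have h1 := hν.step (n * σ) ((n + 1 : ℕ) * σ) (by positivity) (by push_cast; nlinarith)
    (by push_cast; nlinarith) φ G L K hφ
  have h2 := hV.abs_flow_sub_le hφ hσ (ν (n * σ))
  have e : ((n + 1 : ℕ) : ℝ) * σ - n * σ = σ := by push_cast; ring
  rw [e] at h1
  have hL := hφ.nonneg_lip
  have h3 : 0 ≤ C ^ 2 * σ ^ 2 * L := by positivity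
  rw [abs_le] at *
  constructor <;> nlinarith [h1.1, h1.2, h2.1, h2.2]

/-- Approximate solutions that start close to each other remain close, uniformly on bounded time
intervals. -/
theorem exists_stability (hV : V.Regular C) {T ε' : ℝ} (hA : 0 ≤ A) (hT : 0 ≤ T) (hε' : 0 < ε') :
    ∃ η > 0, ∀ h d₀ : ℝ, 0 ≤ h → h ≤ η → d₀ ≤ η →
      ∀ μ ν : ℝ → ProbabilityMeasure (Dom k₁ k₂), IsApprox V A h μ → IsApprox V A h ν →
      WClose (μ 0 : Measure (Dom k₁ k₂)) (ν 0) d₀ →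
      ∀ t, 0 ≤ t → t ≤ T → WClose (μ t : Measure (Dom k₁ k₂)) (ν t) ε' := by
  have hC := hV.nonneg
  set X := Real.exp (3 * C ^ 2 * T) with hX
  have hX0 : 0 < X := Real.exp_pos _
  -- The order of the choices separates the errors: first the smoothing scale `ε`, which fixes `Kε`;
  -- then the number `M` of steps, so that a multiple of `Kε / M` is small; last the bounds of `h`
  -- and `d₀`, which may depend on `M`.
  set ε := ε' / (4 * (X * (T * C) + 1)) with hε
  have hXTC : 0 ≤ X * (T * C) := by positivity
  have hε0 : 0 < ε := by positivity
  have hεle : X * (2 * (T * C * ε)) + 2 * ε = ε' / 2 := by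
    rw [hε]; field_simp; ring
  obtain ⟨Kε, hK0, hs⟩ := exists_smoothable (k₁ := k₁) (k₂ := k₂) hε0
  set B := X * (2 * (T * C + 1 + T * C * Kε + Kε)) with hB
  have hB0 : 0 ≤ B := by positivity
  obtain ⟨M, hM⟩ := exists_nat_gt (max (T + 1) (B * ((A + C ^ 2) * T ^ 2) / (ε' / 8)))
  have hM1 : T + 1 < M := (le_max_left _ _).trans_lt hM
  have hM0 : (0 : ℝ) < M := by linarith
  have hM2 : B * ((A + C ^ 2) * T ^ 2) / M ≤ ε' / 8 := by
    have := (le_max_right _ _).trans_lt hM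
    rw [div_lt_iff₀ (by positivity)] at this
    rw [div_le_iff₀ hM0]; linarith
  refine ⟨min (ε' / 8 / (X + 1)) (ε' / 8 / (B * A * M + 1)), by positivity, ?_⟩
  intro h d₀ hh0 hh hd₀ μ ν hμ hν hd t ht0 htT
  -- The curves are compared over `M` long steps whose number does not depend on `h`. The error `h`
  -- is therefore paid only `M` times, however fine the time steps behind the curves are.
  set σ := t / M with hσ
  have hσ0 : 0 ≤ σ := by positivity
  have hσM : M * σ = t := by rw [hσ]; field_simp
  have hσ1 : σ ≤ 1 := by rw [hσ, div_le_one hM0]; linarith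
  set E := A * (σ ^ 2 + h) + C ^ 2 * σ ^ 2 with hE
  have hE0 : 0 ≤ E := by positivity
  obtain ⟨a, ha⟩ : ∃ a, a = σ * C * (M * (2 * E)) + 2 * E + σ * C * (M * (2 * E) * Kε) +
      2 * (σ * C * ε) := ⟨_, rfl⟩
  have key := abs_oneStep_sub_le hV hσ0 hσ1 hE0 hε0.le hK0 hs (hμ.oneStep hV hσ0 hσ1)
    (hν.oneStep hV hσ0 hσ1) (d₀ := d₀) (by simpa using hd) (M := M) ha M le_rfl
  have hfin := wClose_of_smoothable hs (μ := (μ t : Measure (Dom k₁ k₂))) (ν := ν t)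
    (fun φ G hφ => by simpa only [hσM] using key φ G 1 Kε hφ)
  refine hfin.mono ?_
  have hq : (1 + 3 * C ^ 2 * σ) ^ M ≤ X := by
    rw [hX]
    calc (1 + 3 * C ^ 2 * σ) ^ M ≤ (Real.exp (3 * C ^ 2 * σ)) ^ M := by
          gcongr; rw [add_comm]; exact Real.add_one_le_exp _
      _ = Real.exp (3 * C ^ 2 * t) := by rw [← Real.exp_nat_mul, ← hσM]; ring_nf
      _ ≤ _ := by gcongr
  have hd0' := hd.nonneg
  set ρ := M * E with hρ
  have hρ0 : 0 ≤ ρ := by positivity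
  have hρle : ρ ≤ (A + C ^ 2) * T ^ 2 / M + A * h * M := by
    have : ρ = (A + C ^ 2) * t ^ 2 / M + A * h * M := by
      rw [hρ, hE, hσ]; field_simp; ring
    rw [this]; gcongr
  have hMa : (d₀ + M * a) * 1 + M * (2 * E) * Kε ≤
      d₀ + 2 * ρ * (T * C + 1 + T * C * Kε + Kε) + 2 * (T * C * ε) := by
    have : (d₀ + M * a) * 1 + M * (2 * E) * Kε =
      d₀ + 2 * ρ * (t * C + 1 + t * C * Kε + Kε) + 2 * (t * C * ε) := by
      rw [ha, ← hσM, hρ]; ring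
    rw [this]; gcongr
  have ha0 : 0 ≤ a := by rw [ha]; positivity
  have hstep : (1 + 3 * C ^ 2 * σ) ^ M * ((d₀ + M * a) * 1 + M * (2 * E) * Kε) ≤
      X * (d₀ + 2 * ρ * (T * C + 1 + T * C * Kε + Kε) + 2 * (T * C * ε)) :=
    mul_le_mul hq hMa (by positivity) hX0.le
  clear_value ρ ε B X E σ
  have e1 : X * d₀ ≤ ε' / 8 := by
    have := hd₀.trans (min_le_left _ _)
    rw [le_div_iff₀ (by positivity)] at this
    linarith
  have e2 : B * (A * h * M) ≤ ε' / 8 := by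
    have := hh.trans (min_le_right _ _)
    rw [le_div_iff₀ (by positivity)] at this
    linarith
  have e3 : B * ρ ≤ B * ((A + C ^ 2) * T ^ 2 / M) + B * (A * h * M) := by
    rw [← mul_add]; gcongr
  have e4 : B * ((A + C ^ 2) * T ^ 2 / M) = B * ((A + C ^ 2) * T ^ 2) / M := by ring
  have e5 : X * (d₀ + 2 * ρ * (T * C + 1 + T * C * Kε + Kε) + 2 * (T * C * ε)) =
      X * d₀ + B * ρ + X * (2 * (T * C * ε)) := by rw [hB]; ring
  linarith

end

/-! ### Interpolation between the Wasserstein distance and a translation modulus -/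

/-- `‖f(· + w) - f‖₁ ≤ M |w|`. -/
def ShiftBound (f : Dom k₁ k₂ → ℝ) (M : ℝ) : Prop :=
  ∀ w : Plane, ∫ x, |f (x + pr w) - f x| ≤ M * ‖w‖

theorem ShiftBound.mono {f : Dom k₁ k₂ → ℝ} {M M' : ℝ} (h : ShiftBound f M) (hM : M ≤ M') :
    ShiftBound f M' := fun w => (h w).trans (by gcongr)

theorem ShiftBound.sub {f g : Dom k₁ k₂ → ℝ} {M M' : ℝ} (hf : Integrable f) (hg : Integrable g)
    (h : ShiftBound f M) (h' : ShiftBound g M') : ShiftBound (fun x => f x - g x) (M + M') := by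
  intro w
  have i1 : Integrable fun x => |f (x + pr w) - f x| := ((hf.comp_add_right (pr w)).sub hf).abs
  have i2 : Integrable fun x => |g (x + pr w) - g x| := ((hg.comp_add_right (pr w)).sub hg).abs
  rw [add_mul]
  refine le_trans ?_ (add_le_add (h w) (h' w))
  rw [← integral_add i1 i2]
  refine integral_mono_of_nonneg (Filter.Eventually.of_forall fun x => abs_nonneg _) (i1.add i2)
    (Filter.Eventually.of_forall fun x => ?_)
  change |f (x + pr w) - g (x + pr w) - (f x - g x)| ≤ |f (x + pr w) - f x| + |g (x + pr w) - g x|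
  rw [sub_sub_sub_comm]
  exact abs_sub _ _

/-- With `s` the sign of `g`, split `∫ |g|` into `∫ g (s - moll η s)` and `∫ g (moll η s)`. In the
first integral the translations move to `g` and cost at most `M δ`. In the second the test function
is bounded and Lipschitz with constant `K`, so the dual bound `K d` applies. -/
theorem integral_abs_le_of_shiftBound {g : Dom k₁ k₂ → ℝ} {η : Plane → ℝ} {δ K M d : ℝ}
    (hη : IsKernel η δ) (hK : ∀ v : Plane, ∫ w, |η (w - v) - η w| ≤ K * ‖v‖)
    (hg : Integrable g) (hgm : Measurable g) (hM : ShiftBound g M) (hM0 : 0 ≤ M)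
    (hd : ∀ ψ : Dom k₁ k₂ → ℝ, (∃ B, ∀ x, |ψ x| ≤ B) → LipC ψ K → |∫ x, g x * ψ x| ≤ K * d) :
    ∫ x, |g x| ≤ M * δ + K * d := by
  classical
  set s : Dom k₁ k₂ → ℝ := fun x => if 0 ≤ g x then 1 else -1 with hs
  have hsm : Measurable s :=
    Measurable.ite (measurableSet_le measurable_const hgm) measurable_const measurable_const
  have hsb : ∀ x, |s x| ≤ 1 := fun x => by
    simp only [hs]; split_ifs <;> simp
  have hgs : ∀ x, |g x| = g x * s x := fun x => by
    simp only [hs]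
    split_ifs with h
    · rw [abs_of_nonneg h, mul_one]
    · rw [abs_of_neg (not_le.1 h), mul_neg_one]
  have hlip : LipC (moll η s) K := by
    simpa using hη.lipC_moll_of_bdd hK hsb hsm zero_le_one
  have hmc := hlip.continuous.measurable
  have hmb : ∀ x, |moll η s x| ≤ 1 := hη.abs_moll_le hsb
  have i1 : Integrable (fun x => g x * s x) :=
    hg.mul_bdd (c := 1) hsm.aestronglyMeasurable (Filter.Eventually.of_forall hsb)
  have i2 : Integrable (fun x => g x * moll η s x) :=
    hg.mul_bdd (c := 1) hmc.aestronglyMeasurable (Filter.Eventually.of_forall hmb)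
  have hsplit : ∫ x, |g x| = (∫ x, (g x * s x - g x * moll η s x)) + ∫ x, g x * moll η s x := by
    rw [integral_sub i1 i2]; simp only [hgs]; ring
  have hprod : Integrable (Function.uncurry fun (x : Dom k₁ k₂) (w : Plane) =>
      η w * (g x * (s x - s (x + pr w)))) (volume.prod volume) := by
    refine ((hg.mul_prod hη.integrable).norm.const_mul 2).mono' ?_
      (Filter.Eventually.of_forall fun z => ?_)
    · have : Measurable fun z : Dom k₁ k₂ × Plane => s (z.1 + pr z.2) :=
        hsm.comp (measurable_fst.add (measurable_pr.comp measurable_snd))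
      exact ((hη.continuous.measurable.comp measurable_snd).mul ((hgm.comp measurable_fst).mul
        ((hsm.comp measurable_fst).sub this))).aestronglyMeasurable
    · simp only [Function.uncurry, norm_mul]
      have : ‖s z.1 - s (z.1 + pr z.2)‖ ≤ 2 := by
        refine (norm_sub_le _ _).trans ?_
        have := hsb z.1
        have := hsb (z.1 + pr z.2)
        simp only [Real.norm_eq_abs]; linarith
      calc ‖η z.2‖ * (‖g z.1‖ * ‖s z.1 - s (z.1 + pr z.2)‖) ≤ ‖η z.2‖ * (‖g z.1‖ * 2) := by gcongr
        _ = _ := by ring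
  have hfub : ∫ x, (g x * s x - g x * moll η s x) =
      ∫ w, η w * ∫ x, g x * (s x - s (x + pr w)) := by
    have e1 : ∀ x, g x * s x - g x * moll η s x = ∫ w, η w * (g x * (s x - s (x + pr w))) := by
      intro x
      have e : ∀ w, η w * (g x * (s x - s (x + pr w))) =
          g x * (η w * s x) - g x * (η w * s (x + pr w)) := fun w => by ring
      simp_rw [e]
      rw [integral_sub ((hη.integrable.mul_const _).const_mul _)
        ((hη.integrable_shift ⟨1, hsb⟩ hsm x).const_mul _), integral_const_mul, integral_const_mul,
        integral_mul_const, hη.integral_eq, one_mul, moll]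
    simp_rw [e1]
    rw [integral_integral_swap hprod]
    simp_rw [integral_const_mul]
  have hin : ∀ w : Plane, |∫ x, g x * (s x - s (x + pr w))| ≤ M * ‖w‖ := by
    intro w
    have i3 : Integrable (fun x => g x * s (x + pr w)) :=
      hg.mul_bdd (c := 1) (hsm.comp (measurable_id.add_const _)).aestronglyMeasurable
        (Filter.Eventually.of_forall fun x => hsb _)
    have i4 : Integrable (fun x => g (x + pr (-w)) * s x) :=
      (hg.comp_add_right (pr (-w))).mul_bdd (c := 1) hsm.aestronglyMeasurable
        (Filter.Eventually.of_forall hsb)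
    have e2 : ∫ x, g x * s (x + pr w) = ∫ x, g (x + pr (-w)) * s x := by
      rw [← integral_add_right_eq_self _ (pr (-w))]
      refine integral_congr_ae (Filter.Eventually.of_forall fun x => ?_)
      simp only [pr_neg, neg_add_cancel_right]
    have e3 : ∫ x, g x * (s x - s (x + pr w)) = ∫ x, (g x - g (x + pr (-w))) * s x := by
      simp_rw [mul_sub, sub_mul]
      rw [integral_sub i1 i3, integral_sub i1 i4, e2]
    have hMw := hM (-w)
    rw [norm_neg] at hMw
    rw [e3]
    refine le_trans ?_ hMw
    rw [← Real.norm_eq_abs]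
    refine norm_integral_le_of_norm_le ((hg.comp_add_right (pr (-w))).sub hg).abs
      (Filter.Eventually.of_forall fun x => ?_)
    rw [norm_mul, norm_sub_rev]
    exact mul_le_of_le_one_right (norm_nonneg _) (hsb x)
  have h1 : |∫ w, η w * ∫ x, g x * (s x - s (x + pr w))| ≤ M * δ :=
    hη.abs_integral_mul_le fun w hw => (hin w).trans (by gcongr)
  have h2 := hd _ ⟨1, hmb⟩ hlip
  rw [hsplit, hfub]
  exact add_le_add ((le_abs_self _).trans h1) ((le_abs_self _).trans h2)

/-- The measure with density `f`. -/
abbrev densityMeasure (f : Dom k₁ k₂ → ℝ) : Measure (Dom k₁ k₂) :=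
  volume.withDensity fun x => ENNReal.ofReal (f x)

theorem integral_densityMeasure {f : Dom k₁ k₂ → ℝ} (hf : Measurable f) (h0 : ∀ x, 0 ≤ f x)
    (ψ : Dom k₁ k₂ → ℝ) : ∫ x, ψ x ∂(densityMeasure f) = ∫ x, f x * ψ x := by
  rw [integral_withDensity_eq_integral_toReal_smul hf.ennreal_ofReal
    (Filter.Eventually.of_forall fun x => ENNReal.ofReal_lt_top)]
  simp only [ENNReal.toReal_ofReal (h0 _), smul_eq_mul]

theorem integrable_of_densityMeasure {f : Dom k₁ k₂ → ℝ} (hf : Measurable f) (h0 : ∀ x, 0 ≤ f x)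
    [IsFiniteMeasure (densityMeasure f)] : Integrable f := by
  refine ⟨hf.aestronglyMeasurable, ?_⟩
  have := measure_lt_top (densityMeasure f) Set.univ
  rw [withDensity_apply _ MeasurableSet.univ, Measure.restrict_univ] at this
  rw [HasFiniteIntegral]
  simpa only [Real.enorm_of_nonneg (h0 _)] using this

/-- Nonnegative densities that are close in the Wasserstein distance and satisfy a translation
estimate are close in `L¹`. -/
theorem exists_integral_abs_sub_le {M ε : ℝ} (hM : 0 ≤ M) (hε : 0 < ε) :
    ∃ d > 0, ∀ f g : Dom k₁ k₂ → ℝ, Measurable f → Measurable g → (∀ x, 0 ≤ f x) →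
      (∀ x, 0 ≤ g x) → IsFiniteMeasure (densityMeasure f) → IsFiniteMeasure (densityMeasure g) →
      ShiftBound f M → ShiftBound g M → WClose (densityMeasure f) (densityMeasure g) d →
      ∫ x, |f x - g x| ≤ ε := by
  -- The translation constant of `f - g` is `2 M`, and the radius makes its contribution at most `ε
  -- / 2`. Only then is `d` chosen, against the Lipschitz constant `K` of this kernel.
  obtain ⟨η, hη⟩ := exists_isKernel (δ := ε / (2 * (2 * M + 1))) (by positivity)
  obtain ⟨K, hK0, hK⟩ := hη.exists_lip
  refine ⟨ε / (2 * (K + 1)), by positivity, fun f g hf hg hf0 hg0 _ _ hfM hgM hW => ?_⟩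
  have hfi := integrable_of_densityMeasure hf hf0
  have hgi := integrable_of_densityMeasure hg hg0
  have := integral_abs_le_of_shiftBound (g := fun x => f x - g x) hη hK (hfi.sub hgi) (hf.sub hg)
    (hfM.sub hfi hgi hgM) (by linarith) (d := ε / (2 * (K + 1))) (fun ψ hb hl => by
      have h1 := hW.integral_le hb hl
      rw [integral_densityMeasure hf hf0, integral_densityMeasure hg hg0] at h1
      obtain ⟨B, hB⟩ := hb
      have hψ := hl.continuous.measurable.aestronglyMeasurable (μ := volume)
      rw [← integral_sub (hfi.mul_bdd (c := B) hψ (Filter.Eventually.of_forall hB))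
        (hgi.mul_bdd (c := B) hψ (Filter.Eventually.of_forall hB))] at h1
      simpa only [sub_mul] using h1)
  refine this.trans ?_
  have e1 : (M + M) * (ε / (2 * (2 * M + 1))) ≤ ε / 2 := by
    rw [mul_div_assoc', div_le_div_iff₀ (by positivity) (by positivity)]; nlinarith
  have e2 : K * (ε / (2 * (K + 1))) ≤ ε / 2 := by
    rw [mul_div_assoc', div_le_div_iff₀ (by positivity) (by positivity)]; nlinarith
  linarith

end

/-! ### A weak formulation of an ordinary differential equation on the half-line -/

/-- A smooth cut-off in time that descends from `1` to `0` on `[t, t + ε]`. -/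
theorem exists_ramp {t ε : ℝ} (ht : 0 ≤ t) (hε : 0 < ε) :
    ∃ χ : ℝ → ℝ, ContDiff ℝ ∞ χ ∧ HasCompactSupport χ ∧ (∀ r, 0 ≤ r → r ≤ t → χ r = 1) ∧
      (∀ r, t + ε ≤ r → χ r = 0) ∧ (∀ r, 0 ≤ χ r) ∧ (∀ r, χ r ≤ 1) ∧
      (∀ r, 0 < r → deriv χ r ≤ 0) ∧ (∀ r, 0 < r → r ∉ Set.Icc t (t + ε) → deriv χ r = 0) := by
  set ρ : ℝ → ℝ := fun r => Real.smoothTransition ((t + ε - r) / ε) with hρ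
  -- The first factor is 1 for `r ≥ -1` and 0 for `r ≤ -2`. It makes the support compact and leaves
  -- positive times untouched.
  set χ : ℝ → ℝ := fun r => Real.smoothTransition (r + 2) * ρ r with hχ
  have hρanti : Antitone ρ := fun a b hab =>
    Real.smoothTransition.monotone (by gcongr)
  have hχρ : ∀ r, -1 ≤ r → χ r = ρ r := fun r hr => by
    rw [hχ]; simp only
    rw [Real.smoothTransition.one_of_one_le (by linarith), one_mul]
  have h1 : ∀ r, -1 ≤ r → r ≤ t → χ r = 1 := fun r hr hrt => by
    rw [hχρ r hr, hρ]
    exact Real.smoothTransition.one_of_one_le (by rw [one_le_div hε]; linarith)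
  have h0 : ∀ r, t + ε ≤ r → χ r = 0 := fun r hr => by
    rw [hχρ r (by linarith), hρ]
    exact Real.smoothTransition.zero_of_nonpos (div_nonpos_of_nonpos_of_nonneg (by linarith) hε.le)
  have hev : ∀ r, 0 < r → χ =ᶠ[nhds r] ρ := fun r hr => by
    filter_upwards [lt_mem_nhds (by linarith : -1 < r)] with y hy using hχρ y hy.le
  refine ⟨χ, ?_, ?_, fun r hr => h1 r (by linarith), h0, fun r => ?_, fun r => ?_, fun r hr => ?_,
    fun r hr hrt => ?_⟩
  · exact (Real.smoothTransition.contDiff.comp (contDiff_id.add contDiff_const)).mul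
      (Real.smoothTransition.contDiff.comp ((contDiff_const.sub contDiff_id).div_const _))
  · refine HasCompactSupport.intro (isCompact_Icc (a := -2) (b := t + ε)) fun r hr => ?_
    rw [Set.mem_Icc, not_and_or, not_le, not_le] at hr
    rcases hr with hr | hr
    · rw [hχ]; simp only
      rw [Real.smoothTransition.zero_of_nonpos (by linarith), zero_mul]
    · exact h0 r hr.le
  · exact mul_nonneg (Real.smoothTransition.nonneg _) (Real.smoothTransition.nonneg _)
  · exact mul_le_one₀ (Real.smoothTransition.le_one _) (Real.smoothTransition.nonneg _)
      (Real.smoothTransition.le_one _)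
  · rw [(hev r hr).deriv_eq]
    exact hρanti.deriv_nonpos
  · rw [Set.mem_Icc, not_and_or, not_le, not_le] at hrt
    rcases hrt with hrt | hrt
    · have : χ =ᶠ[nhds r] fun _ => 1 := by
        filter_upwards [lt_mem_nhds (by linarith : -1 < r), gt_mem_nhds hrt] with y hy hy'
        exact h1 y hy.le hy'.le
      rw [this.deriv_eq, deriv_const]
    · have : χ =ᶠ[nhds r] fun _ => 0 := by
        filter_upwards [lt_mem_nhds hrt] with y hy
        exact h0 y hy.le
      rw [this.deriv_eq, deriv_const]

section WeakODE
open Set Filter Topology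

variable {m F : ℝ → ℝ} {m₀ c b : ℝ}

/-- `m' = F`, `m(0) = m₀` in the sense of distributions on `[0, ∞)`. -/
def WeakODE (m F : ℝ → ℝ) (m₀ : ℝ) : Prop :=
  ∀ χ : ℝ → ℝ, ContDiff ℝ ∞ χ → HasCompactSupport χ →
    IntegrableOn (fun r => deriv χ r * m r + χ r * F r) (Ioi 0) ∧
    (∫ r in Ioi (0 : ℝ), (deriv χ r * m r + χ r * F r)) + χ 0 * m₀ = 0

theorem integrableOn_deriv_mul (hm : Continuous m) {χ : ℝ → ℝ} (hχ : ContDiff ℝ ∞ χ)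
    (hχc : HasCompactSupport χ) : IntegrableOn (fun r => deriv χ r * m r) (Ioi 0) :=
  (((hχ.continuous_deriv (by simp)).mul hm).integrable_of_hasCompactSupport
    hχc.deriv.mul_right).integrableOn

/-- Only the sum of the two terms is known to be integrable. Continuity of `m` makes the first one
integrable, and so the second. -/
theorem WeakODE.ramp (h : WeakODE m F m₀) (hm : Continuous m) {χ : ℝ → ℝ} (hχ : ContDiff ℝ ∞ χ)
    (hχc : HasCompactSupport χ) (hχ1 : χ 0 = 1) :
    IntegrableOn (fun r => χ r * F r) (Ioi 0) ∧
    -∫ r in Ioi (0 : ℝ), deriv χ r * m r = m₀ + ∫ r in Ioi (0 : ℝ), χ r * F r := by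
  obtain ⟨h1, h2⟩ := h χ hχ hχc
  have h3 := integrableOn_deriv_mul hm hχ hχc
  have h4 : IntegrableOn (fun r => χ r * F r) (Ioi 0) := by
    have := h1.sub h3
    refine this.congr_fun (fun r _ => ?_) measurableSet_Ioi
    simp
  refine ⟨h4, ?_⟩
  rw [integral_add h3 h4, hχ1, one_mul] at h2
  linarith

/-- On positive times `-χ'` is a probability density carried by `[t, t + ε]`, so the integral is an
average of `m` near `t`. -/
theorem abs_ramp_sub_le (hm : Continuous m) {χ : ℝ → ℝ} {t ε e : ℝ} (hχ : ContDiff ℝ ∞ χ)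
    (hχc : HasCompactSupport χ) (hχ1 : χ 0 = 1) (hd : ∀ r, 0 < r → deriv χ r ≤ 0)
    (hd0 : ∀ r, 0 < r → r ∉ Icc t (t + ε) → deriv χ r = 0)
    (he : ∀ r ∈ Icc t (t + ε), |m r - m t| ≤ e) :
    |-(∫ r in Ioi (0 : ℝ), deriv χ r * m r) - m t| ≤ e := by
  have i1 : ∫ r in Ioi (0 : ℝ), deriv χ r = -1 := by
    rw [hχc.integral_Ioi_deriv_eq (hχ.of_le (by simp)), hχ1]
  have i2 : IntegrableOn (deriv χ) (Ioi 0) :=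
    ((hχ.continuous_deriv (by simp)).integrable_of_hasCompactSupport hχc.deriv).integrableOn
  have e1 : -(∫ r in Ioi (0 : ℝ), deriv χ r * m r) - m t =
      -∫ r in Ioi (0 : ℝ), deriv χ r * (m r - m t) := by
    simp_rw [mul_sub]
    rw [integral_sub (integrableOn_deriv_mul hm hχ hχc) (i2.mul_const _), integral_mul_const, i1]
    ring
  rw [e1, abs_neg]
  have : ‖∫ r in Ioi (0 : ℝ), deriv χ r * (m r - m t)‖ ≤ ∫ r in Ioi (0 : ℝ), -deriv χ r * e := by
    refine norm_integral_le_of_norm_le (i2.neg.mul_const e) ?_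
    filter_upwards [ae_restrict_mem measurableSet_Ioi] with r hr
    rw [norm_mul, Real.norm_eq_abs, Real.norm_eq_abs, abs_of_nonpos (hd r hr)]
    by_cases hrt : r ∈ Icc t (t + ε)
    · exact mul_le_mul_of_nonneg_left (he r hrt) (by linarith [hd r hr])
    · simp [hd0 r hr hrt]
  rw [integral_mul_const, integral_neg, i1] at this
  simpa using this

/-- The difference of a ramp at `t` and a ramp at `s` approximates the indicator of `[s, t]`. The
ramp at `t` reaches slightly beyond `t`, which explains the margin `ε₀`; no continuity of `F` is
used. -/
theorem WeakODE.abs_increment_le (h : WeakODE m F m₀) (hm : Continuous m) {s t ε₀ : ℝ}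
    (hs : 0 ≤ s) (hst : s ≤ t) (hε₀ : 0 < ε₀) (hF : ∀ r ∈ Icc s (t + ε₀), |F r - c| ≤ b) :
    |m t - m s - (t - s) * c| ≤ (t - s) * b := by
  rcases hst.eq_or_lt with rfl | hst
  · simp
  have hb : 0 ≤ b := (abs_nonneg _).trans (hF s ⟨le_rfl, by linarith⟩)
  refine le_of_forall_pos_le_add fun e he => ?_
  obtain ⟨δ₁, hδ₁, hδ₁'⟩ := Metric.continuousAt_iff.1 (hm.continuousAt (x := t)) (e / 4) (by linarith)
  obtain ⟨δ₂, hδ₂, hδ₂'⟩ := Metric.continuousAt_iff.1 (hm.continuousAt (x := s)) (e / 4) (by linarith)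
  -- `ε ≤ t - s` makes the ramp at `s` vanish before the ramp at `t` descends, so that `θ ≤ χ` on
  -- nonnegative times. The last condition pays for the error `ε` in the mass of `χ - θ`.
  obtain ⟨ε, hε, hεle⟩ : ∃ ε > 0, ε ≤ ε₀ ∧ ε ≤ t - s ∧ ε < δ₁ ∧ ε < δ₂ ∧ (|c| + b) * ε ≤ e / 2 := by
    refine ⟨min (min ε₀ (t - s)) (min (min (δ₁ / 2) (δ₂ / 2)) (e / (2 * (|c| + b + 1)))), ?_,
      ?_, ?_, ?_, ?_, ?_⟩
    · have : 0 < t - s := by linarith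
      positivity
    · exact (min_le_left _ _).trans (min_le_left _ _)
    · exact (min_le_left _ _).trans (min_le_right _ _)
    · refine ((min_le_right _ _).trans ((min_le_left _ _).trans (min_le_left _ _))).trans_lt ?_
      linarith
    · refine ((min_le_right _ _).trans ((min_le_left _ _).trans (min_le_right _ _))).trans_lt ?_
      linarith
    · calc _ ≤ (|c| + b) * (e / (2 * (|c| + b + 1))) := by
            gcongr; exact (min_le_right _ _).trans (min_le_right _ _)
        _ ≤ e / 2 := by
            have := abs_nonneg c
            rw [mul_div_assoc', div_le_div_iff₀ (by positivity) (by positivity)]; nlinarith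
  obtain ⟨hε1, hε2, hε3, hε4, hε5⟩ := hεle
  obtain ⟨χ, χs, χc, χ1, χ0, χn, χl, χd, χe⟩ := exists_ramp (hs.trans hst.le) hε
  obtain ⟨θ, θs, θc, θ1, θ0, θn, θl, θd, θe⟩ := exists_ramp hs hε
  have χ10 := χ1 0 le_rfl (hs.trans hst.le)
  have θ10 := θ1 0 le_rfl hs
  obtain ⟨χi, χeq⟩ := h.ramp hm χs χc χ10
  obtain ⟨θi, θeq⟩ := h.ramp hm θs θc θ10
  have a1 := abs_ramp_sub_le hm χs χc χ10 χd χe (e := e / 4) (fun r hr => by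
    refine (hδ₁' ?_).le
    rw [Real.dist_eq, abs_of_nonneg (by linarith [hr.1])]
    linarith [hr.2])
  have a2 := abs_ramp_sub_le hm θs θc θ10 θd θe (e := e / 4) (fun r hr => by
    refine (hδ₂' ?_).le
    rw [Real.dist_eq, abs_of_nonneg (by linarith [hr.1])]
    linarith [hr.2])
  have hnn : ∀ r, 0 ≤ r → 0 ≤ χ r - θ r := fun r hr => by
    rcases le_or_gt r t with hrt | hrt
    · rw [χ1 r hr hrt]; linarith [θl r]
    · rw [θ0 r (by linarith)]; linarith [χn r]
  have hχint : IntegrableOn χ (Ioi 0) := (χs.continuous.integrable_of_hasCompactSupport χc).integrableOn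
  have hθint : IntegrableOn θ (Ioi 0) := (θs.continuous.integrable_of_hasCompactSupport θc).integrableOn
  -- the mass of the difference of the two ramps
  have hmass : |(∫ r in Ioi (0 : ℝ), (χ r - θ r)) - (t - s)| ≤ ε := by
    have key : ∀ (f : ℝ → ℝ) (u : ℝ), 0 ≤ u → IntegrableOn f (Ioi 0) → (∀ r, 0 ≤ r → r ≤ u → f r = 1) →
        (∀ r, u + ε ≤ r → f r = 0) → (∀ r, 0 ≤ f r) → (∀ r, f r ≤ 1) →
        u ≤ ∫ r in Ioi (0 : ℝ), f r ∧ ∫ r in Ioi (0 : ℝ), f r ≤ u + ε := by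
      intro f u hu hfi hf1 hf0 hfn hfl
      have int1 : ∀ w : ℝ, 0 ≤ w → ∫ r in Ioi (0 : ℝ), (Ioc 0 w).indicator (fun _ => (1 : ℝ)) r = w := by
        intro w hw
        rw [setIntegral_indicator measurableSet_Ioc, setIntegral_const,
          inter_eq_self_of_subset_right Ioc_subset_Ioi_self]
        simp [hw]
      have int2 : ∀ w : ℝ, IntegrableOn ((Ioc 0 w).indicator (fun _ => (1 : ℝ))) (Ioi 0) := fun w =>
        ((integrable_indicator_iff measurableSet_Ioc).2
          (integrableOn_const (by simp))).integrableOn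
      constructor
      · rw [← int1 u hu]
        refine setIntegral_mono_on (int2 u) hfi measurableSet_Ioi fun r hr => ?_
        by_cases hru : r ∈ Ioc 0 u
        · rw [indicator_of_mem hru, hf1 r hru.1.le hru.2]
        · rw [indicator_of_notMem hru]; exact hfn r
      · rw [← int1 (u + ε) (by linarith)]
        refine setIntegral_mono_on hfi (int2 _) measurableSet_Ioi fun r hr => ?_
        by_cases hru : r ∈ Ioc 0 (u + ε)
        · rw [indicator_of_mem hru]; exact hfl r
        · rw [indicator_of_notMem hru, hf0 r]
          by_contra hc
          exact hru ⟨hr, (not_le.1 hc).le⟩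
    have k1 := key χ t (by linarith) hχint χ1 χ0 χn χl
    have k2 := key θ s hs hθint θ1 θ0 θn θl
    rw [integral_sub hχint hθint, abs_le]
    constructor <;> linarith [k1.1, k1.2, k2.1, k2.2]
  have hint : IntegrableOn (fun r => χ r - θ r) (Ioi 0) := hχint.sub hθint
  have hdiff : |(∫ r in Ioi (0 : ℝ), χ r * F r) - (∫ r in Ioi (0 : ℝ), θ r * F r) -
      c * ∫ r in Ioi (0 : ℝ), (χ r - θ r)| ≤ b * ∫ r in Ioi (0 : ℝ), (χ r - θ r) := by
    have hi : IntegrableOn (fun r => χ r * F r - θ r * F r) (Ioi 0) := χi.sub θi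
    rw [← integral_sub χi θi, ← integral_const_mul, ← integral_sub hi (hint.const_mul c),
      ← integral_const_mul, ← Real.norm_eq_abs]
    refine norm_integral_le_of_norm_le (hint.const_mul b) ?_
    filter_upwards [ae_restrict_mem measurableSet_Ioi] with r hr
    have e : χ r * F r - θ r * F r - c * (χ r - θ r) = (F r - c) * (χ r - θ r) := by ring
    have hr0 : (0 : ℝ) ≤ r := le_of_lt hr
    rw [e, norm_mul, Real.norm_eq_abs, Real.norm_of_nonneg (hnn r hr0)]
    by_cases hrs : r ∈ Icc s (t + ε)
    · exact mul_le_mul_of_nonneg_right (hF r ⟨hrs.1, by linarith [hrs.2]⟩) (hnn r hr0)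
    · have : χ r - θ r = 0 := by
        rw [mem_Icc, not_and_or, not_le, not_le] at hrs
        rcases hrs with hrs | hrs
        · rw [χ1 r hr0 (by linarith), θ1 r hr0 hrs.le, sub_self]
        · rw [χ0 r hrs.le, θ0 r (by linarith), sub_self]
      simp [this]
  have hmass' := abs_le.1 hmass
  set J := ∫ r in Ioi (0 : ℝ), (χ r - θ r)
  have b1 : |c * (J - (t - s))| ≤ |c| * ε := by
    rw [abs_mul]; gcongr
  have b2 : b * J ≤ b * (t - s) + b * ε := by
    rw [← mul_add]; exact mul_le_mul_of_nonneg_left (by linarith) hb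
  rw [χeq] at a1
  rw [θeq] at a2
  rw [abs_le] at *
  constructor <;> linarith [a1.1, a1.2, a2.1, a2.2, hdiff.1, hdiff.2, b1.1, b1.2]

theorem WeakODE.initial (h : WeakODE m F m₀) (hm : Continuous m) (hF : ∀ r, |F r| ≤ b) :
    m 0 = m₀ := by
  have hb : 0 ≤ b := (abs_nonneg _).trans (hF 0)
  refine eq_of_abs_sub_nonpos (le_of_forall_pos_le_add fun e he => ?_)
  obtain ⟨δ₁, hδ₁, hδ₁'⟩ := Metric.continuousAt_iff.1 (hm.continuousAt (x := 0)) (e / 2) (by linarith)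
  set ε := min (δ₁ / 2) (e / (2 * (b + 1))) with hε
  have hε0 : 0 < ε := by positivity
  have hε1 : ε < δ₁ := (min_le_left _ _).trans_lt (by linarith)
  have hε2 : b * ε ≤ e / 2 := by
    calc _ ≤ b * (e / (2 * (b + 1))) := by gcongr; exact min_le_right _ _
      _ ≤ e / 2 := by
          rw [mul_div_assoc', div_le_div_iff₀ (by positivity) (by positivity)]; nlinarith
  obtain ⟨χ, χs, χc, χ1, χ0, χn, χl, χd, χe⟩ := exists_ramp le_rfl hε0
  have χ10 := χ1 0 le_rfl le_rfl
  obtain ⟨χi, χeq⟩ := h.ramp hm χs χc χ10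
  have a1 := abs_ramp_sub_le hm χs χc χ10 χd χe (e := e / 2) (fun r hr => by
    refine (hδ₁' ?_).le
    rw [Real.dist_eq, abs_of_nonneg (by linarith [hr.1])]
    linarith [hr.2])
  have a2 : |∫ r in Ioi (0 : ℝ), χ r * F r| ≤ b * ε := by
    have : ‖∫ r in Ioi (0 : ℝ), χ r * F r‖ ≤
        ∫ r in Ioi (0 : ℝ), (Ioc 0 ε).indicator (fun _ => b) r := by
      refine norm_integral_le_of_norm_le ((integrable_indicator_iff measurableSet_Ioc).2
          (integrableOn_const (by simp))).integrableOn ?_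
      filter_upwards [ae_restrict_mem measurableSet_Ioi] with r hr
      by_cases hr' : r ∈ Ioc 0 ε
      · rw [indicator_of_mem hr', norm_mul, Real.norm_of_nonneg (χn r)]
        calc χ r * |F r| ≤ 1 * b := mul_le_mul (χl r) (hF r) (abs_nonneg _) zero_le_one
          _ = b := one_mul b
      · rw [indicator_of_notMem hr', χ0 r]
        · simp
        · by_contra hc
          exact hr' ⟨hr, by linarith⟩
    rw [setIntegral_indicator measurableSet_Ioc, setIntegral_const,
      inter_eq_self_of_subset_right Ioc_subset_Ioi_self] at this
    simpa [hε0.le, mul_comm] using this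
  rw [χeq] at a1
  rw [abs_le] at *
  constructor <;> linarith [a1.1, a1.2, a2.1, a2.2]

end WeakODE

section

variable {k₁ k₂ : Axis}

/-! ### Partial derivatives of `C^{1,1}` functions -/

theorem hasDerivAt_of_quadratic {f : ℝ → ℝ} {c K : ℝ}
    (h : ∀ r, |f r - f 0 - r * c| ≤ K * r ^ 2) : HasDerivAt f c 0 := by
  rw [hasDerivAt_iff_isLittleO_nhds_zero]
  have h1 : (fun r : ℝ => f (0 + r) - f 0 - r • c) =O[nhds 0] fun r => r ^ 2 :=
    Asymptotics.IsBigO.of_bound K (Filter.Eventually.of_forall fun r => by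
      simpa using h r)
  exact h1.trans_isLittleO (by simpa using Asymptotics.isLittleO_pow_id (𝕜 := ℝ) one_lt_two)

theorem add_pr_fst (x : Dom k₁ k₂) (r : ℝ) : x + pr (!₂[r, 0]) = (x.1 + k₁.proj r, x.2) := by
  ext <;> simp [pr, Axis.proj_zero]

theorem add_pr_snd (x : Dom k₁ k₂) (r : ℝ) : x + pr (!₂[0, r]) = (x.1, x.2 + k₂.proj r) := by
  ext <;> simp [pr, Axis.proj_zero]

theorem inner_plane (v w : Plane) : inner ℝ v w = v 0 * w 0 + v 1 * w 1 := by
  simp [PiLp.inner_apply, mul_comm]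

theorem norm_plane_fst (r : ℝ) : ‖(!₂[r, 0] : Plane)‖ = |r| := by
  rw [norm_plane]; simp [Real.sqrt_sq_eq_abs]

theorem norm_plane_snd (r : ℝ) : ‖(!₂[0, r] : Plane)‖ = |r| := by
  rw [norm_plane]; simp [Real.sqrt_sq_eq_abs]

section
variable {φ : Dom k₁ k₂ → ℝ} {G : Dom k₁ k₂ → Plane} {L K : ℝ}

theorem IsC11.hasDerivAt_fst (h : IsC11 φ G L K) (x : Dom k₁ k₂) :
    HasDerivAt (fun r : ℝ => φ (x.1 + k₁.proj r, x.2)) (G x 0) 0 := by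
  refine hasDerivAt_of_quadratic (K := K) fun r => ?_
  have := h.taylor x (!₂[r, 0])
  rw [add_pr_fst, norm_plane_fst, sq_abs, inner_plane] at this
  simpa [Axis.proj_zero, mul_comm] using this

theorem IsC11.hasDerivAt_snd (h : IsC11 φ G L K) (x : Dom k₁ k₂) :
    HasDerivAt (fun r : ℝ => φ (x.1, x.2 + k₂.proj r)) (G x 1) 0 := by
  refine hasDerivAt_of_quadratic (K := K) fun r => ?_
  have := h.taylor x (!₂[0, r])
  rw [add_pr_snd, norm_plane_snd, sq_abs, inner_plane] at this
  simpa [Axis.proj_zero, mul_comm] using this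

theorem IsC11.pderiv₁ (h : IsC11 φ G L K) (x : Dom k₁ k₂) : pderiv₁ φ x = G x 0 :=
  (h.hasDerivAt_fst x).deriv

theorem IsC11.pderiv₂ (h : IsC11 φ G L K) (x : Dom k₁ k₂) : pderiv₂ φ x = G x 1 :=
  (h.hasDerivAt_snd x).deriv

theorem IsC11.const_mul (h : IsC11 φ G L K) (c : ℝ) :
    IsC11 (fun x => c * φ x) (fun x => c • G x) (|c| * L) (|c| * K) where
  bdd := by
    obtain ⟨B, hB⟩ := h.bdd
    exact ⟨|c| * B, fun x => by rw [abs_mul]; gcongr; exact hB x⟩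
  lip x v := by
    rw [← mul_sub, norm_mul, Real.norm_eq_abs, mul_assoc]; gcongr; exact h.lip x v
  norm_le x := by rw [norm_smul, Real.norm_eq_abs]; gcongr; exact h.norm_le x
  taylor x v := by
    rw [inner_smul_left, conj_trivial, ← mul_sub, ← mul_sub, abs_mul, mul_assoc]
    gcongr; exact h.taylor x v

theorem IsC11.mul {χ : Dom k₁ k₂ → ℝ} {H : Dom k₁ k₂ → Plane} {L' K' B : ℝ}
    (h : IsC11 φ G L K) (h' : IsC11 χ H L' K') (hB : ∀ x, |φ x| ≤ B) (hχ : ∀ x, |χ x| ≤ 1) :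
    IsC11 (fun x => χ x * φ x) (fun x => χ x • G x + φ x • H x) (L + B * L')
      (K + B * K' + L * L') where
  bdd := ⟨B, fun x => by
    rw [abs_mul]
    exact (mul_le_of_le_one_left (abs_nonneg _) (hχ x)).trans (hB x)⟩
  lip x v := by
    have e : χ (x + pr v) * φ (x + pr v) - χ x * φ x =
      χ x * (φ (x + pr v) - φ x) + φ (x + pr v) * (χ (x + pr v) - χ x) := by ring
    rw [e, add_mul, mul_assoc B]
    refine (norm_add_le _ _).trans (add_le_add ?_ ?_)
    · rw [norm_mul]
      exact (mul_le_of_le_one_left (norm_nonneg _) (hχ x)).trans (h.lip x v)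
    · rw [norm_mul]
      exact mul_le_mul (hB _) (h'.lip x v) (norm_nonneg _) ((abs_nonneg _).trans (hB x))
  norm_le x := by
    refine (norm_add_le _ _).trans (add_le_add ?_ ?_)
    · rw [norm_smul]
      exact (mul_le_of_le_one_left (norm_nonneg _) (hχ x)).trans (h.norm_le x)
    · rw [norm_smul]
      exact mul_le_mul (hB _) (h'.norm_le x) (norm_nonneg _) ((abs_nonneg _).trans (hB x))
  taylor x v := by
    have e : χ (x + pr v) * φ (x + pr v) - χ x * φ x - inner ℝ (χ x • G x + φ x • H x) v =
      χ x * (φ (x + pr v) - φ x - inner ℝ (G x) v) +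
      φ x * (χ (x + pr v) - χ x - inner ℝ (H x) v) +
      (φ (x + pr v) - φ x) * (χ (x + pr v) - χ x) := by
      rw [inner_add_left, inner_smul_left, inner_smul_left]
      simp only [conj_trivial]; ring
    rw [e]
    have e1 : |χ x * (φ (x + pr v) - φ x - inner ℝ (G x) v)| ≤ K * ‖v‖ ^ 2 := by
      rw [abs_mul]
      exact (mul_le_of_le_one_left (abs_nonneg _) (hχ x)).trans (h.taylor x v)
    have e2 : |φ x * (χ (x + pr v) - χ x - inner ℝ (H x) v)| ≤ B * (K' * ‖v‖ ^ 2) := by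
      rw [abs_mul]
      exact mul_le_mul (hB _) (h'.taylor x v) (abs_nonneg _) ((abs_nonneg _).trans (hB x))
    have e3 : |(φ (x + pr v) - φ x) * (χ (x + pr v) - χ x)| ≤ (L * ‖v‖) * (L' * ‖v‖) := by
      rw [abs_mul]
      exact mul_le_mul (h.lip x v) (h'.lip x v) (abs_nonneg _)
        (mul_nonneg h.nonneg_lip (norm_nonneg v))
    calc _ ≤ K * ‖v‖ ^ 2 + B * (K' * ‖v‖ ^ 2) + (L * ‖v‖) * (L' * ‖v‖) :=
          (abs_add_le _ _).trans (add_le_add ((abs_add_le _ _).trans (add_le_add e1 e2)) e3)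
      _ = _ := by ring

end

/-! ### Test functions -/

theorem contDiff_plane : ContDiff ℝ ∞ fun u : ℝ × ℝ => (!₂[u.1, u.2] : Plane) :=
  contDiff_euclidean.2 fun i => by
    fin_cases i
    · exact contDiff_fst
    · exact contDiff_snd

theorem isTest_of_contDiff {φ : Dom k₁ k₂ → ℝ}
    (h : ContDiff ℝ ∞ fun u : Plane => φ (pr u)) (hc : HasCompactSupport φ) : IsTest φ :=
  ⟨h.comp contDiff_plane, hc⟩

theorem IsTest.contDiff_plane {φ : Dom k₁ k₂ → ℝ} (h : IsTest φ) :
    ContDiff ℝ ∞ fun u : Plane => φ (pr u) := by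
  have h1 : ContDiff ℝ ∞ fun u : Plane => (u 0, u 1) :=
    (contDiff_euclidean.1 contDiff_id 0).prodMk (contDiff_euclidean.1 contDiff_id 1)
  exact h.1.comp h1

theorem IsTest.isSpaceTimeTest {ψ : Dom k₁ k₂ → ℝ} (h : IsTest ψ) {χ : ℝ → ℝ}
    (hχ : ContDiff ℝ ∞ χ) (hχc : HasCompactSupport χ) :
    IsSpaceTimeTest fun z : Dom k₁ k₂ × ℝ => χ z.2 * ψ z.1 := by
  refine ⟨(hχ.comp contDiff_snd).mul (h.1.comp contDiff_fst), ?_⟩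
  refine HasCompactSupport.intro (h.2.isCompact.prod hχc.isCompact) fun z hz => ?_
  rw [Set.mem_prod, not_and_or] at hz
  rcases hz with hz | hz
  · simp [image_eq_zero_of_notMem_tsupport hz]
  · simp [image_eq_zero_of_notMem_tsupport hz]

theorem norm_pr_le (v : Plane) : ‖(pr v : Dom k₁ k₂)‖ ≤ ‖v‖ := by
  rw [Prod.norm_def]
  exact max_le ((k₁.norm_proj_le _).trans (abs_coord_le v 0))
    ((k₂.norm_proj_le _).trans (abs_coord_le v 1))

/-- A Lipschitz cut-off at radius `R`. -/
def cutoff (R : ℝ) (x : Dom k₁ k₂) : ℝ := max 0 (min 1 (2 - ‖x‖ / R))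

theorem abs_cutoff_le (R : ℝ) (x : Dom k₁ k₂) : |cutoff R x| ≤ 1 := by
  rw [cutoff, abs_of_nonneg (le_max_left _ _)]
  exact max_le zero_le_one (min_le_left _ _)

theorem lipC_cutoff {R : ℝ} (hR : 0 < R) : LipC (cutoff R : Dom k₁ k₂ → ℝ) (1 / R) := fun x v => by
  have h1 : |‖x + pr v‖ - ‖x‖| ≤ ‖v‖ :=
    (abs_norm_sub_norm_le _ _).trans (by simpa using norm_pr_le v)
  have h2 : |(2 - ‖x + pr v‖ / R) - (2 - ‖x‖ / R)| ≤ 1 / R * ‖v‖ := by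
    rw [sub_sub_sub_cancel_left, ← sub_div, abs_div, abs_of_pos hR, abs_sub_comm, one_div_mul_eq_div]
    gcongr
  rw [Real.norm_eq_abs, cutoff, cutoff]
  refine (abs_max_sub_max_le_max _ _ _ _).trans ?_
  rw [sub_self, abs_zero]
  refine max_le (by positivity) ((abs_min_sub_min_le_max _ _ _ _).trans ?_)
  rw [sub_self, abs_zero]
  exact max_le (by positivity) h2

theorem cutoff_eq_one {R : ℝ} (hR : 0 < R) {x : Dom k₁ k₂} (hx : ‖x‖ ≤ R) : cutoff R x = 1 := by
  have : ‖x‖ / R ≤ 1 := (div_le_one hR).2 hx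
  rw [cutoff, min_eq_left (by linarith), max_eq_right zero_le_one]

theorem cutoff_eq_zero {R : ℝ} (hR : 0 < R) {x : Dom k₁ k₂} (hx : 2 * R ≤ ‖x‖) :
    cutoff R x = 0 := by
  have : 2 ≤ ‖x‖ / R := (le_div_iff₀ hR).2 hx
  exact max_eq_left ((min_le_right _ _).trans (by linarith))

/-- A mollified function that vanishes outside of a ball has compact support. -/
theorem IsKernel.hasCompactSupport_moll {η : Plane → ℝ} {δ R : ℝ} (h : IsKernel η δ)
    {ψ : Dom k₁ k₂ → ℝ} (hψ : ∀ x, R ≤ ‖x‖ → ψ x = 0) : HasCompactSupport (moll η ψ) := by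
  refine HasCompactSupport.intro (isCompact_closedBall (0 : Dom k₁ k₂) (R + δ)) fun x hx => ?_
  rw [mem_closedBall_zero_iff, not_le] at hx
  have := h.abs_integral_mul_le (g := fun w => ψ (x + pr w)) (c := 0) fun w hw => by
    rw [hψ, abs_zero]
    have h1 := norm_sub_norm_le x (-pr w)
    rw [sub_neg_eq_add, norm_neg] at h1
    have := norm_pr_le (k₁ := k₁) (k₂ := k₂) w
    linarith
  exact abs_nonpos_iff.1 this

/-- Smooth functions with compact support approximate `C^{1,1}` functions. -/
theorem IsC11.exists_isTest {φ : Dom k₁ k₂ → ℝ} {G : Dom k₁ k₂ → Plane} {L K : ℝ}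
    (h : IsC11 φ G L K) : ∃ (f : ℕ → Dom k₁ k₂ → ℝ) (H : ℕ → Dom k₁ k₂ → Plane) (a B : ℝ), 0 ≤ a ∧
      (∀ n, IsTest (f n)) ∧
      (∀ n, IsC11 (f n) (H n) (L + a * (1 / ((n : ℝ) + 1))) (K + a * (1 / ((n : ℝ) + 1)))) ∧
      (∀ n x, |f n x| ≤ B) ∧ (∀ x, Filter.Tendsto (fun n => f n x) Filter.atTop (nhds (φ x))) ∧
      (∀ x, Filter.Tendsto (fun n => H n x) Filter.atTop (nhds (G x))) := by
  obtain ⟨B, hB⟩ := h.bdd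
  have hB0 : 0 ≤ B := (abs_nonneg _).trans (hB 0)
  have hL := h.nonneg_lip
  have hK := h.nonneg_taylor
  obtain ⟨ζ, hζ⟩ := exists_isKernel zero_lt_one
  obtain ⟨K₁, hK₁, hζK⟩ := hζ.exists_lip
  have hpos : ∀ n : ℕ, 0 < 1 / ((n : ℝ) + 1) := fun n => Nat.one_div_pos_of_nat
  choose η hη using fun n : ℕ => exists_isKernel (hpos n)
  have hR : ∀ n : ℕ, 0 < (n : ℝ) + 1 := fun n => by positivity
  -- The cut-off descends over a length `n + 1` but is mollified at the fixed scale 1, so both of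
  -- its constants are `O(1 / (n + 1))`. By the product rule the constants of `φ` are then recovered
  -- in the limit.
  set χ : ℕ → Dom k₁ k₂ → ℝ := fun n => moll ζ (cutoff ((n : ℝ) + 1)) with hχ
  have hχ11 : ∀ n, IsC11 (χ n) (grad (χ n)) (1 / ((n : ℝ) + 1)) (1 / ((n : ℝ) + 1) * K₁) := fun n =>
    hζ.isC11_moll hζK hK₁ ⟨1, abs_cutoff_le _⟩ (lipC_cutoff (hR n))
  have hχ1 : ∀ n x, |χ n x| ≤ 1 := fun n => hζ.abs_moll_le (abs_cutoff_le _)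
  have hφ11 := fun n => h.mollify (hη n)
  have hφB : ∀ n x, |moll (η n) φ x| ≤ B := fun n => (hη n).abs_moll_le hB
  have hχev : ∀ x, ∀ᶠ n in Filter.atTop, χ n x = 1 := fun x => by
    obtain ⟨N, hN⟩ := exists_nat_gt (‖x‖ + 1)
    filter_upwards [Filter.eventually_ge_atTop N] with n hn
    have hn' : (N : ℝ) ≤ n := by exact_mod_cast hn
    have e1 : cutoff ((n : ℝ) + 1) x = 1 := cutoff_eq_one (hR n) (by linarith)
    have := hζ.abs_moll_sub_le (ψ := cutoff ((n : ℝ) + 1)) ⟨1, abs_cutoff_le _⟩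
      (lipC_cutoff (hR n)).continuous.measurable (c := 0) (x := x) fun w hw => by
        rw [e1, cutoff_eq_one (hR n), sub_self, abs_zero]
        have := norm_pr_le (k₁ := k₁) (k₂ := k₂) w
        linarith [norm_add_le x (pr w)]
    rw [e1] at this
    exact sub_eq_zero.1 (abs_nonpos_iff.1 this)
  have ht0 : Filter.Tendsto (fun n : ℕ => 1 / ((n : ℝ) + 1)) Filter.atTop (nhds 0) :=
    tendsto_one_div_add_atTop_nhds_zero_nat
  have hφt : ∀ x, Filter.Tendsto (fun n => moll (η n) φ x) Filter.atTop (nhds (φ x)) := fun x => by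
    rw [tendsto_iff_dist_tendsto_zero]
    refine squeeze_zero (fun _ => dist_nonneg)
      (fun n => (hη n).abs_moll_sub_le_of_lip h.bdd h.lip x) ?_
    simpa using ht0.const_mul L
  have hGt : ∀ x, Filter.Tendsto (fun n => ∫ w, η n w • G (x + pr w)) Filter.atTop
      (nhds (G x)) := fun x => by
    rw [tendsto_iff_norm_sub_tendsto_zero]
    refine squeeze_zero (fun _ => norm_nonneg _) (fun n => h.moll_gradient_sub_le (hη n) x) ?_
    simpa using ht0.const_mul (6 * K)
  have hχt : ∀ x, Filter.Tendsto (fun n => χ n x) Filter.atTop (nhds 1) := fun x =>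
    tendsto_nhds_of_eventually_eq (hχev x)
  refine ⟨fun n x => χ n x * moll (η n) φ x,
    fun n x => χ n x • (∫ w, η n w • G (x + pr w)) + moll (η n) φ x • grad (χ n) x,
    B + B * K₁ + L, B, by positivity, fun n => ?_, fun n => ?_, fun n x => ?_, fun x => ?_,
    fun x => ?_⟩
  · refine isTest_of_contDiff (ContDiff.mul
      (hζ.contDiff_moll ⟨1, abs_cutoff_le _⟩ (lipC_cutoff (hR n)).continuous.measurable)
      ((hη n).contDiff_moll h.bdd h.continuous.measurable)) ?_
    exact (hζ.hasCompactSupport_moll (R := 2 * ((n : ℝ) + 1))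
      fun x hx => cutoff_eq_zero (hR n) hx).mul_right
  · refine ((hφ11 n).mul (hχ11 n) (hφB n) (hχ1 n)).mono ?_ ?_
    · have := hpos n
      have : 0 ≤ B * K₁ + L := by positivity
      nlinarith
    · have := hpos n
      nlinarith
  · rw [abs_mul]
    exact (mul_le_of_le_one_left (abs_nonneg _) (hχ1 n x)).trans (hφB n x)
  · simpa using (hχt x).mul (hφt x)
  · have h1 : Filter.Tendsto (fun n => moll (η n) φ x • grad (χ n) x) Filter.atTop (nhds 0) := by
      rw [tendsto_zero_iff_norm_tendsto_zero]
      refine squeeze_zero (fun _ => norm_nonneg _) (g := fun n : ℕ => B * (1 / ((n : ℝ) + 1)))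
        (fun n => ?_) (by simpa using ht0.const_mul B)
      rw [norm_smul]
      exact mul_le_mul (hφB n x) ((hχ11 n).norm_le x) (norm_nonneg _) hB0
    simpa using ((hχt x).smul (hGt x)).add h1

/-! ### Measure-valued solutions -/

/-- The flux `∫ V[μ] · G dμ`. -/
def flux (V : Velocity k₁ k₂) (μ : ProbabilityMeasure (Dom k₁ k₂)) (G : Dom k₁ k₂ → Plane) : ℝ :=
  ∫ x, inner ℝ (V μ x) (G x) ∂(μ : Measure (Dom k₁ k₂))

section
variable {V : Velocity k₁ k₂} {C : ℝ} {μ₀ : ProbabilityMeasure (Dom k₁ k₂)}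
  {μ : ℝ≥0 → ProbabilityMeasure (Dom k₁ k₂)}

theorem Velocity.Regular.abs_flux_le (hV : V.Regular C) {φ : Dom k₁ k₂ → ℝ}
    {G : Dom k₁ k₂ → Plane} {L K : ℝ} (hφ : IsC11 φ G L K) (ν : ProbabilityMeasure (Dom k₁ k₂)) :
    |flux V ν G| ≤ C * L := by
  have := norm_integral_le_of_norm_le_const (μ := (ν : Measure (Dom k₁ k₂)))
      (f := fun x => inner ℝ (V ν x) (G x)) (C := C * L)
      (Filter.Eventually.of_forall (hV.abs_inner_le hφ ν))
  simpa [flux] using this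

theorem weakIntegrand_mul (hV : V.Regular C) {ψ : Dom k₁ k₂ → ℝ} {G : Dom k₁ k₂ → Plane} {L K : ℝ}
    (hψ : IsC11 ψ G L K) {χ : ℝ → ℝ} (hχ : Differentiable ℝ χ) (t : ℝ≥0) :
    weakIntegrand V μ (fun z => χ z.2 * ψ z.1) t =
      deriv χ t * ∫ x, ψ x ∂(μ t : Measure (Dom k₁ k₂)) + χ t * flux V (μ t) G := by
  rw [weakIntegrand, flux, ← integral_const_mul, ← integral_const_mul, ← integral_add
    ((integrable_of_bdd hψ.bdd hψ.continuous.measurable).const_mul _)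
    ((hV.integrable_inner hψ _ _).const_mul _)]
  refine integral_congr_ae (Filter.Eventually.of_forall fun x => ?_)
  simp only
  rw [deriv_mul_const hχ.differentiableAt, (hψ.const_mul (χ t)).pderiv₁,
    (hψ.const_mul (χ t)).pderiv₂, inner_plane]
  simp only [PiLp.smul_apply, smul_eq_mul]
  ring

theorem IsMeasureValuedSolution.continuous_integral (hμ : IsMeasureValuedSolution V μ₀ μ)
    {ψ : Dom k₁ k₂ → ℝ} (hψ : Continuous ψ) (hc : HasCompactSupport ψ) :
    Continuous fun t : ℝ≥0 => ∫ x, ψ x ∂(μ t : Measure (Dom k₁ k₂)) :=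
  hμ.weakly_continuous ⟨⟨ψ, hψ⟩, hc.is_zero_at_infty⟩

/-- Products `χ(t) ψ(x)` reduce the equation to a scalar one for `∫ ψ dμ_t`. The increments of these
scalars are all that uniqueness needs. -/
theorem IsMeasureValuedSolution.weakODE (hV : V.Regular C) (hμ : IsMeasureValuedSolution V μ₀ μ)
    {ψ : Dom k₁ k₂ → ℝ} {G : Dom k₁ k₂ → Plane} {L K : ℝ} (hψ : IsC11 ψ G L K) (ht : IsTest ψ) :
    WeakODE (fun r => ∫ x, ψ x ∂(μ r.toNNReal : Measure (Dom k₁ k₂)))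
      (fun r => flux V (μ r.toNNReal) G) (∫ x, ψ x ∂(μ₀ : Measure (Dom k₁ k₂))) := by
  intro χ hχ hχc
  have hst := ht.isSpaceTimeTest hχ hχc
  have e : Set.EqOn (fun t : ℝ => weakIntegrand V μ (fun z => χ z.2 * ψ z.1) t.toNNReal)
      (fun r => deriv χ r * ∫ x, ψ x ∂(μ r.toNNReal : Measure (Dom k₁ k₂)) +
        χ r * flux V (μ r.toNNReal) G) (Set.Ioi 0) := fun r hr => by
    simp only
    rw [weakIntegrand_mul hV hψ (hχ.differentiable (by simp)), Real.coe_toNNReal r (le_of_lt hr)]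
  refine ⟨(hμ.integrable _ hst).congr_fun e measurableSet_Ioi, ?_⟩
  have := hμ.equation _ hst
  rw [setIntegral_congr_fun measurableSet_Ioi e] at this
  simp only [integral_const_mul] at this
  exact this

/-- The bound is continuous in `L` and `K`, so it survives the vanishing enlargement of the
constants in `IsC11.exists_isTest`. The two measures are fixed, and dominated convergence suffices
without any tightness. -/
theorem abs_integral_sub_le_of_isTest {μ ν : ProbabilityMeasure (Dom k₁ k₂)} {c b : ℝ} {τ : ℝ}
    (hV : V.Regular C)
    (h : ∀ φ G L K, IsTest φ → IsC11 φ G L K →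
      |∫ x, φ x ∂(ν : Measure (Dom k₁ k₂)) - ∫ x, φ x ∂(μ : Measure (Dom k₁ k₂)) -
        τ * flux V μ G| ≤ c * L + b * K)
    {φ : Dom k₁ k₂ → ℝ} {G : Dom k₁ k₂ → Plane} {L K : ℝ} (hφ : IsC11 φ G L K) :
    |∫ x, φ x ∂(ν : Measure (Dom k₁ k₂)) - ∫ x, φ x ∂(μ : Measure (Dom k₁ k₂)) -
      τ * flux V μ G| ≤ c * L + b * K := by
  obtain ⟨f, H, a, B, ha, hft, hf11, hfB, hf, hH⟩ := hφ.exists_isTest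
  have hlim : ∀ ρ : ProbabilityMeasure (Dom k₁ k₂), Filter.Tendsto
      (fun n => ∫ x, f n x ∂(ρ : Measure (Dom k₁ k₂))) Filter.atTop
      (nhds (∫ x, φ x ∂(ρ : Measure (Dom k₁ k₂)))) := fun ρ =>
    tendsto_integral_of_dominated_convergence (fun _ => B)
      (fun n => (hf11 n).continuous.aestronglyMeasurable) (integrable_const B)
      (fun n => Filter.Eventually.of_forall (hfB n)) (Filter.Eventually.of_forall hf)
  have hflux : Filter.Tendsto (fun n => flux V μ (H n)) Filter.atTop (nhds (flux V μ G)) :=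
    tendsto_integral_of_dominated_convergence (fun _ => C * (L + a))
      (fun n => (hV.integrable_inner (hf11 n) μ _).aestronglyMeasurable) (integrable_const _)
      (fun n => Filter.Eventually.of_forall fun x => by
        refine (hV.abs_inner_le (hf11 n) μ x).trans ?_
        have : 1 / ((n : ℝ) + 1) ≤ 1 := by
          rw [div_le_one (by positivity)]; linarith [(Nat.cast_nonneg n : (0 : ℝ) ≤ n)]
        have := hV.nonneg
        gcongr
        exact mul_le_of_le_one_right ha ‹_›)
      (Filter.Eventually.of_forall fun x => tendsto_const_nhds.inner (hH x))
  have hz : Filter.Tendsto (fun n : ℕ => a * (1 / ((n : ℝ) + 1))) Filter.atTop (nhds 0) := by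
    simpa using (tendsto_one_div_add_atTop_nhds_zero_nat (𝕜 := ℝ)).const_mul a
  have hR : Filter.Tendsto (fun n : ℕ => c * (L + a * (1 / ((n : ℝ) + 1))) +
      b * (K + a * (1 / ((n : ℝ) + 1)))) Filter.atTop (nhds (c * L + b * K)) := by
    simpa using ((hz.const_add L).const_mul c).add ((hz.const_add K).const_mul b)
  exact le_of_tendsto_of_tendsto (((hlim ν).sub (hlim μ)).sub (hflux.const_mul τ)).abs hR
    (Filter.Eventually.of_forall fun n => h _ _ _ _ (hft n) (hf11 n))

theorem wClose_of_isC11 {μ ν : ProbabilityMeasure (Dom k₁ k₂)} {d : ℝ}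
    (h : ∀ φ G K, IsC11 φ G 1 K →
      |∫ x, φ x ∂(μ : Measure (Dom k₁ k₂)) - ∫ x, φ x ∂(ν : Measure (Dom k₁ k₂))| ≤ d) :
    WClose (μ : Measure (Dom k₁ k₂)) ν d := by
  intro ψ hb hl
  refine le_of_forall_pos_le_add fun e he => ?_
  obtain ⟨K, _, hs⟩ := exists_smoothable (k₁ := k₁) (k₂ := k₂) (half_pos he)
  have := wClose_of_smoothable hs (fun φ G hφ => h φ G K hφ) ψ hb hl
  linarith

theorem IsMeasureValuedSolution.abs_increment_le (hV : V.Regular C)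
    (hμ : IsMeasureValuedSolution V μ₀ μ) {φ : Dom k₁ k₂ → ℝ} {G : Dom k₁ k₂ → Plane} {L K : ℝ}
    (hφ : IsC11 φ G L K) (ht : IsTest φ) {s t ε c b : ℝ} (hs : 0 ≤ s) (hst : s ≤ t) (hε : 0 < ε)
    (hF : ∀ r ∈ Set.Icc s (t + ε), |flux V (μ r.toNNReal) G - c| ≤ b) :
    |∫ x, φ x ∂(μ t.toNNReal : Measure (Dom k₁ k₂)) -
      ∫ x, φ x ∂(μ s.toNNReal : Measure (Dom k₁ k₂)) - (t - s) * c| ≤ (t - s) * b :=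
  (hμ.weakODE hV hφ ht).abs_increment_le
    ((hμ.continuous_integral hφ.continuous ht.2).comp continuous_real_toNNReal) hs hst hε hF

/-- The flux against a gradient of length at most `L` is at most `C L`, so mass moves with speed at
most `C`. -/
theorem IsMeasureValuedSolution.wClose (hV : V.Regular C) (hμ : IsMeasureValuedSolution V μ₀ μ)
    {s t : ℝ} (hs : 0 ≤ s) (hst : s ≤ t) :
    WClose (μ s.toNNReal : Measure (Dom k₁ k₂)) (μ t.toNNReal) (C * (t - s)) := by
  refine WClose.symm (wClose_of_isC11 fun φ G K hφ => ?_)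
  have := abs_integral_sub_le_of_isTest (τ := 0) (c := C * (t - s)) (b := 0)
    (μ := μ s.toNNReal) (ν := μ t.toNNReal) hV (fun φ G L K ht hφ => by
      have := hμ.abs_increment_le hV hφ ht hs hst zero_lt_one (c := 0) (b := C * L)
        (fun r _ => by simpa using hV.abs_flux_le hφ _)
      simp only [mul_zero, sub_zero, zero_mul, add_zero] at this ⊢
      linarith) hφ
  simpa using this

/-- The flux is Lipschitz along the solution, because the solution is Lipschitz in the Wasserstein
distance. Freezing it at time `s` leaves a quadratic remainder, and the error parameter is 0. -/
theorem IsMeasureValuedSolution.isApprox (hV : V.Regular C) (hμ : IsMeasureValuedSolution V μ₀ μ) :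
    IsApprox V (6 * C ^ 2) 0 (fun t => μ t.toNNReal) where
  close s t hs hst := (hμ.wClose hV hs hst).mono (by
    have h1 := hV.one_le
    have : 0 ≤ t - s := by linarith
    rw [add_zero]
    gcongr
    nlinarith)
  step s t hs hst _ φ G L K hφ := by
    have hC := hV.nonneg
    have h1 := abs_integral_sub_le_of_isTest (τ := t - s) (c := 6 * C ^ 2 * (t - s) ^ 2)
      (b := 6 * C ^ 2 * (t - s) ^ 2) (μ := μ s.toNNReal) (ν := μ t.toNNReal) hV
      (fun φ G L K ht hφ => by
        rw [← mul_add]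
        have hL := hφ.nonneg_lip
        have hK := hφ.nonneg_taylor
        -- The increment estimate looks at the flux up to `t + ε`; the margin is removed by `ε → 0`.
        have key : ∀ ε > 0, |∫ x, φ x ∂(μ t.toNNReal : Measure (Dom k₁ k₂)) -
            ∫ x, φ x ∂(μ s.toNNReal : Measure (Dom k₁ k₂)) - (t - s) * flux V (μ s.toNNReal) G| ≤
            (t - s) * (6 * C * (L + K) * (C * (t + ε - s))) := fun ε hε =>
          hμ.abs_increment_le hV hφ ht hs hst hε fun r hr => by
            refine (hV.abs_flux_sub_le hφ (hμ.wClose hV hs hr.1).symm).trans ?_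
            gcongr; exact hr.2
        have hlim : Filter.Tendsto (fun ε => (t - s) * (6 * C * (L + K) * (C * (t + ε - s))))
            (nhdsWithin 0 (Set.Ioi 0)) (nhds ((t - s) * (6 * C * (L + K) * (C * (t + 0 - s))))) :=
          (Continuous.tendsto (by fun_prop) 0).mono_left nhdsWithin_le_nhds
        have := ge_of_tendsto hlim (by
          filter_upwards [self_mem_nhdsWithin] with ε hε using key ε hε)
        refine this.trans (le_of_eq ?_)
        ring) hφ
    simp only [add_zero]
    rw [mul_add]
    exact h1

theorem IsMeasureValuedSolution.wClose_initial (hV : V.Regular C)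
    (hμ : IsMeasureValuedSolution V μ₀ μ) : WClose (μ 0 : Measure (Dom k₁ k₂)) μ₀ 0 := by
  refine WClose.symm (wClose_of_isC11 fun φ G K hφ => ?_)
  rw [abs_sub_comm]
  have := abs_integral_sub_le_of_isTest (τ := 0) (c := 0) (b := 0)
    (μ := μ₀) (ν := μ 0) hV (fun φ G L K ht hφ => by
      have := (hμ.weakODE hV hφ ht).initial ((hμ.continuous_integral hφ.continuous ht.2).comp
        continuous_real_toNNReal) (fun r => hV.abs_flux_le hφ _)
      simp only [Real.toNNReal_zero] at this
      simp [this]) hφ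
  simpa using this

/-- Measures at distance `0` coincide. -/
theorem eq_of_wClose {μ ν : ProbabilityMeasure (Dom k₁ k₂)}
    (h : ∀ ε > 0, WClose (μ : Measure (Dom k₁ k₂)) ν ε) : μ = ν := by
  have h0 : ∀ ψ : Dom k₁ k₂ → ℝ, (∃ B, ∀ x, |ψ x| ≤ B) → ∀ L, LipC ψ L →
      ∫ x, ψ x ∂(μ : Measure (Dom k₁ k₂)) = ∫ x, ψ x ∂(ν : Measure (Dom k₁ k₂)) := by
    intro ψ hb L hl
    have hW : WClose (μ : Measure (Dom k₁ k₂)) ν 0 := fun ψ hb hl =>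
      le_of_forall_pos_le_add fun e he => by simpa using h e he ψ hb hl
    have := hW.integral_le hb hl
    rw [mul_zero] at this
    exact sub_eq_zero.1 (abs_nonpos_iff.1 this)
  suffices h : (μ : Measure (Dom k₁ k₂)) = ν from Subtype.ext h
  refine ext_of_forall_integral_eq_of_IsFiniteMeasure fun f => ?_
  have hb : ∀ x, |f x| ≤ ‖f‖ := fun x => f.norm_coe_le_norm x
  choose η hη using fun n : ℕ => exists_isKernel (Nat.one_div_pos_of_nat (α := ℝ) (n := n))
  have hpt : ∀ x, Filter.Tendsto (fun n => moll (η n) f x) Filter.atTop (nhds (f x)) := fun x => by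
    rw [Metric.tendsto_atTop]
    intro e he
    obtain ⟨δ, hδ, hδ'⟩ := Metric.continuousAt_iff.1 (f.continuous.continuousAt (x := x)) (e / 2)
      (half_pos he)
    obtain ⟨N, hN⟩ := exists_nat_one_div_lt hδ
    refine ⟨N, fun n hn => ?_⟩
    rw [Real.dist_eq]
    refine ((hη n).abs_moll_sub_le ⟨_, hb⟩ f.continuous.measurable (c := e / 2)
      fun w hw => ?_).trans_lt (half_lt_self he)
    refine (hδ' ?_).le
    rw [dist_eq_norm, add_sub_cancel_left]
    exact ((norm_pr_le w).trans (hw.trans (Nat.one_div_le_one_div hn))).trans_lt hN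
  have hlim : ∀ ρ : ProbabilityMeasure (Dom k₁ k₂), Filter.Tendsto
      (fun n => ∫ x, moll (η n) f x ∂(ρ : Measure (Dom k₁ k₂))) Filter.atTop
      (nhds (∫ x, f x ∂(ρ : Measure (Dom k₁ k₂)))) := fun ρ => by
    refine tendsto_integral_of_dominated_convergence (fun _ => ‖f‖) (fun n => ?_)
      (integrable_const _) (fun n => Filter.Eventually.of_forall ((hη n).abs_moll_le hb))
      (Filter.Eventually.of_forall hpt)
    obtain ⟨K, _, hK⟩ := (hη n).exists_lip
    exact ((hη n).lipC_moll_of_bdd hK hb f.continuous.measurable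
      (norm_nonneg f)).continuous.aestronglyMeasurable
  refine tendsto_nhds_unique (hlim μ) ((hlim ν).congr fun n => ?_)
  obtain ⟨K, _, hK⟩ := (hη n).exists_lip
  exact (h0 _ ⟨_, (hη n).abs_moll_le hb⟩ _
    ((hη n).lipC_moll_of_bdd hK hb f.continuous.measurable (norm_nonneg f))).symm

/-- Stability with `h = 0` and `d₀ = 0` puts two solutions within every `ε` of each other. -/
theorem IsMeasureValuedSolution.unique (hV : V.Regular C) {μ' : ℝ≥0 → ProbabilityMeasure (Dom k₁ k₂)}
    (hμ : IsMeasureValuedSolution V μ₀ μ) (hμ' : IsMeasureValuedSolution V μ₀ μ') : μ' = μ := by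
  funext t
  refine eq_of_wClose fun ε hε => ?_
  obtain ⟨η, hη, H⟩ := exists_stability hV (A := 6 * C ^ 2) (by positivity) t.2 hε
  have := H 0 (0 + 0) le_rfl hη.le (by simpa using hη.le) _ _ (hμ'.isApprox hV) (hμ.isApprox hV)
    (by simpa using (hμ'.wClose_initial hV).trans (hμ.wClose_initial hV).symm) t t.2 le_rfl
  simpa using this

end

end

section

variable {k₁ k₂ : Axis}

/-! ### Space-time test functions -/

/-- The lift of a function on `𝕂₁ × 𝕂₂ × ℝ`. -/
def liftST (φ : Dom k₁ k₂ × ℝ → ℝ) (z : Plane × ℝ) : ℝ := φ (pr z.1, z.2)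

theorem IsSpaceTimeTest.contDiff_liftST {φ : Dom k₁ k₂ × ℝ → ℝ} (h : IsSpaceTimeTest φ) :
    ContDiff ℝ ∞ (liftST φ) := by
  have h1 : ContDiff ℝ ∞ fun u : Plane => (u 0, u 1) :=
    (contDiff_euclidean.1 contDiff_id 0).prodMk (contDiff_euclidean.1 contDiff_id 1)
  exact h.1.comp ((h1.comp contDiff_fst).prodMk contDiff_snd)

/-- On a torus the lift of a compactly supported function is not compactly supported. Each point
over `S` is equivalent to its shortest lift, which stays in a fixed ball, so periodicity reduces the
bound to a compact set. -/
theorem exists_bound_of_periodic {F : Type*} [NormedAddCommGroup F] {D : Plane × ℝ → F}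
    {S : Set (Dom k₁ k₂ × ℝ)} (hS : IsCompact S) (hc : Continuous D)
    (hp : ∀ u w : Plane, (pr w : Dom k₁ k₂) = 0 → ∀ t, D (u + w, t) = D (u, t))
    (h0 : ∀ z : Plane × ℝ, ((pr z.1 : Dom k₁ k₂), z.2) ∉ S → D z = 0) :
    ∃ M, 0 ≤ M ∧ ∀ z, ‖D z‖ ≤ M := by
  obtain ⟨R, hR⟩ := hS.isBounded.exists_norm_le
  obtain ⟨M, hM⟩ := (isCompact_closedBall (0 : Plane × ℝ) (2 * |R|)).exists_bound_of_continuousOn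
    hc.continuousOn
  refine ⟨|M|, abs_nonneg M, fun z => ?_⟩
  by_cases hz : ((pr z.1 : Dom k₁ k₂), z.2) ∈ S
  · have hn := hR _ hz
    rw [Prod.norm_def] at hn
    obtain ⟨v, hv, hvn⟩ := exists_pr (0 : Dom k₁ k₂) (pr z.1)
    rw [zero_add] at hv
    have hvn' : ‖v‖ ≤ 2 * |R| := by
      rw [hvn]
      refine (euclDist_le_two_mul_dist _ _).trans ?_
      rw [dist_zero_left]
      have := (le_max_left _ _).trans hn
      linarith [le_abs_self R]
    have e : D z = D (v, z.2) := by
      have := hp v (z.1 - v) (by rw [sub_eq_add_neg, pr_add, pr_neg, ← hv, add_neg_cancel]) z.2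
      rw [add_sub_cancel] at this
      exact this
    rw [e]
    refine (hM _ ?_).trans (le_abs_self M)
    rw [mem_closedBall_zero_iff, Prod.norm_def]
    refine max_le hvn' ?_
    have := (le_max_right _ _).trans hn
    have := le_abs_self R
    have := abs_nonneg R
    simp only at *
    linarith
  · rw [h0 z hz, norm_zero]; exact abs_nonneg M

theorem fderiv_periodic {F : Type*} [NormedAddCommGroup F] [NormedSpace ℝ F] {D : Plane × ℝ → F}
    (hp : ∀ u w : Plane, (pr w : Dom k₁ k₂) = 0 → ∀ t, D (u + w, t) = D (u, t)) :
    ∀ u w : Plane, (pr w : Dom k₁ k₂) = 0 → ∀ t, fderiv ℝ D (u + w, t) = fderiv ℝ D (u, t) := by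
  intro u w hw t
  have h1 : (fun z : Plane × ℝ => D (z + (w, 0))) = D := by
    ext z
    obtain ⟨a, b⟩ := z
    simpa using hp a w hw b
  have h2 := fderiv_comp_add_right (𝕜 := ℝ) (f := D) (x := (u, t)) (w, 0)
  rw [h1] at h2
  rw [h2]
  simp

theorem fderiv_eq_zero_off {F : Type*} [NormedAddCommGroup F] [NormedSpace ℝ F] {D : Plane × ℝ → F}
    {S : Set (Dom k₁ k₂ × ℝ)} (hS : IsClosed S)
    (h0 : ∀ z : Plane × ℝ, ((pr z.1 : Dom k₁ k₂), z.2) ∉ S → D z = 0) :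
    ∀ z : Plane × ℝ, ((pr z.1 : Dom k₁ k₂), z.2) ∉ S → fderiv ℝ D z = 0 := by
  intro z hz
  have hP : Continuous fun z : Plane × ℝ => ((pr z.1 : Dom k₁ k₂), z.2) :=
    (continuous_pr.comp continuous_fst).prodMk continuous_snd
  have hev : D =ᶠ[nhds z] fun _ => 0 := by
    filter_upwards [(hS.isOpen_compl.preimage hP).mem_nhds hz] with y hy using h0 y hy
  rw [hev.fderiv_eq, fderiv_fun_const]; rfl

/-- One `M`, the sum of bounds of the first two derivatives of the lift, serves for all the
estimates, uniformly in time. -/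
theorem exists_spaceTime_bounds {φ : Dom k₁ k₂ × ℝ → ℝ} (hφ : IsSpaceTimeTest φ) :
    ∃ M, 0 ≤ M ∧ (∀ x t, |deriv (fun s => φ (x, s)) t| ≤ M) ∧
      (∀ t, LipC (fun x => deriv (fun s => φ (x, s)) t) M) ∧
      (∀ x s t, |deriv (fun r => φ (x, r)) t - deriv (fun r => φ (x, r)) s| ≤ M * |t - s|) ∧
      (∀ x s t, |φ (x, t) - φ (x, s) - (t - s) * deriv (fun r => φ (x, r)) s| ≤ M * (t - s) ^ 2) ∧
      (∀ t, IsC11 (fun x => φ (x, t)) (grad fun x => φ (x, t)) M M) ∧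
      (∀ x s t, ‖grad (fun z => φ (z, t)) x - grad (fun z => φ (z, s)) x‖ ≤ M * |t - s|) ∧
      ∃ R, 0 < R ∧ ∀ t, R < t → ∀ x, φ (x, t) = 0 := by
  set Φ := liftST φ with hΦdef
  have hΦ : ContDiff ℝ ∞ Φ := hφ.contDiff_liftST
  have hp0 : ∀ u w : Plane, (pr w : Dom k₁ k₂) = 0 → ∀ t, Φ (u + w, t) = Φ (u, t) :=
    fun u w hw t => by simp [hΦdef, liftST, pr_add, hw]
  have hz0 : ∀ z : Plane × ℝ, ((pr z.1 : Dom k₁ k₂), z.2) ∉ tsupport φ → Φ z = 0 :=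
    fun z hz => image_eq_zero_of_notMem_tsupport (f := φ) hz
  have hS : IsClosed (tsupport φ) := isClosed_tsupport φ
  have hd1 : ContDiff ℝ ∞ (fderiv ℝ Φ) := hΦ.fderiv_right (by simp)
  have hd2 : ContDiff ℝ ∞ (fderiv ℝ (fderiv ℝ Φ)) := hd1.fderiv_right (by simp)
  obtain ⟨M₀, hM₀, hb0⟩ := exists_bound_of_periodic hφ.2.isCompact hΦ.continuous hp0 hz0
  obtain ⟨M₁, hM₁, hb1⟩ := exists_bound_of_periodic hφ.2.isCompact hd1.continuous
    (fderiv_periodic hp0) (fderiv_eq_zero_off hS hz0)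
  obtain ⟨M₂, hM₂, hb2⟩ := exists_bound_of_periodic hφ.2.isCompact hd2.continuous
    (fderiv_periodic (fderiv_periodic hp0)) (fderiv_eq_zero_off hS (fderiv_eq_zero_off hS hz0))
  set M := M₁ + M₂ with hM
  have hM1 : M₁ ≤ M := by linarith
  have hM2 : M₂ ≤ M := by linarith
  have hM0 : 0 ≤ M := by linarith
  have hdiff : Differentiable ℝ Φ := hΦ.differentiable (by simp)
  have hlip0 : ∀ z y, ‖Φ z - Φ y‖ ≤ M * ‖z - y‖ := fun z y =>
    (convex_univ.norm_image_sub_le_of_norm_fderiv_le (fun x _ => hdiff x)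
      (fun x _ => (hb1 x).trans hM1) (Set.mem_univ y) (Set.mem_univ z))
  have hlip1 : ∀ z y, ‖fderiv ℝ Φ z - fderiv ℝ Φ y‖ ≤ M * ‖z - y‖ := fun z y =>
    (convex_univ.norm_image_sub_le_of_norm_fderiv_le (fun x _ => hd1.differentiable (by simp) x)
      (fun x _ => (hb2 x).trans hM2) (Set.mem_univ y) (Set.mem_univ z))
  have hdt : ∀ (u : Plane) t, deriv (fun s => φ (pr u, s)) t = fderiv ℝ Φ (u, t) (0, 1) := by
    intro u t
    exact ((hdiff (u, t)).hasFDerivAt.comp_hasDerivAt t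
      ((hasDerivAt_const t u).prodMk (hasDerivAt_id t))).deriv
  have hdx' : ∀ (u : Plane) t, HasFDerivAt (fun u : Plane => φ (pr u, t))
      ((fderiv ℝ Φ (u, t)).comp (ContinuousLinearMap.inl ℝ Plane ℝ)) u := by
    intro u t
    exact HasFDerivAt.comp (g := Φ) u (hdiff (u, t)).hasFDerivAt
      (hasFDerivAt_prodMk_left (𝕜 := ℝ) u t)
  have hdx : ∀ (u : Plane) t, fderiv ℝ (fun u : Plane => φ (pr u, t)) u =
      (fderiv ℝ Φ (u, t)).comp (ContinuousLinearMap.inl ℝ Plane ℝ) :=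
    fun u t => (hdx' u t).fderiv
  have n01 : ‖((0, 1) : Plane × ℝ)‖ = 1 := by simp [Prod.norm_def]
  have hop : ∀ Λ : Plane × ℝ →L[ℝ] ℝ, |Λ (0, 1)| ≤ ‖Λ‖ := fun Λ => by
    simpa [n01] using Λ.le_opNorm (0, 1)
  have hcomp : ∀ Λ : Plane × ℝ →L[ℝ] ℝ, ‖Λ.comp (ContinuousLinearMap.inl ℝ Plane ℝ)‖ ≤ ‖Λ‖ :=
    fun Λ => ContinuousLinearMap.opNorm_le_bound _ (norm_nonneg _) fun v => by
      simpa [Prod.norm_def] using Λ.le_opNorm (v, 0)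
  refine ⟨M, hM0, fun x t => ?_, fun t x v => ?_, fun x s t => ?_, fun x s t => ?_, fun t => ?_,
    fun x s t => ?_, ?_⟩
  · obtain ⟨u, rfl⟩ := pr_surjective x
    rw [hdt]
    exact (hop _).trans ((hb1 _).trans hM1)
  · obtain ⟨u, rfl⟩ := pr_surjective x
    simp only [← pr_add]
    rw [hdt, hdt, ← sub_apply]
    refine (hop _).trans ((hlip1 _ _).trans (le_of_eq ?_))
    simp [Prod.norm_def]
  · obtain ⟨u, rfl⟩ := pr_surjective x
    rw [hdt, hdt, ← sub_apply]
    refine (hop _).trans ((hlip1 _ _).trans (le_of_eq ?_))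
    simp [Prod.norm_def]
  · obtain ⟨u, rfl⟩ := pr_surjective x
    rw [hdt]
    have := norm_taylor_le hM0 hdiff hlip1 (u, s) (0, t - s)
    have e : fderiv ℝ Φ (u, s) (0, t - s) = (t - s) * fderiv ℝ Φ (u, s) (0, 1) := by
      rw [← smul_eq_mul, ← map_smul]; simp
    rw [e] at this
    simpa [Prod.norm_def, hΦdef, liftST] using this
  · refine isC11_of_smooth ⟨M₀, fun x => ?_⟩ (fun x v => ?_) hM0 (fun u => ?_) fun u w => ?_
    · obtain ⟨u, rfl⟩ := pr_surjective x
      exact hb0 (u, t)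
    · obtain ⟨u, rfl⟩ := pr_surjective x
      have := hlip0 (u + v, t) (u, t)
      simpa [Prod.norm_def, hΦdef, liftST, pr_add] using this
    · exact (hdx' u t).differentiableAt
    · rw [hdx, hdx, ← ContinuousLinearMap.sub_comp]
      refine (hcomp _).trans ((hlip1 _ _).trans (le_of_eq ?_))
      simp [Prod.norm_def]
  · obtain ⟨u, rfl⟩ := pr_surjective x
    rw [grad_pr, grad_pr, gradient, gradient, ← map_sub, LinearIsometryEquiv.norm_map, hdx, hdx,
      ← ContinuousLinearMap.sub_comp]
    refine (hcomp _).trans ((hlip1 _ _).trans (le_of_eq ?_))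
    simp [Prod.norm_def]
  · obtain ⟨R, hR⟩ := hφ.2.isCompact.isBounded.exists_norm_le
    refine ⟨max R 1, by positivity, fun t ht x => ?_⟩
    by_contra hne
    have := hR (x, t) (subset_tsupport φ hne)
    rw [Prod.norm_def] at this
    have h1 : |t| ≤ R := (le_max_right _ _).trans this
    have h2 := (le_max_left R 1).trans_lt ht
    linarith [le_abs_self t]

/-! ### From approximate solutions with vanishing error to measure-valued solutions -/

section
variable {V : Velocity k₁ k₂} {C A : ℝ} {μ : ℝ≥0 → ProbabilityMeasure (Dom k₁ k₂)}

theorem abs_integral_le_of_abs_le {ν : Measure (Dom k₁ k₂)} [IsProbabilityMeasure ν]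
    {f : Dom k₁ k₂ → ℝ} {c : ℝ} (h : ∀ x, |f x| ≤ c) : |∫ x, f x ∂ν| ≤ c := by
  have := norm_integral_le_of_norm_le_const (μ := ν) (f := f) (C := c)
    (Filter.Eventually.of_forall h)
  simpa using this

theorem continuous_integral_of_lip (hA : 0 ≤ A)
    (h : ∀ s t : ℝ≥0, s ≤ t → WClose (μ s : Measure (Dom k₁ k₂)) (μ t) (A * (t - s)))
    {ψ : Dom k₁ k₂ → ℝ} {L : ℝ} (hb : ∃ B, ∀ x, |ψ x| ≤ B) (hl : LipC ψ L) :
    Continuous fun t : ℝ≥0 => ∫ x, ψ x ∂(μ t : Measure (Dom k₁ k₂)) := by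
  have hL := hl.nonneg
  refine (LipschitzWith.of_dist_le_mul (K := (L * A).toNNReal) fun s t => ?_).continuous
  rw [Real.coe_toNNReal _ (by positivity), Real.dist_eq, NNReal.dist_eq]
  rcases le_total s t with hst | hst
  · refine ((h s t hst).integral_le hb hl).trans ?_
    rw [mul_assoc, abs_sub_comm]
    gcongr; exact le_abs_self _
  · rw [abs_sub_comm]
    refine ((h t s hst).integral_le hb hl).trans ?_
    rw [mul_assoc]
    gcongr; exact le_abs_self _

/-- A function in `C₀` is uniformly continuous, hence a uniform limit of its mollifications. These
are bounded and Lipschitz, so the Wasserstein bound makes their integrals continuous in time. -/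
theorem weakly_continuous_of_lip (hA : 0 ≤ A)
    (h : ∀ s t : ℝ≥0, s ≤ t → WClose (μ s : Measure (Dom k₁ k₂)) (μ t) (A * (t - s)))
    (φ : C₀(Dom k₁ k₂, ℝ)) : Continuous fun t : ℝ≥0 => ∫ x, φ x ∂(μ t : Measure (Dom k₁ k₂)) := by
  have hb : ∀ x, |φ x| ≤ ‖φ.toBCF‖ := fun x => φ.toBCF.norm_coe_le_norm x
  have hφm : Measurable φ := φ.continuous.measurable
  refine continuous_of_uniform_approx_of_continuous fun u hu => ?_
  obtain ⟨ε, hε, hεu⟩ := Metric.mem_uniformity_dist.1 hu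
  obtain ⟨δ, hδ, hδ'⟩ := Metric.uniformContinuous_iff.1
    (ZeroAtInftyContinuousMap.uniformContinuous φ) (ε / 2) (half_pos hε)
  obtain ⟨η, hη⟩ := exists_isKernel (half_pos hδ)
  obtain ⟨K, hK0, hK⟩ := hη.exists_lip
  have hl := hη.lipC_moll_of_bdd hK hb hφm (norm_nonneg _)
  refine ⟨fun t => ∫ x, moll η φ x ∂(μ t : Measure (Dom k₁ k₂)),
    continuous_integral_of_lip hA h ⟨_, hη.abs_moll_le hb⟩ hl, fun t => hεu ?_⟩
  rw [Real.dist_eq, abs_sub_comm]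
  refine (abs_integral_sub_le_of_abs_sub_le
    (integrable_of_bdd ⟨_, hη.abs_moll_le hb⟩ hl.continuous.measurable)
    (integrable_of_bdd ⟨_, hb⟩ hφm) (ε := ε / 2) fun x => ?_).trans_lt (half_lt_self hε)
  refine hη.abs_moll_sub_le ⟨_, hb⟩ hφm fun w hw => (hδ' ?_).le
  rw [dist_eq_norm, add_sub_cancel_left]
  exact (norm_pr_le w).trans_lt (hw.trans_lt (half_lt_self hδ))

theorem weakIntegrand_eq (hV : V.Regular C) {φ : Dom k₁ k₂ × ℝ → ℝ} {M : ℝ} (t : ℝ≥0)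
    (h1 : ∀ x, |deriv (fun s => φ (x, s)) t| ≤ M)
    (h2 : LipC (fun x => deriv (fun s => φ (x, s)) t) M)
    (h3 : IsC11 (fun x => φ (x, (t : ℝ))) (grad fun x => φ (x, (t : ℝ))) M M) :
    weakIntegrand V μ φ t = ∫ x, deriv (fun s => φ (x, s)) t ∂(μ t : Measure (Dom k₁ k₂)) +
      flux V (μ t) (grad fun x => φ (x, (t : ℝ))) := by
  rw [weakIntegrand, flux, ← integral_add (integrable_of_bdd ⟨M, h1⟩ h2.continuous.measurable)
    (hV.integrable_inner h3 _ _)]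
  refine integral_congr_ae (Filter.Eventually.of_forall fun x => ?_)
  simp only
  rw [h3.pderiv₁, h3.pderiv₂, inner_plane]
  ring

/-- With error 0, `m(t) = ∫ φ(·, t) dμ_t` has a quadratic expansion at every time, with the weak
integrand `w` as its slope. Since `m` and `w` are Lipschitz on `[0, ∞)` and vanish for large times,
the fundamental theorem of calculus is the weak equation. -/
theorem IsApprox.isMeasureValuedSolution (hV : V.Regular C) (hA : 0 ≤ A)
    (h : IsApprox V A 0 fun t => μ t.toNNReal) :
    IsMeasureValuedSolution V (μ 0) μ := by
  have hC := hV.nonneg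
  have hclose : ∀ s t : ℝ≥0, s ≤ t → WClose (μ s : Measure (Dom k₁ k₂)) (μ t) (A * (t - s)) :=
    fun s t hst => by simpa using h.close s t s.2 (by exact_mod_cast hst)
  have key : ∀ φ : Dom k₁ k₂ × ℝ → ℝ, IsSpaceTimeTest φ →
      IntegrableOn (fun t : ℝ => weakIntegrand V μ φ t.toNNReal) (Set.Ioi 0) ∧
      (∫ t in Set.Ioi (0 : ℝ), weakIntegrand V μ φ t.toNNReal)
        + ∫ x, φ (x, 0) ∂(μ 0 : Measure (Dom k₁ k₂)) = 0 := by
    intro φ hφ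
    obtain ⟨M, hM, b1, b2, b3, b4, b5, b6, R, hR, b7⟩ := exists_spaceTime_bounds hφ
    set m : ℝ → ℝ := fun t => ∫ x, φ (x, t) ∂(μ t.toNNReal : Measure (Dom k₁ k₂)) with hm
    set w : ℝ → ℝ := fun t => ∫ x, deriv (fun s => φ (x, s)) t ∂(μ t.toNNReal : Measure (Dom k₁ k₂)) +
      flux V (μ t.toNNReal) (grad fun x => φ (x, t)) with hw
    have hweq : ∀ t : ℝ, 0 ≤ t → weakIntegrand V μ φ t.toNNReal = w t := fun t ht => by
      have e := Real.coe_toNNReal t ht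
      rw [weakIntegrand_eq hV (M := M) t.toNNReal (fun x => b1 x _) (b2 _) (b5 _), e]
    have i1 : ∀ t (ν : ProbabilityMeasure (Dom k₁ k₂)), Integrable (fun x => φ (x, t))
      (ν : Measure (Dom k₁ k₂)) := fun t ν => integrable_of_bdd (b5 t).bdd (b5 t).continuous.measurable
    have i2 : ∀ t (ν : ProbabilityMeasure (Dom k₁ k₂)), Integrable
      (fun x => deriv (fun s => φ (x, s)) t) (ν : Measure (Dom k₁ k₂)) := fun t ν =>
        integrable_of_bdd ⟨M, fun x => b1 x t⟩ (b2 t).continuous.measurable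
    have hwcl : ∀ s t : ℝ, 0 ≤ s → s ≤ t →
        WClose (μ s.toNNReal : Measure (Dom k₁ k₂)) (μ t.toNNReal) (A * (t - s)) :=
      fun s t hs hst => by simpa using h.close s t hs hst
    -- expansion of `m`
    have hexp : ∀ s t : ℝ, 0 ≤ s → s ≤ t → t ≤ s + 1 →
        |m t - m s - (t - s) * w s| ≤ (M + M * A + A * (M + M)) * (t - s) ^ 2 := by
      intro s t hs hst hst1
      have hts : 0 ≤ t - s := by linarith
      have a1 : |∫ x, (φ (x, t) - φ (x, s) - (t - s) * deriv (fun r => φ (x, r)) s)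
          ∂(μ t.toNNReal : Measure (Dom k₁ k₂))| ≤ M * (t - s) ^ 2 :=
        abs_integral_le_of_abs_le fun x => b4 x s t
      have i3 : Integrable (fun x => φ (x, t) - φ (x, s)) (μ t.toNNReal : Measure (Dom k₁ k₂)) :=
        (i1 t _).sub (i1 s _)
      rw [integral_sub i3 ((i2 s _).const_mul _), integral_sub (i1 t _) (i1 s _),
        integral_const_mul] at a1
      have a2 := (hwcl s t hs hst).integral_le ⟨M, fun x => b1 x s⟩ (b2 s)
      have a3 := h.step s t hs hst hst1 _ _ _ _ (b5 s)
      rw [add_zero] at a3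
      have a4 := mul_le_mul_of_nonneg_left a2 hts
      rw [← abs_of_nonneg hts, ← abs_mul, abs_of_nonneg hts] at a4
      simp only [hm, hw, flux]
      rw [abs_le] at *
      constructor <;> nlinarith [a1.1, a1.2, a3.1, a3.2, a4.1, a4.2]
    have hwlip : ∀ s t : ℝ, 0 ≤ s → s ≤ t →
        |w t - w s| ≤ (M + M * A + C * M + 6 * C * (M + M) * A) * (t - s) := by
      intro s t hs hst
      have hts : 0 ≤ t - s := by linarith
      have a1 := abs_integral_sub_le_of_abs_sub_le (μ := (μ t.toNNReal : Measure (Dom k₁ k₂)))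
        (i2 t _) (i2 s _) (fun x => b3 x s t)
      have a2 := (hwcl s t hs hst).integral_le ⟨M, fun x => b1 x s⟩ (b2 s)
      have a3 := abs_integral_sub_le_of_abs_sub_le (μ := (μ t.toNNReal : Measure (Dom k₁ k₂)))
        (hV.integrable_inner (b5 t) (μ t.toNNReal) _) (hV.integrable_inner (b5 s) (μ t.toNNReal) _)
        (ε := C * (M * |t - s|)) (fun x => by
          rw [← inner_sub_right]
          exact (abs_real_inner_le_norm _ _).trans
            (mul_le_mul (hV.bdd _ x) (b6 x s t) (norm_nonneg _) hC))
      have a4 := hV.abs_flux_sub_le (b5 s) (hwcl s t hs hst)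
      rw [abs_of_nonneg hts] at a1 a3
      simp only [hw, flux]
      rw [abs_le] at *
      constructor <;> nlinarith [a1.1, a1.2, a2.1, a2.2, a3.1, a3.2, a4.1, a4.2]
    set cw := M + M * A + C * M + 6 * C * (M + M) * A with hcw
    have hcw0 : 0 ≤ cw := by positivity
    have hwcont : ContinuousOn w (Set.Ici 0) := by
      refine LipschitzOnWith.continuousOn (K := cw.toNNReal)
        (LipschitzOnWith.of_dist_le_mul fun s hs t ht => ?_)
      rw [Real.coe_toNNReal _ hcw0, Real.dist_eq, Real.dist_eq]
      rcases le_total s t with hst | hst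
      · rw [abs_sub_comm, abs_sub_comm s t, abs_of_nonneg (by linarith : 0 ≤ t - s)]
        exact hwlip s t hs hst
      · rw [abs_of_nonneg (by linarith : 0 ≤ s - t)]
        exact hwlip t s ht hst
    set cm := M + M * A + A * (M + M) with hcm
    have hcm0 : 0 ≤ cm := by positivity
    have hmlip : ∀ s t : ℝ, 0 ≤ s → s ≤ t → |m t - m s| ≤ (M + M * A) * (t - s) := by
      intro s t hs hst
      have hts : 0 ≤ t - s := by linarith
      have hdiff : ∀ x, |φ (x, t) - φ (x, s)| ≤ M * (t - s) := fun x => by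
        have hd : ∀ r ∈ (Set.univ : Set ℝ), DifferentiableAt ℝ (fun r => φ (x, r)) r := by
          intro r _
          have := hφ.contDiff_liftST.differentiable (by simp)
          obtain ⟨u, rfl⟩ := pr_surjective x
          exact ((this (u, r)).hasFDerivAt.comp_hasDerivAt r
            ((hasDerivAt_const r u).prodMk (hasDerivAt_id r))).differentiableAt
        have := convex_univ.norm_image_sub_le_of_norm_deriv_le hd (fun r _ => b1 x r)
          (Set.mem_univ s) (Set.mem_univ t)
        simpa [abs_of_nonneg hts] using this
      have a1 := abs_integral_sub_le_of_abs_sub_le (μ := (μ t.toNNReal : Measure (Dom k₁ k₂)))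
        (i1 t _) (i1 s _) hdiff
      have a2 := (hwcl s t hs hst).integral_le (b5 s).bdd (b5 s).lip
      simp only [hm]
      rw [abs_le] at *
      constructor <;> nlinarith [a1.1, a1.2, a2.1, a2.2]
    have hmcont : ContinuousOn m (Set.Ici 0) := by
      refine LipschitzOnWith.continuousOn (K := (M + M * A).toNNReal)
        (LipschitzOnWith.of_dist_le_mul fun s hs t ht => ?_)
      rw [Real.coe_toNNReal _ (by positivity), Real.dist_eq, Real.dist_eq]
      rcases le_total s t with hst | hst
      · rw [abs_sub_comm, abs_sub_comm s t, abs_of_nonneg (by linarith : 0 ≤ t - s)]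
        exact hmlip s t hs hst
      · rw [abs_of_nonneg (by linarith : 0 ≤ s - t)]
        exact hmlip t s ht hst
    -- The expansion starts at the left end `s`, so it yields a right derivative. With continuity of
    -- `m` this is enough for the fundamental theorem.
    have hderiv : ∀ s, 0 ≤ s → HasDerivWithinAt m (w s) (Set.Ioi s) s := by
      intro s hs
      rw [hasDerivWithinAt_iff_isLittleO]
      have h1 : (fun t => m t - m s - (t - s) • w s) =O[nhdsWithin s (Set.Ioi s)]
          fun t => (t - s) ^ 2 := by
        refine Asymptotics.IsBigO.of_bound cm ?_
        have : Set.Ioc s (s + 1) ∈ nhdsWithin s (Set.Ioi s) :=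
          Ioc_mem_nhdsGT (by linarith)
        filter_upwards [this] with t ht
        rw [Real.norm_eq_abs, Real.norm_of_nonneg (sq_nonneg _), smul_eq_mul]
        exact hexp s t hs ht.1.le ht.2
      refine h1.trans_isLittleO ?_
      have h2 : (fun t : ℝ => (t - s) ^ 2) =o[nhds s] fun t => t - s := by
        have := (Asymptotics.isLittleO_pow_id (𝕜 := ℝ) one_lt_two).comp_tendsto
          (k := fun t : ℝ => t - s) (l' := nhds s)
          (by simpa using (continuous_id.sub continuous_const).tendsto s (f := fun t : ℝ => t - s))
        exact this
      exact h2.mono nhdsWithin_le_nhds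
    have hmR : ∀ t, R < t → m t = 0 := fun t ht => by
      simp only [hm, b7 t ht, integral_zero]
    have hwR : ∀ t, R < t → w t = 0 := fun t ht => by
      have e1 : ∀ x, deriv (fun s => φ (x, s)) t = 0 := fun x => by
        have : (fun s => φ (x, s)) =ᶠ[nhds t] fun _ => 0 := by
          filter_upwards [lt_mem_nhds ht] with s hs using b7 s hs x
        rw [this.deriv_eq, deriv_const]
      have e2 : (fun x => φ (x, t)) = fun _ => 0 := funext fun x => b7 t ht x
      have e3 : grad (fun x : Dom k₁ k₂ => φ (x, t)) = fun _ => 0 := by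
        funext x
        rw [e2, grad, gradient_fun_const]
      simp only [hw, e1, e3, flux, inner_zero_right, integral_zero, add_zero]
    have hwint : IntervalIntegrable w volume 0 (R + 1) :=
      (hwcont.mono (by rw [Set.uIcc_of_le (by linarith)]; exact Set.Icc_subset_Ici_self)).intervalIntegrable
    have hftc := intervalIntegral.integral_eq_sub_of_hasDeriv_right (a := 0) (b := R + 1)
      (hmcont.mono (by rw [Set.uIcc_of_le (by linarith)]; exact Set.Icc_subset_Ici_self))
      (fun x hx => hderiv x (by
        rw [min_eq_left (by linarith)] at hx; exact hx.1.le)) hwint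
    rw [hmR (R + 1) (by linarith), intervalIntegral.integral_of_le (by linarith)] at hftc
    have hIoi : IntegrableOn w (Set.Ioi 0) := by
      have h1 : IntegrableOn w (Set.Ioc 0 (R + 1)) :=
        (intervalIntegrable_iff_integrableOn_Ioc_of_le (by linarith)).1 hwint
      have h2 : IntegrableOn w (Set.Ioi (R + 1)) :=
        integrableOn_zero.congr_fun (fun t ht => (hwR t (by have : R + 1 < t := ht; linarith)).symm)
          measurableSet_Ioi
      rw [← Set.Ioc_union_Ioi_eq_Ioi (by linarith : (0 : ℝ) ≤ R + 1)]
      exact h1.union h2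
    have hsplit : ∫ t in Set.Ioi (0 : ℝ), w t = ∫ t in Set.Ioc 0 (R + 1), w t := by
      refine (setIntegral_eq_of_subset_of_forall_sdiff_eq_zero measurableSet_Ioi
        Set.Ioc_subset_Ioi_self fun t ht => hwR t ?_)
      have : ¬ (t ≤ R + 1) := fun hle => ht.2 ⟨ht.1, hle⟩
      linarith
    have hEq : Set.EqOn (fun t : ℝ => weakIntegrand V μ φ t.toNNReal) w (Set.Ioi 0) :=
      fun t ht => hweq t (le_of_lt ht)
    refine ⟨hIoi.congr_fun hEq.symm measurableSet_Ioi, ?_⟩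
    rw [setIntegral_congr_fun measurableSet_Ioi hEq, hsplit, hftc]
    simp [hm]
  exact ⟨weakly_continuous_of_lip hA hclose, fun φ hφ => (key φ hφ).1, fun φ hφ => (key φ hφ).2⟩

end

end

/-! ### Meshes -/

instance ZMod.instCountable (n : ℕ) : Countable (ZMod n) :=
  (ZMod.intCast_surjective (n := n)).countable

section OneDim
variable {k : Axis} (m : Mesh k)

theorem Axis.proj_add_int_mul_period (k : Axis) (r : ℝ) (n : ℤ) :
    k.proj (r + n * k.period) = k.proj r := (k.proj_eq_proj_iff _ _).2 ⟨n, rfl⟩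

/-- The number of the cell of the real line that contains `r`. -/
def Mesh.cellNumber (r : ℝ) : ℤ := ⌊(r - m.origin) / m.step + 1 / 2⌋

theorem Mesh.cellNumber_eq_iff (r : ℝ) (z : ℤ) : m.cellNumber r = z ↔
    r ∈ Set.Ico (m.origin + z * m.step - m.step / 2) (m.origin + z * m.step + m.step / 2) := by
  have h := m.step_pos
  rw [Mesh.cellNumber, Int.floor_eq_iff, Set.mem_Ico]
  have e : (r - m.origin) / m.step + 1 / 2 = (r - m.origin + m.step / 2) / m.step := by
    field_simp
  rw [e, le_div_iff₀ h, div_lt_iff₀ h]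
  constructor <;> rintro ⟨h1, h2⟩ <;> constructor <;> linarith

theorem Mesh.cellNumber_add (r : ℝ) (z : ℤ) :
    m.cellNumber (r + z * m.step) = m.cellNumber r + z := by
  have h := m.step_pos
  rw [Mesh.cellNumber, Mesh.cellNumber, ← Int.floor_add_intCast]
  congr 1
  field_simp
  ring

theorem Mesh.cellNumber_add_period (r : ℝ) (n : ℤ) :
    m.cellNumber (r + n * k.period) = m.cellNumber r + n * m.cells := by
  have := m.cellNumber_add r (n * m.cells)
  rw [← this, ← m.cells_mul_step]
  push_cast
  ring_nf

/-- The formula includes the line, where `m.cells = 0`: there `z % 0 = z` and `z / 0 = 0`. -/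
theorem Mesh.coord_intCast (z : ℤ) :
    m.coord (z : ZMod m.cells) = m.origin + z * m.step + ((-(z / m.cells) : ℤ) : ℝ) * k.period := by
  rw [Mesh.coord, ZMod.coe_intCast, Int.emod_def, ← m.cells_mul_step]
  push_cast
  ring

theorem Mesh.point_intCast (z : ℤ) :
    m.point (z : ZMod m.cells) = k.proj (m.origin + z * m.step) := by
  rw [Mesh.point, Mesh.coord_intCast, Axis.proj_add_int_mul_period]

/-- A period is a whole number of cells, so the number of the cell around a lift, reduced modulo
`m.cells`, depends only on the projected point. -/
theorem Mesh.proj_mem_cell_iff (r : ℝ) (i : m.Index) :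
    k.proj r ∈ m.cell i ↔ i = (m.cellNumber r : ZMod m.cells) := by
  constructor
  · rintro ⟨r', hr', he⟩
    obtain ⟨n, hn⟩ := (k.proj_eq_proj_iff r r').1 he.symm
    have h1 : m.cellNumber r' = ZMod.cast i := (m.cellNumber_eq_iff _ _).2 hr'
    rw [hn, m.cellNumber_add_period, h1]
    simp
  · rintro rfl
    set z := m.cellNumber r with hz
    have h1 := (m.cellNumber_eq_iff r z).1 hz.symm
    refine ⟨r + ((-(z / m.cells) : ℤ) : ℝ) * k.period, ?_, k.proj_add_int_mul_period _ _⟩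
    rw [m.coord_intCast, Set.mem_Ico]
    constructor <;> linarith [h1.1, h1.2]

/-- The index of the cell that contains `x`. -/
def Mesh.index (x : k.Space) : m.Index := m.cellNumber (k.proj_surjective x).choose

theorem Mesh.mem_cell_iff (x : k.Space) (i : m.Index) : x ∈ m.cell i ↔ m.index x = i := by
  have := m.proj_mem_cell_iff (k.proj_surjective x).choose i
  rw [(k.proj_surjective x).choose_spec] at this
  rw [this, Mesh.index, eq_comm]

theorem Mesh.index_proj (r : ℝ) : m.index (k.proj r) = (m.cellNumber r : ZMod m.cells) :=
  (m.mem_cell_iff _ _).1 ((m.proj_mem_cell_iff r _).2 rfl)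

theorem Mesh.index_add_proj_step (x : k.Space) : m.index (x + k.proj m.step) = m.index x + 1 := by
  obtain ⟨r, rfl⟩ := k.proj_surjective x
  have := m.cellNumber_add r 1
  rw [Int.cast_one, one_mul] at this
  rw [← k.proj_add, m.index_proj, m.index_proj, this]
  push_cast; rfl

theorem Mesh.point_add_one (i : m.Index) : m.point (i + 1) = m.point i + k.proj m.step := by
  obtain ⟨z, rfl⟩ := ZMod.intCast_surjective i
  have e : (z : ZMod m.cells) + 1 = ((z + 1 : ℤ) : ZMod m.cells) := by push_cast; rfl
  rw [e, m.point_intCast, m.point_intCast, ← k.proj_add]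
  push_cast
  ring_nf

theorem Mesh.exists_point_add {x : k.Space} {i : m.Index} (hx : x ∈ m.cell i) :
    ∃ a : ℝ, |a| ≤ m.step / 2 ∧ x = m.point i + k.proj a := by
  obtain ⟨r, hr, rfl⟩ := hx
  refine ⟨r - m.coord i, ?_, ?_⟩
  · rw [abs_le]; constructor <;> linarith [hr.1, hr.2]
  · rw [Mesh.point, ← k.proj_add, add_sub_cancel]

/-- A half-open interval is a countable union of compact ones, and the projection maps these to
compact sets. -/
theorem Mesh.measurableSet_cell (i : m.Index) : MeasurableSet (m.cell i) := by
  have h := m.step_pos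
  have e : Set.Ico (m.coord i - m.step / 2) (m.coord i + m.step / 2) =
      ⋃ n : ℕ, Set.Icc (m.coord i - m.step / 2) (m.coord i + m.step / 2 - 1 / ((n : ℝ) + 1)) := by
    ext r
    simp only [Set.mem_Ico, Set.mem_iUnion, Set.mem_Icc]
    constructor
    · rintro ⟨h1, h2⟩
      obtain ⟨n, hn⟩ := exists_nat_one_div_lt (sub_pos.2 h2)
      exact ⟨n, h1, by linarith⟩
    · rintro ⟨n, h1, h2⟩
      have : 0 < 1 / ((n : ℝ) + 1) := by positivity
      exact ⟨h1, by linarith⟩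
  rw [Mesh.cell, e, Set.image_iUnion]
  exact MeasurableSet.iUnion fun n =>
    (isCompact_Icc.image k.continuous_proj).isClosed.measurableSet

theorem Axis.volume_closedBall_le (k : Axis) (x : k.Space) (r : ℝ) :
    volume (Metric.closedBall x r) ≤ ENNReal.ofReal (2 * r) := by
  cases k
  · exact (Real.volume_closedBall (a := x) (r := r)).le
  · refine (AddCircle.volume_closedBall (2 * Real.pi) (x := x) r).trans_le ?_
    exact ENNReal.ofReal_le_ofReal (min_le_right _ _)

theorem Mesh.step_le_period {m : Mesh .circle} : m.step ≤ 2 * Real.pi := by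
  have h := m.cells_mul_step
  have h0 := m.step_pos
  have hc : m.cells ≠ 0 := fun hc => by
    rw [hc] at h
    simp only [Axis.period, Nat.cast_zero, zero_mul] at h
    linarith [Real.two_pi_pos]
  have h1 : (1 : ℝ) ≤ m.cells := by exact_mod_cast Nat.one_le_iff_ne_zero.2 hc
  simp only [Axis.period] at h
  nlinarith

theorem Mesh.volume_ball (x : k.Space) :
    volume (Metric.ball x (m.step / 2)) = ENNReal.ofReal m.step := by
  cases k
  · refine (Real.volume_ball (a := x) (r := m.step / 2)).trans ?_
    ring_nf
  · refine (measure_congr (AddCircle.closedBall_ae_eq_ball (T := 2 * Real.pi) (x := x)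
      (ε := m.step / 2)).symm).trans ?_
    refine (AddCircle.volume_closedBall (2 * Real.pi) (x := x) _).trans ?_
    rw [mul_div_cancel₀ _ (two_ne_zero), min_eq_right m.step_le_period]

theorem Axis.image_Ico_subset (k : Axis) (c r : ℝ) :
    k.proj '' Set.Ico (c - r) (c + r) ⊆ Metric.closedBall (k.proj c) r := by
  rintro _ ⟨s, hs, rfl⟩
  rw [mem_closedBall_iff_norm, ← k.proj_sub]
  refine (k.norm_proj_le _).trans ?_
  rw [abs_le]; constructor <;> linarith [hs.1, hs.2]

theorem Axis.ball_subset_image (k : Axis) (c r : ℝ) :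
    Metric.ball (k.proj c) r ⊆ k.proj '' Set.Ico (c - r) (c + r) := by
  intro x hx
  rw [mem_ball_iff_norm] at hx
  obtain ⟨a, ha, ha'⟩ := k.exists_proj (x - k.proj c)
  rw [← ha', abs_lt] at hx
  exact ⟨c + a, ⟨by linarith [hx.1], by linarith [hx.2]⟩, by rw [k.proj_add, ha]; abel⟩

/-- The cell lies between the open and the closed ball of radius `m.step / 2` about its midpoint, so
injectivity of the projection on the cell is not needed. -/
theorem Mesh.volume_cell (i : m.Index) : volume (m.cell i) = ENNReal.ofReal m.step := by
  refine le_antisymm ?_ ?_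
  · refine (measure_mono (k.image_Ico_subset _ _)).trans ((k.volume_closedBall_le _ _).trans ?_)
    rw [mul_div_cancel₀ _ (two_ne_zero)]
  · rw [← m.volume_ball (k.proj (m.coord i))]
    exact measure_mono (k.ball_subset_image _ _)

/-- The part of the `i`-th cell that a translation by `v` moves to another cell. -/
def Mesh.strip (v : ℝ) (i : m.Index) : Set k.Space :=
  m.cell i ∩ {x | m.index (x + k.proj v) ≠ i}

/-- A point that leaves the cell lies within `v` of its right end and, as `v ≤ m.step`, cannot pass
beyond the next cell. The enclosing ball bounds the measure of the strip. -/
theorem Mesh.index_of_mem_strip {v : ℝ} (hv : 0 ≤ v) (hvs : v ≤ m.step) {i : m.Index} {x : k.Space}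
    (hx : x ∈ m.strip v i) : m.index (x + k.proj v) = i + 1 ∧
      x ∈ Metric.closedBall (k.proj (m.coord i + m.step / 2 - v / 2)) (v / 2) := by
  obtain ⟨⟨r, hr, rfl⟩, hne⟩ := hx
  simp only [Set.mem_ofPred_eq, ← k.proj_add, m.index_proj] at hne ⊢
  obtain ⟨z, rfl⟩ := ZMod.intCast_surjective i
  set c := m.coord (z : ZMod m.cells) with hc
  have hcz : c = m.origin + ((ZMod.cast (z : ZMod m.cells) : ℤ) : ℝ) * m.step := rfl
  set y : ℤ := ZMod.cast (z : ZMod m.cells) with hy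
  have hyz : (y : ZMod m.cells) = z := by rw [hy, ZMod.intCast_zmod_cast]
  have h1 : ¬ (r + v < c + m.step / 2) := fun h => by
    refine hne ?_
    rw [(m.cellNumber_eq_iff (r + v) y).2 ⟨by rw [← hcz]; linarith [hr.1], by rw [← hcz]; exact h⟩,
      hyz]
  rw [not_lt] at h1
  constructor
  · rw [(m.cellNumber_eq_iff (r + v) (y + 1)).2 ⟨?_, ?_⟩]
    · push_cast; rw [hyz]
    · push_cast; linarith [hr.1]
    · push_cast; linarith [hr.2]
  · rw [mem_closedBall_iff_norm, ← k.proj_sub]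
    refine (k.norm_proj_le _).trans ?_
    rw [abs_le]; constructor <;> linarith [hr.1, hr.2]

theorem Mesh.volume_strip_le {v : ℝ} (hv : 0 ≤ v) (hvs : v ≤ m.step) (i : m.Index) :
    volume (m.strip v i) ≤ ENNReal.ofReal v := by
  refine (measure_mono fun x hx => (m.index_of_mem_strip hv hvs hx).2).trans
    ((k.volume_closedBall_le _ _).trans ?_)
  rw [mul_div_cancel₀ _ (two_ne_zero)]

end OneDim

section TwoDim
variable {k₁ k₂ : Axis} {m₁ : Mesh k₁} {m₂ : Mesh k₂}

/-- The product cells. -/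
def gridCell (m₁ : Mesh k₁) (m₂ : Mesh k₂) (p : m₁.Index × m₂.Index) : Set (Dom k₁ k₂) :=
  m₁.cell p.1 ×ˢ m₂.cell p.2

/-- The midpoints of the product cells. -/
def gridPoint (m₁ : Mesh k₁) (m₂ : Mesh k₂) (p : m₁.Index × m₂.Index) : Dom k₁ k₂ :=
  (m₁.point p.1, m₂.point p.2)

theorem mem_gridCell_iff (x : Dom k₁ k₂) (p : m₁.Index × m₂.Index) :
    x ∈ gridCell m₁ m₂ p ↔ (m₁.index x.1, m₂.index x.2) = p := by
  rw [gridCell, Set.mem_prod, Mesh.mem_cell_iff, Mesh.mem_cell_iff, Prod.ext_iff]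

theorem measurableSet_gridCell (p : m₁.Index × m₂.Index) : MeasurableSet (gridCell m₁ m₂ p) :=
  (m₁.measurableSet_cell p.1).prod (m₂.measurableSet_cell p.2)

theorem pairwise_disjoint_gridCell : Pairwise (Function.onFun Disjoint (gridCell m₁ m₂)) := by
  intro p q hpq
  refine Set.disjoint_left.2 fun x hp hq => hpq ?_
  rw [mem_gridCell_iff] at hp hq
  rw [← hp, hq]

theorem iUnion_gridCell : ⋃ p, gridCell m₁ m₂ p = Set.univ :=
  Set.eq_univ_of_forall fun x => Set.mem_iUnion.2
    ⟨(m₁.index x.1, m₂.index x.2), (mem_gridCell_iff _ _).2 rfl⟩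

theorem volume_gridCell (p : m₁.Index × m₂.Index) :
    volume (gridCell m₁ m₂ p) = ENNReal.ofReal (m₁.step * m₂.step) := by
  rw [gridCell, Measure.volume_eq_prod, Measure.prod_prod, m₁.volume_cell, m₂.volume_cell,
    ENNReal.ofReal_mul m₁.step_pos.le]

theorem piecewiseConst_eq (a : GridFun m₁ m₂) (x : Dom k₁ k₂) :
    piecewiseConst a x = a (m₁.index x.1) (m₂.index x.2) := by
  rw [piecewiseConst, tsum_eq_single (m₁.index x.1, m₂.index x.2)]
  · exact Set.indicator_of_mem ((mem_gridCell_iff x _).2 rfl) _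
  · intro p hp
    exact Set.indicator_of_notMem (fun h => hp ((mem_gridCell_iff x p).1 h).symm) _

theorem piecewiseConst_of_mem (a : GridFun m₁ m₂) {x : Dom k₁ k₂} {p : m₁.Index × m₂.Index}
    (hx : x ∈ gridCell m₁ m₂ p) : piecewiseConst a x = a p.1 p.2 := by
  rw [piecewiseConst_eq, ← (mem_gridCell_iff x p).1 hx]

theorem measurable_piecewiseConst (a : GridFun m₁ m₂) : Measurable (piecewiseConst a) := by
  intro S _
  have : piecewiseConst a ⁻¹' S = ⋃ p : {p : m₁.Index × m₂.Index // a p.1 p.2 ∈ S},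
      gridCell m₁ m₂ p := by
    ext x
    simp only [Set.mem_preimage, Set.mem_iUnion, piecewiseConst_eq, mem_gridCell_iff]
    constructor
    · intro h; exact ⟨⟨_, h⟩, rfl⟩
    · rintro ⟨⟨p, hp⟩, rfl⟩; exact hp
  rw [this]
  exact MeasurableSet.iUnion fun p => measurableSet_gridCell _

/-- Grid functions that are probability densities. -/
structure IsGridDensity (a : GridFun m₁ m₂) : Prop where
  nonneg : ∀ i j, 0 ≤ a i j
  hasSum : HasSum (fun p : m₁.Index × m₂.Index => a p.1 p.2 * (m₁.step * m₂.step)) 1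

theorem step_mul_pos (m₁ : Mesh k₁) (m₂ : Mesh k₂) : 0 < m₁.step * m₂.step :=
  mul_pos m₁.step_pos m₂.step_pos

theorem IsGridDensity.tsum_ofReal {a : GridFun m₁ m₂} (h : IsGridDensity a) :
    ∑' p : m₁.Index × m₂.Index, ENNReal.ofReal (a p.1 p.2 * (m₁.step * m₂.step)) = 1 := by
  rw [← ENNReal.ofReal_tsum_of_nonneg (fun p => mul_nonneg (h.nonneg _ _) (step_mul_pos m₁ m₂).le)
    h.hasSum.summable, h.hasSum.tsum_eq, ENNReal.ofReal_one]

theorem cellwise_eq (a : GridFun m₁ m₂) :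
    Realization.cellwise.measure a = densityMeasure (piecewiseConst a) := rfl

theorem densityMeasure_gridCell (a : GridFun m₁ m₂) (ha : ∀ i j, 0 ≤ a i j)
    (p : m₁.Index × m₂.Index) : densityMeasure (piecewiseConst a) (gridCell m₁ m₂ p) =
      ENNReal.ofReal (a p.1 p.2 * (m₁.step * m₂.step)) := by
  rw [densityMeasure, withDensity_apply _ (measurableSet_gridCell p),
    setLIntegral_congr_fun (g := fun _ => ENNReal.ofReal (a p.1 p.2)) (measurableSet_gridCell p)
      (fun x hx => by simp only [piecewiseConst_of_mem a hx]), setLIntegral_const,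
    volume_gridCell, ENNReal.ofReal_mul (ha _ _)]

theorem IsGridDensity.isProbabilityMeasure {a : GridFun m₁ m₂} (h : IsGridDensity a) :
    ∀ r : Realization, IsProbabilityMeasure (r.measure a)
  | .pointMasses => ⟨by
      rw [Realization.measure, Measure.sum_apply _ MeasurableSet.univ]
      simpa using h.tsum_ofReal⟩
  | .cellwise => ⟨by
      rw [cellwise_eq, ← iUnion_gridCell (m₁ := m₁) (m₂ := m₂),
        measure_iUnion pairwise_disjoint_gridCell measurableSet_gridCell]
      simp only [densityMeasure_gridCell a h.nonneg, h.tsum_ofReal]⟩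

/-- Integration against the point masses. -/
theorem IsGridDensity.hasSum_pointMasses {a : GridFun m₁ m₂} (h : IsGridDensity a)
    {ψ : Dom k₁ k₂ → ℝ} (hb : ∃ B, ∀ x, |ψ x| ≤ B) (hm : Measurable ψ) :
    HasSum (fun p : m₁.Index × m₂.Index =>
        a p.1 p.2 * (m₁.step * m₂.step) * ψ (gridPoint m₁ m₂ p))
      (∫ x, ψ x ∂(Realization.pointMasses.measure a)) := by
  have := h.isProbabilityMeasure .pointMasses
  have hi := integrable_of_bdd (μ := Realization.pointMasses.measure a) hb hm
  have := hasSum_integral_measure hi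
  refine this.congr_fun fun p => ?_
  rw [integral_smul_measure, integral_dirac' _ _ hm.stronglyMeasurable,
    ENNReal.toReal_ofReal (mul_nonneg (h.nonneg _ _) (step_mul_pos m₁ m₂).le), smul_eq_mul]
  rfl

theorem hasSum_gridCell {ν : Measure (Dom k₁ k₂)} {ψ : Dom k₁ k₂ → ℝ} (hi : Integrable ψ ν) :
    HasSum (fun p => ∫ x in gridCell m₁ m₂ p, ψ x ∂ν) (∫ x, ψ x ∂ν) := by
  have := hasSum_integral_iUnion (μ := ν) (f := ψ) (s := gridCell m₁ m₂) measurableSet_gridCell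
    pairwise_disjoint_gridCell hi.integrableOn
  rwa [iUnion_gridCell, Measure.restrict_univ] at this

theorem exists_pr_of_mem_gridCell {x : Dom k₁ k₂} {p : m₁.Index × m₂.Index}
    (hx : x ∈ gridCell m₁ m₂ p) :
    ∃ w : Plane, ‖w‖ ≤ m₁.step + m₂.step ∧ x = gridPoint m₁ m₂ p + pr w := by
  obtain ⟨a, ha, hxa⟩ := m₁.exists_point_add hx.1
  obtain ⟨b, hb, hxb⟩ := m₂.exists_point_add hx.2
  refine ⟨!₂[a, b], ?_, ?_⟩
  · have e : (!₂[a, b] : Plane) = !₂[a, 0] + !₂[0, b] := by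
      ext i; fin_cases i <;> simp
    rw [e]
    refine (norm_add_le _ _).trans ?_
    rw [norm_plane_fst, norm_plane_snd]
    linarith [m₁.step_pos, m₂.step_pos]
  · ext
    · simpa [pr, gridPoint] using hxa
    · simpa [pr, gridPoint] using hxb

/-- A measure with the cell masses of `a` is close to the point masses. -/
theorem IsGridDensity.wClose_pointMasses {a : GridFun m₁ m₂} (h : IsGridDensity a)
    {ν : Measure (Dom k₁ k₂)} [IsProbabilityMeasure ν]
    (hν : ∀ p, ν (gridCell m₁ m₂ p) = ENNReal.ofReal (a p.1 p.2 * (m₁.step * m₂.step))) :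
    WClose ν (Realization.pointMasses.measure a) (m₁.step + m₂.step) := by
  intro ψ hb hl
  have hm := hl.continuous.measurable
  have hi := integrable_of_bdd (μ := ν) hb hm
  have h1 := hasSum_gridCell (m₁ := m₁) (m₂ := m₂) hi
  have h2 := h.hasSum_pointMasses hb hm
  have h3 := h1.sub h2
  have h4 := h.hasSum.mul_left (m₁.step + m₂.step)
  rw [mul_one] at h4
  have hterm : ∀ p : m₁.Index × m₂.Index, |(∫ x in gridCell m₁ m₂ p, ψ x ∂ν) -
      a p.1 p.2 * (m₁.step * m₂.step) * ψ (gridPoint m₁ m₂ p)| ≤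
      (m₁.step + m₂.step) * (a p.1 p.2 * (m₁.step * m₂.step)) := by
    intro p
    have hmass : ν.real (gridCell m₁ m₂ p) = a p.1 p.2 * (m₁.step * m₂.step) := by
      rw [Measure.real, hν, ENNReal.toReal_ofReal
        (mul_nonneg (h.nonneg _ _) (step_mul_pos m₁ m₂).le)]
    have e : a p.1 p.2 * (m₁.step * m₂.step) * ψ (gridPoint m₁ m₂ p) =
        ∫ _ in gridCell m₁ m₂ p, ψ (gridPoint m₁ m₂ p) ∂ν := by
      rw [setIntegral_const, hmass, smul_eq_mul]
    have hc : IntegrableOn (fun _ => ψ (gridPoint m₁ m₂ p)) (gridCell m₁ m₂ p) ν :=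
      integrableOn_const (measure_ne_top ν _)
    rw [e, ← integral_sub hi.integrableOn hc, ← hmass, ← Real.norm_eq_abs]
    refine norm_setIntegral_le_of_norm_le_const (measure_lt_top ν _) fun x hx => ?_
    obtain ⟨w, hw, rfl⟩ := exists_pr_of_mem_gridCell hx
    exact (hl _ _).trans (by rw [one_mul]; exact hw)
  rw [abs_le]
  constructor
  · have := hasSum_le (fun p => (abs_le.1 (hterm p)).1) h4.neg h3
    linarith
  · exact hasSum_le (fun p => (abs_le.1 (hterm p)).2) h3 h4

theorem IsGridDensity.wClose_realization {a : GridFun m₁ m₂} (h : IsGridDensity a) :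
    ∀ r : Realization,
      WClose (r.measure a) (Realization.pointMasses.measure a) (m₁.step + m₂.step)
  | .pointMasses => (WClose.refl _).mono (add_nonneg m₁.step_pos.le m₂.step_pos.le)
  | .cellwise => by
      have := h.isProbabilityMeasure .cellwise
      exact h.wClose_pointMasses (densityMeasure_gridCell a h.nonneg)

/-! ### The initial cell averages -/

theorem integral_density_gridCell {μ₀ : ProbabilityMeasure (Dom k₁ k₂)}
    (hac : (μ₀ : Measure (Dom k₁ k₂)) ≪ volume) (p : m₁.Index × m₂.Index) :
    ∫ x in gridCell m₁ m₂ p, density μ₀ x = (μ₀ : Measure (Dom k₁ k₂)).real (gridCell m₁ m₂ p) :=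
  Measure.setIntegral_toReal_rnDeriv hac _

theorem cellAverages_mul {μ₀ : ProbabilityMeasure (Dom k₁ k₂)}
    (hac : (μ₀ : Measure (Dom k₁ k₂)) ≪ volume) (p : m₁.Index × m₂.Index) :
    cellAverages m₁ m₂ μ₀ p.1 p.2 * (m₁.step * m₂.step) =
      (μ₀ : Measure (Dom k₁ k₂)).real (gridCell m₁ m₂ p) := by
  rw [cellAverages, div_mul_cancel₀ _ (step_mul_pos m₁ m₂).ne']
  exact integral_density_gridCell hac p

theorem isGridDensity_cellAverages {μ₀ : ProbabilityMeasure (Dom k₁ k₂)}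
    (hac : (μ₀ : Measure (Dom k₁ k₂)) ≪ volume) : IsGridDensity (cellAverages m₁ m₂ μ₀) where
  nonneg i j := div_nonneg (integral_nonneg fun x => ENNReal.toReal_nonneg) (step_mul_pos m₁ m₂).le
  hasSum := by
    simp only [cellAverages_mul hac]
    have := hasSum_gridCell (m₁ := m₁) (m₂ := m₂) (ν := (μ₀ : Measure (Dom k₁ k₂)))
      (integrable_const (1 : ℝ))
    simpa using this

theorem wClose_cellAverages {μ₀ : ProbabilityMeasure (Dom k₁ k₂)}
    (hac : (μ₀ : Measure (Dom k₁ k₂)) ≪ volume) :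
    WClose (μ₀ : Measure (Dom k₁ k₂)) (Realization.pointMasses.measure (cellAverages m₁ m₂ μ₀))
      (m₁.step + m₂.step) :=
  (isGridDensity_cellAverages hac).wClose_pointMasses fun p => by
    rw [cellAverages_mul hac, Measure.real, ENNReal.ofReal_toReal (measure_ne_top _ _)]

end TwoDim

/-! ### The Lax–Friedrichs step on an abstract grid -/

theorem summable_mul_of_abs_le {P : Type*} {A : P → ℝ} (hA : Summable A) {g : P → ℝ} {B : ℝ}
    (hg : ∀ p, |g p| ≤ B) : Summable fun p => A p * g p :=
  Summable.of_norm_bounded (hA.abs.mul_right B) fun p => by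
    rw [Real.norm_eq_abs, abs_mul]
    exact mul_le_mul_of_nonneg_left (hg p) (abs_nonneg _)

section GridStep
variable {P : Type*} [AddCommGroup P]

/-- The Lax–Friedrichs step in conservative form, with Courant numbers `u / 2` and `w / 2`. -/
def gridStep (e₁ e₂ : P) (u w A : P → ℝ) (p : P) : ℝ :=
  (1 / 4 - u (p + e₁)) * A (p + e₁) + (1 / 4 + u (p - e₁)) * A (p - e₁) +
    ((1 / 4 - w (p + e₂)) * A (p + e₂) + (1 / 4 + w (p - e₂)) * A (p - e₂))

variable {e₁ e₂ : P} {u w A : P → ℝ}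

theorem hasSum_comp_add (e : P) {f : P → ℝ} {s : ℝ} (h : HasSum f s) :
    HasSum (fun p => f (p + e)) s := (Equiv.addRight e).hasSum_iff.2 h

theorem hasSum_comp_sub (e : P) {f : P → ℝ} {s : ℝ} (h : HasSum f s) :
    HasSum (fun p => f (p - e)) s := (Equiv.subRight e).hasSum_iff.2 h

/-- Summation by parts. -/
theorem hasSum_gridStep_mul (hu : ∀ p, |u p| ≤ 1 / 4) (hw : ∀ p, |w p| ≤ 1 / 4) (hA : Summable A)
    {g : P → ℝ} {B : ℝ} (hg : ∀ p, |g p| ≤ B) :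
    HasSum (fun p => gridStep e₁ e₂ u w A p * g p)
      (∑' p, A p * ((1 / 4 - u p) * g (p - e₁) + (1 / 4 + u p) * g (p + e₁) +
        ((1 / 4 - w p) * g (p - e₂) + (1 / 4 + w p) * g (p + e₂)))) := by
  have hB : 0 ≤ B := (abs_nonneg _).trans (hg 0)
  have key : ∀ c : P → ℝ, (∀ p, |c p| ≤ 1 / 4) → ∀ q : P → P,
      Summable fun p => A p * ((1 / 4 + c p) * g (q p)) := fun c hc q => by
    refine summable_mul_of_abs_le hA (B := 1 / 2 * B) fun p => ?_
    rw [abs_mul]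
    have := abs_le.1 (hc p)
    refine mul_le_mul ?_ (hg _) (abs_nonneg _) (by norm_num)
    rw [abs_le]; constructor <;> linarith
  have hu' : ∀ p, |-u p| ≤ 1 / 4 := fun p => by rw [abs_neg]; exact hu p
  have hw' : ∀ p, |-w p| ≤ 1 / 4 := fun p => by rw [abs_neg]; exact hw p
  have s1 := key (fun p => -u p) hu' (fun p => p - e₁)
  have s2 := key u hu (fun p => p + e₁)
  have s3 := key (fun p => -w p) hw' (fun p => p - e₂)
  have s4 := key w hw (fun p => p + e₂)
  have h := ((hasSum_comp_add e₁ s1.hasSum).add (hasSum_comp_sub e₁ s2.hasSum)).add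
    ((hasSum_comp_add e₂ s3.hasSum).add (hasSum_comp_sub e₂ s4.hasSum))
  have e := ((s1.hasSum).add (s2.hasSum)).add ((s3.hasSum).add (s4.hasSum))
  rw [← e.tsum_eq] at h
  convert h using 1
  · ext p
    simp only [gridStep, add_sub_cancel_right, sub_add_cancel]
    ring
  · refine tsum_congr fun p => ?_
    ring

theorem hasSum_gridStep (hu : ∀ p, |u p| ≤ 1 / 4) (hw : ∀ p, |w p| ≤ 1 / 4) {s : ℝ}
    (hA : HasSum A s) : HasSum (gridStep e₁ e₂ u w A) s := by
  have := hasSum_gridStep_mul (e₁ := e₁) (e₂ := e₂) hu hw hA.summable (g := fun _ => 1) (B := 1)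
    (fun _ => by simp)
  convert this using 1
  · ext p; ring
  · rw [← hA.tsum_eq]
    refine tsum_congr fun p => ?_
    ring

/-- The bound on the Courant numbers makes the four weights nonnegative; this is the monotonicity of
the scheme. -/
theorem abs_gridStep_le (hu : ∀ p, |u p| ≤ 1 / 4) (hw : ∀ p, |w p| ≤ 1 / 4) (p : P) :
    |gridStep e₁ e₂ u w A p| ≤ gridStep e₁ e₂ u w (fun q => |A q|) p := by
  have key : ∀ c : ℝ, |c| ≤ 1 / 4 → ∀ b : ℝ, |(1 / 4 + c) * b| ≤ (1 / 4 + c) * |b| :=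
    fun c hc b => by
      rw [abs_mul, abs_of_nonneg (by linarith [abs_le.1 hc])]
  have key' : ∀ c : ℝ, |c| ≤ 1 / 4 → ∀ b : ℝ, |(1 / 4 - c) * b| ≤ (1 / 4 - c) * |b| :=
    fun c hc b => by
      rw [abs_mul, abs_of_nonneg (by linarith [abs_le.1 hc])]
  exact (abs_add_le _ _).trans (add_le_add
    ((abs_add_le _ _).trans (add_le_add (key' _ (hu _) _) (key _ (hu _) _)))
    ((abs_add_le _ _).trans (add_le_add (key' _ (hw _) _) (key _ (hw _) _))))

theorem gridStep_nonneg (hu : ∀ p, |u p| ≤ 1 / 4) (hw : ∀ p, |w p| ≤ 1 / 4) (hA : ∀ p, 0 ≤ A p)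
    (p : P) : 0 ≤ gridStep e₁ e₂ u w A p := by
  have := abs_gridStep_le (e₁ := e₁) (e₂ := e₂) (A := A) hu hw p
  simp only [fun q => abs_of_nonneg (hA q)] at this
  exact (abs_nonneg _).trans this

/-- The variation of a grid function in the direction `e`. -/
def gridVar (e : P) (A : P → ℝ) : ℝ := ∑' p, |A (p + e) - A p|

theorem gridVar_nonneg (e : P) (A : P → ℝ) : 0 ≤ gridVar e A := tsum_nonneg fun _ => abs_nonneg _

theorem hasSum_gridVar (hA : Summable A) (e : P) :
    HasSum (fun p => |A (p + e) - A p|) (gridVar e A) :=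
  ((hasSum_comp_add e hA.hasSum).summable.sub hA).abs.hasSum

/-- The commutator of a translation and the transport part of the step, in one direction. -/
theorem exists_hasSum_commutator (hA : Summable A) (e f : P) {v : P → ℝ} {D₁ D₂ : ℝ}
    (h1 : ∀ p, |v (p + e) - v p| ≤ D₁)
    (h2 : ∀ p, |v (p + f + e) - v (p + f) - (v (p - f + e) - v (p - f))| ≤ D₂) :
    ∃ B : P → ℝ, HasSum B (2 * D₁ * gridVar f A + D₂ * ∑' p, |A p|) ∧
      ∀ p, |(v (p + f + e) - v (p + f)) * A (p + f + e) -
        (v (p - f + e) - v (p - f)) * A (p - f + e)| ≤ B p := by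
  have s1 := (hasSum_gridVar hA f).mul_left D₁
  have s2 := hA.abs.hasSum.mul_left D₂
  have s := (((hasSum_comp_add e s1).add (hasSum_comp_add (e - f) s1)).add
    (hasSum_comp_add (e - f) s2))
  have es : 2 * D₁ * gridVar f A + D₂ * ∑' p, |A p| =
      D₁ * gridVar f A + D₁ * gridVar f A + D₂ * ∑' p, |A p| := by ring
  rw [es]
  refine ⟨_, s, fun p => ?_⟩
  -- The two values of `A` are `2 f` apart. This gives two variation terms weighted by a first
  -- difference of `v`, and a remainder weighted by its second difference.
  have t : (v (p + f + e) - v (p + f)) * A (p + f + e) -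
        (v (p - f + e) - v (p - f)) * A (p - f + e) =
      (v (p + f + e) - v (p + f)) * (A (p + e + f) - A (p + e)) +
      (v (p + f + e) - v (p + f)) * (A (p + (e - f) + f) - A (p + (e - f))) +
      (v (p + f + e) - v (p + f) - (v (p - f + e) - v (p - f))) * A (p + (e - f)) := by
    have a1 : p + f + e = p + e + f := by abel
    have a2 : p + (e - f) + f = p + e := by abel
    have a3 : p - f + e = p + (e - f) := by abel
    rw [a2, a3, a1]; ring
  rw [t]
  refine (abs_add_le _ _).trans (add_le_add ((abs_add_le _ _).trans (add_le_add ?_ ?_)) ?_)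
  · rw [abs_mul]; exact mul_le_mul_of_nonneg_right (h1 _) (abs_nonneg _)
  · rw [abs_mul]; exact mul_le_mul_of_nonneg_right (h1 _) (abs_nonneg _)
  · rw [abs_mul]; exact mul_le_mul_of_nonneg_right (h2 _) (abs_nonneg _)

/-- The variation of a Lax–Friedrichs step. -/
theorem gridVar_gridStep_le (hu : ∀ p, |u p| ≤ 1 / 4) (hw : ∀ p, |w p| ≤ 1 / 4) (hA : Summable A)
    (e : P) {D₁ D₂ : ℝ}
    (hu1 : ∀ p, |u (p + e) - u p| ≤ D₁) (hw1 : ∀ p, |w (p + e) - w p| ≤ D₁)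
    (hu2 : ∀ p, |u (p + e₁ + e) - u (p + e₁) - (u (p - e₁ + e) - u (p - e₁))| ≤ D₂)
    (hw2 : ∀ p, |w (p + e₂ + e) - w (p + e₂) - (w (p - e₂ + e) - w (p - e₂))| ≤ D₂) :
    gridVar e (gridStep e₁ e₂ u w A) ≤
      gridVar e A + 2 * D₁ * (gridVar e₁ A + gridVar e₂ A) + 2 * D₂ * ∑' p, |A p| := by
  obtain ⟨B₁, hB₁, hb₁⟩ := exists_hasSum_commutator hA e e₁ hu1 hu2
  obtain ⟨B₂, hB₂, hb₂⟩ := exists_hasSum_commutator hA e e₂ hw1 hw2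
  have h0 := hasSum_gridStep (e₁ := e₁) (e₂ := e₂) hu hw (hasSum_gridVar hA e)
  have hs := hasSum_gridVar (hasSum_gridStep (e₁ := e₁) (e₂ := e₂) hu hw hA.hasSum).summable e
  refine (hasSum_le (fun p => ?_) hs ((h0.add hB₁).add hB₂)).trans (le_of_eq (by ring))
  -- The difference of the step is the step of the difference, up to one commutator in each
  -- direction. The first part does not increase the `ℓ¹` norm, because the step is monotone and
  -- preserves sums.
  have t : gridStep e₁ e₂ u w A (p + e) - gridStep e₁ e₂ u w A p =
      gridStep e₁ e₂ u w (fun q => A (q + e) - A q) p -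
      ((u (p + e₁ + e) - u (p + e₁)) * A (p + e₁ + e) -
        (u (p - e₁ + e) - u (p - e₁)) * A (p - e₁ + e)) -
      ((w (p + e₂ + e) - w (p + e₂)) * A (p + e₂ + e) -
        (w (p - e₂ + e) - w (p - e₂)) * A (p - e₂ + e)) := by
    have a1 : p + e + e₁ = p + e₁ + e := by abel
    have a2 : p + e - e₁ = p - e₁ + e := by abel
    have a3 : p + e + e₂ = p + e₂ + e := by abel
    have a4 : p + e - e₂ = p - e₂ + e := by abel
    simp only [gridStep, a1, a2, a3, a4]; ring
  rw [t]
  refine (abs_sub _ _).trans (add_le_add ((abs_sub _ _).trans (add_le_add ?_ (hb₁ p))) (hb₂ p))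
  exact abs_gridStep_le hu hw p

end GridStep

/-! ### From one-step consistency to approximate solutions -/

section Steps
variable {k₁ k₂ : Axis} {V : Velocity k₁ k₂} {C R R' τ : ℝ}
  {ν : ℕ → ProbabilityMeasure (Dom k₁ k₂)}

theorem wClose_of_steps
    (h1 : ∀ n, WClose (ν n : Measure (Dom k₁ k₂)) (ν (n + 1)) (R * τ)) (n k : ℕ) :
    WClose (ν n : Measure (Dom k₁ k₂)) (ν (n + k)) (R * (k * τ)) := by
  induction k with
  | zero => exact (WClose.refl _).mono (by simp)
  | succ k ih =>
    refine (ih.trans (h1 (n + k))).mono (le_of_eq ?_)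
    push_cast; ring

/-- The one-step expansions are summed with the flux frozen at level `n`. After `k` steps the
measure has moved by at most `R k τ`, and stability of the flux turns this into the quadratic term.
-/
theorem abs_multistep_le (hV : V.Regular C) (hτ : 0 ≤ τ) (hR : 0 ≤ R)
    (h1 : ∀ n, WClose (ν n : Measure (Dom k₁ k₂)) (ν (n + 1)) (R * τ))
    (h2 : ∀ n φ G L K, IsC11 φ G L K →
      |∫ x, φ x ∂(ν (n + 1) : Measure (Dom k₁ k₂)) - ∫ x, φ x ∂(ν n : Measure (Dom k₁ k₂)) -
        τ * ∫ x, inner ℝ (V (ν n) x) (G x) ∂(ν n : Measure (Dom k₁ k₂))| ≤ R' * τ ^ 2 * (L + K))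
    (n k : ℕ) {φ : Dom k₁ k₂ → ℝ} {G : Dom k₁ k₂ → Plane} {L K : ℝ} (hφ : IsC11 φ G L K) :
    |∫ x, φ x ∂(ν (n + k) : Measure (Dom k₁ k₂)) - ∫ x, φ x ∂(ν n : Measure (Dom k₁ k₂)) -
      k * τ * ∫ x, inner ℝ (V (ν n) x) (G x) ∂(ν n : Measure (Dom k₁ k₂))| ≤
      (R' * τ * (k * τ) + 6 * C * R * (k * τ) ^ 2) * (L + K) := by
  have hC := hV.nonneg
  have hL := hφ.nonneg_lip
  have hK := hφ.nonneg_taylor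
  induction k with
  | zero => simp
  | succ k ih =>
    have a1 := h2 (n + k) φ G L K hφ
    have a2 := hV.abs_flux_sub_le hφ (wClose_of_steps h1 n k)
    set F := ∫ x, inner ℝ (V (ν n) x) (G x) ∂(ν n : Measure (Dom k₁ k₂))
    set F' := ∫ x, inner ℝ (V (ν (n + k)) x) (G x) ∂(ν (n + k) : Measure (Dom k₁ k₂))
    have a3 : |τ * F' - τ * F| ≤ τ * (6 * C * (L + K) * (R * (k * τ))) := by
      rw [← mul_sub, abs_mul, abs_of_nonneg hτ, abs_sub_comm]
      exact mul_le_mul_of_nonneg_left a2 hτ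
    have a4 : 0 ≤ 6 * C * R * (L + K) * τ ^ 2 * (k + 1) := by positivity
    rw [← add_assoc]
    push_cast
    rw [abs_le] at *
    constructor <;> nlinarith [ih.1, ih.2, a1.1, a1.2, a3.1, a3.2, a4]

theorem floor_diff {s t : ℝ} (hτ : 0 < τ) (hs : 0 ≤ s) (hst : s ≤ t) :
    ∃ k : ℕ, ⌊t / τ⌋₊ = ⌊s / τ⌋₊ + k ∧ |k * τ - (t - s)| ≤ τ := by
  obtain ⟨k, hk⟩ := Nat.exists_eq_add_of_le (Nat.floor_mono (div_le_div_of_nonneg_right hst hτ.le))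
  refine ⟨k, hk, ?_⟩
  have a1 := Nat.floor_le (div_nonneg hs hτ.le)
  have a2 := Nat.lt_floor_add_one (s / τ)
  have b1 := Nat.floor_le (div_nonneg (hs.trans hst) hτ.le)
  have b2 := Nat.lt_floor_add_one (t / τ)
  rw [hk] at b1 b2
  push_cast at b1 b2
  rw [le_div_iff₀ hτ] at a1 b1
  rw [div_lt_iff₀ hτ] at a2 b2
  rw [abs_le]; constructor <;> nlinarith

/-- A consistent sequence of measures is an approximate solution. -/
theorem isApprox_of_steps (hV : V.Regular C) (hτ : 0 < τ) (hτ1 : τ ≤ 1) (hR : 0 ≤ R) (hR' : 0 ≤ R')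
    (h1 : ∀ n, WClose (ν n : Measure (Dom k₁ k₂)) (ν (n + 1)) (R * τ))
    (h2 : ∀ n φ G L K, IsC11 φ G L K →
      |∫ x, φ x ∂(ν (n + 1) : Measure (Dom k₁ k₂)) - ∫ x, φ x ∂(ν n : Measure (Dom k₁ k₂)) -
        τ * ∫ x, inner ℝ (V (ν n) x) (G x) ∂(ν n : Measure (Dom k₁ k₂))| ≤ R' * τ ^ 2 * (L + K)) :
    IsApprox V (R + C + 4 * R' + 24 * C * R) τ (fun t => ν ⌊t / τ⌋₊) where
  close s t hs hst := by
    obtain ⟨k, hk, hkt⟩ := floor_diff hτ hs hst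
    simp only [hk]
    refine (wClose_of_steps h1 _ k).mono ?_
    have hC := hV.nonneg
    have := (abs_le.1 hkt).2
    have h3 : k * τ ≤ t - s + τ := by linarith
    have h4 : 0 ≤ t - s + τ := by linarith
    refine mul_le_mul ?_ h3 (by positivity) (by positivity)
    have : 0 ≤ C + 4 * R' + 24 * C * R := by positivity
    linarith
  step s t hs hst hts φ G L K hφ := by
    obtain ⟨k, hk, hkt⟩ := floor_diff hτ hs hst
    simp only [hk]
    have a1 := abs_multistep_le hV hτ.le hR h1 h2 ⌊s / τ⌋₊ k hφ
    have hC := hV.nonneg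
    have hL := hφ.nonneg_lip
    have hK := hφ.nonneg_taylor
    set N := ν ⌊s / τ⌋₊
    have a2 : |∫ x, inner ℝ (V N x) (G x) ∂(N : Measure (Dom k₁ k₂))| ≤ C * L := by
      have := norm_integral_le_of_norm_le_const (μ := (N : Measure (Dom k₁ k₂)))
        (f := fun x => inner ℝ (V N x) (G x)) (C := C * L)
        (Filter.Eventually.of_forall (hV.abs_inner_le hφ N))
      simpa using this
    set F := ∫ x, inner ℝ (V N x) (G x) ∂(N : Measure (Dom k₁ k₂))
    have a3 : |(k * τ - (t - s)) * F| ≤ τ * (C * (L + K)) := by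
      rw [abs_mul]
      exact mul_le_mul hkt (a2.trans (by gcongr; linarith)) (abs_nonneg _) hτ.le
    have hkτ : k * τ ≤ t - s + τ := by linarith [(abs_le.1 hkt).2]
    have hkτ0 : 0 ≤ k * τ := by positivity
    -- Rounding to time levels changes the elapsed time by at most `τ`, and `t - s` and `τ` are at
    -- most 1. All excess terms are thus `O(τ)`, and `τ` plays the part of the error `h`.
    have a4 : R' * τ * (k * τ) + 6 * C * R * (k * τ) ^ 2 ≤
        (4 * R' + 24 * C * R) * ((t - s) ^ 2 + τ) := by
      have b1 : τ * (k * τ) ≤ 2 * τ := by nlinarith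
      have b2 : (k * τ) ^ 2 ≤ 4 * ((t - s) ^ 2 + τ) := by
        have : (k * τ) ^ 2 ≤ (t - s + τ) ^ 2 := by gcongr
        nlinarith [sq_nonneg (t - s - τ)]
      have c1 : R' * (τ * (k * τ)) ≤ R' * (2 * τ) := by gcongr
      have c2 : 6 * C * R * (k * τ) ^ 2 ≤ 6 * C * R * (4 * ((t - s) ^ 2 + τ)) := by gcongr
      have c3 : 0 ≤ R' * (t - s) ^ 2 := by positivity
      have c4 : 0 ≤ R' * τ := by positivity
      nlinarith
    have a5 := mul_le_mul_of_nonneg_right a4 (add_nonneg hL hK)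
    have a6 : 0 ≤ (R + C) * (t - s) ^ 2 * (L + K) := by positivity
    have a7 : 0 ≤ R * τ * (L + K) := by positivity
    rw [abs_le] at *
    constructor <;> nlinarith [a1.1, a1.2, a3.1, a3.2, a5, a6, a7]

end Steps

/-! ### The Lax–Friedrichs scheme as a grid step -/

section Scheme
variable {k₁ k₂ : Axis} {m₁ : Mesh k₁} {m₂ : Mesh k₂}

/-- The larger of the two cell lengths. -/
def meshSize (m₁ : Mesh k₁) (m₂ : Mesh k₂) : ℝ := max m₁.step m₂.step

/-- The CFL condition and the mesh ratio condition. -/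
structure CFL (C₁ lam₀ κ : ℝ) (m₁ : Mesh k₁) (m₂ : Mesh k₂) (τ : ℝ) : Prop where
  pos : 0 < τ
  ratio : max m₁.step m₂.step ≤ κ * min m₁.step m₂.step
  lower : lam₀ ≤ τ / min m₁.step m₂.step * C₁
  upper : τ / min m₁.step m₂.step * C₁ ≤ 1 / 2

section
variable {C₁ lam₀ κ τ : ℝ}

theorem meshSize_pos (m₁ : Mesh k₁) (m₂ : Mesh k₂) : 0 < meshSize m₁ m₂ :=
  lt_max_of_lt_left m₁.step_pos

theorem CFL.meshSize_le_fst (h : CFL C₁ lam₀ κ m₁ m₂ τ) (hκ : 0 ≤ κ) :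
    meshSize m₁ m₂ ≤ κ * m₁.step := h.ratio.trans (by gcongr; exact min_le_left _ _)

theorem CFL.meshSize_le_snd (h : CFL C₁ lam₀ κ m₁ m₂ τ) (hκ : 0 ≤ κ) :
    meshSize m₁ m₂ ≤ κ * m₂.step := h.ratio.trans (by gcongr; exact min_le_right _ _)

theorem CFL.mul_le_min (h : CFL C₁ lam₀ κ m₁ m₂ τ) :
    τ * C₁ ≤ min m₁.step m₂.step / 2 := by
  have hm : 0 < min m₁.step m₂.step := lt_min m₁.step_pos m₂.step_pos
  have := h.upper
  rw [div_mul_eq_mul_div, div_le_iff₀ hm] at this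
  linarith

/-- This is the purpose of the lower CFL bound: the numerical diffusion, quadratic in the mesh size
in each step, becomes `O(τ²)`. -/
theorem CFL.meshSize_le_mul (h : CFL C₁ lam₀ κ m₁ m₂ τ) (hlam : 0 < lam₀) (hκ : 0 ≤ κ) :
    meshSize m₁ m₂ ≤ κ * C₁ / lam₀ * τ := by
  have hm : 0 < min m₁.step m₂.step := lt_min m₁.step_pos m₂.step_pos
  have h1 := h.lower
  rw [div_mul_eq_mul_div, le_div_iff₀ hm] at h1
  refine h.ratio.trans ?_
  rw [div_mul_eq_mul_div, le_div_iff₀ hlam]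
  nlinarith

end

/-- The translation of the index set by one cell in the first direction. -/
def shift₁ (m₁ : Mesh k₁) (m₂ : Mesh k₂) : m₁.Index × m₂.Index := (1, 0)

/-- The translation of the index set by one cell in the second direction. -/
def shift₂ (m₁ : Mesh k₁) (m₂ : Mesh k₂) : m₁.Index × m₂.Index := (0, 1)

/-- The displacement that belongs to `shift₁`. -/
def disp₁ (m₁ : Mesh k₁) : Plane := !₂[m₁.step, 0]

/-- The displacement that belongs to `shift₂`. -/
def disp₂ (m₂ : Mesh k₂) : Plane := !₂[0, m₂.step]

theorem norm_disp₁ (m₁ : Mesh k₁) : ‖disp₁ m₁‖ = m₁.step := by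
  rw [disp₁, norm_plane_fst, abs_of_pos m₁.step_pos]

theorem norm_disp₂ (m₂ : Mesh k₂) : ‖disp₂ m₂‖ = m₂.step := by
  rw [disp₂, norm_plane_snd, abs_of_pos m₂.step_pos]

theorem gridPoint_add_shift₁ (p : m₁.Index × m₂.Index) :
    gridPoint m₁ m₂ (p + shift₁ m₁ m₂) = gridPoint m₁ m₂ p + pr (disp₁ m₁) := by
  ext
  · simp [gridPoint, shift₁, pr, disp₁, m₁.point_add_one]
  · simp [gridPoint, shift₁, pr, disp₁, Axis.proj_zero]

theorem gridPoint_add_shift₂ (p : m₁.Index × m₂.Index) :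
    gridPoint m₁ m₂ (p + shift₂ m₁ m₂) = gridPoint m₁ m₂ p + pr (disp₂ m₂) := by
  ext
  · simp [gridPoint, shift₂, pr, disp₂, Axis.proj_zero]
  · simp [gridPoint, shift₂, pr, disp₂, m₂.point_add_one]

theorem gridPoint_sub {e : m₁.Index × m₂.Index} {v : Plane}
    (he : ∀ p, gridPoint m₁ m₂ (p + e) = gridPoint m₁ m₂ p + pr v) (p : m₁.Index × m₂.Index) :
    gridPoint m₁ m₂ (p - e) = gridPoint m₁ m₂ p + pr (-v) := by
  have := he (p - e)
  rw [sub_add_cancel] at this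
  rw [this, add_assoc, ← pr_add, add_neg_cancel, pr_zero, add_zero]

/-- A grid density as a probability measure. -/
def IsGridDensity.toMeasure {a : GridFun m₁ m₂} (h : IsGridDensity a) (r : Realization) :
    ProbabilityMeasure (Dom k₁ k₂) := ⟨r.measure a, h.isProbabilityMeasure r⟩

/-- Half of the Courant number at a grid point, in the direction `i` and for cell length `s`. -/
def courant (m₁ : Mesh k₁) (m₂ : Mesh k₂) (V : Velocity k₁ k₂)
    (ν : ProbabilityMeasure (Dom k₁ k₂)) (τ s : ℝ) (i : Fin 2) (p : m₁.Index × m₂.Index) : ℝ :=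
  τ / (2 * s) * V ν (gridPoint m₁ m₂ p) i

variable {V : Velocity k₁ k₂} {C C₁ lam₀ κ τ : ℝ}

/-- For a probability density, `V.eval` is the actual velocity and not its default value 0. -/
theorem lfStep_eq {a : GridFun m₁ m₂} (h : IsGridDensity a) (r : Realization)
    (p : m₁.Index × m₂.Index) : lfStep V r τ a p.1 p.2 =
      gridStep (shift₁ m₁ m₂) (shift₂ m₁ m₂) (courant m₁ m₂ V (h.toMeasure r) τ m₁.step 0)
        (courant m₁ m₂ V (h.toMeasure r) τ m₂.step 1) (fun p => a p.1 p.2) p := by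
  have e : ∀ x, V.eval (r.measure a) x = V (h.toMeasure r) x := fun x =>
    by rw [Velocity.eval, dif_pos (h.isProbabilityMeasure r)]; rfl
  simp only [lfStep, e, gridStep, courant, shift₁, shift₂, gridPoint, Prod.fst_add, Prod.snd_add,
    Prod.fst_sub, Prod.snd_sub, add_zero, sub_zero]
  have := m₁.step_pos
  have := m₂.step_pos
  field_simp
  ring

theorem abs_courant_le (h : V.BoundedBy C₁) (hτ : 0 ≤ τ) {s : ℝ} (hs : 0 < s) (hcfl : τ * C₁ ≤ s / 2)
    (ν : ProbabilityMeasure (Dom k₁ k₂)) (i : Fin 2) (p : m₁.Index × m₂.Index) :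
    |courant m₁ m₂ V ν τ s i p| ≤ 1 / 4 := by
  have h1 := (abs_coord_le (V ν (gridPoint m₁ m₂ p)) i).trans (h ν _)
  rw [courant, abs_mul, abs_of_nonneg (by positivity), div_mul_eq_mul_div,
    div_le_iff₀ (by positivity)]
  nlinarith

theorem CFL.abs_courant_le₁ (hc : CFL C₁ lam₀ κ m₁ m₂ τ) (h : V.BoundedBy C₁)
    (ν : ProbabilityMeasure (Dom k₁ k₂)) (i : Fin 2) (p : m₁.Index × m₂.Index) :
    |courant m₁ m₂ V ν τ m₁.step i p| ≤ 1 / 4 :=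
  abs_courant_le h hc.pos.le m₁.step_pos
    (hc.mul_le_min.trans (by linarith [min_le_left m₁.step m₂.step])) _ _ _

theorem CFL.abs_courant_le₂ (hc : CFL C₁ lam₀ κ m₁ m₂ τ) (h : V.BoundedBy C₁)
    (ν : ProbabilityMeasure (Dom k₁ k₂)) (i : Fin 2) (p : m₁.Index × m₂.Index) :
    |courant m₁ m₂ V ν τ m₂.step i p| ≤ 1 / 4 :=
  abs_courant_le h hc.pos.le m₂.step_pos
    (hc.mul_le_min.trans (by linarith [min_le_right m₁.step m₂.step])) _ _ _

theorem IsGridDensity.hasSum_self {a : GridFun m₁ m₂} (h : IsGridDensity a) :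
    HasSum (fun p : m₁.Index × m₂.Index => a p.1 p.2) (1 / (m₁.step * m₂.step)) := by
  have := h.hasSum.div_const (m₁.step * m₂.step)
  simpa only [mul_div_cancel_right₀ _ (step_mul_pos m₁ m₂).ne'] using this

/-- The scheme preserves positivity and mass. -/
theorem IsGridDensity.of_lfStep {a : GridFun m₁ m₂} (h : IsGridDensity a)
    (hc : CFL C₁ lam₀ κ m₁ m₂ τ) (hV : V.BoundedBy C₁) (r : Realization) :
    IsGridDensity (lfStep V r τ a) where
  nonneg i j := by
    rw [lfStep_eq h r (i, j)]
    exact gridStep_nonneg (hc.abs_courant_le₁ hV _ _) (hc.abs_courant_le₂ hV _ _)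
      (fun p => h.nonneg _ _) _
  hasSum := by
    have hS := step_mul_pos m₁ m₂
    have := (hasSum_gridStep (e₁ := shift₁ m₁ m₂) (e₂ := shift₂ m₁ m₂)
      (hc.abs_courant_le₁ hV (h.toMeasure r) 0) (hc.abs_courant_le₂ hV (h.toMeasure r) 1)
      h.hasSum_self).mul_right (m₁.step * m₂.step)
    rw [one_div_mul_cancel hS.ne'] at this
    simpa only [lfStep_eq h r] using this

/-! ### Bounds of the variation -/

/-- The displacement and the cell length `s` in the Courant number may belong to different
directions; the mesh ratio bounds their quotient by `κ`. -/
theorem abs_courant_sub_le (hV : V.Regular C) (hτ : 0 ≤ τ) {s h : ℝ} (hs : 0 < s)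
    (hh : h ≤ κ * s) {e : m₁.Index × m₂.Index} {v : Plane}
    (he : ∀ p, gridPoint m₁ m₂ (p + e) = gridPoint m₁ m₂ p + pr v) (hv : ‖v‖ ≤ h)
    (ν : ProbabilityMeasure (Dom k₁ k₂)) (i : Fin 2) (p : m₁.Index × m₂.Index) :
    |courant m₁ m₂ V ν τ s i (p + e) - courant m₁ m₂ V ν τ s i p| ≤ C * κ * τ / 2 := by
  have hC := hV.nonneg
  rw [courant, courant, he, ← mul_sub, abs_mul, abs_of_nonneg (by positivity)]
  have h1 := (abs_coord_le (V ν (gridPoint m₁ m₂ p + pr v) - V ν (gridPoint m₁ m₂ p)) i).trans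
    (hV.lip ν _ v)
  rw [PiLp.sub_apply] at h1
  calc _ ≤ τ / (2 * s) * (C * (κ * s)) := by
        gcongr
        exact h1.trans (by gcongr; exact hv.trans hh)
    _ = _ := by field_simp

/-- All four values are expanded at `y`. The linear parts cancel, and the remainders contribute `4 +
1 + 4 + 1`. -/
theorem Velocity.Regular.norm_secondDiff_le (hV : V.Regular C) {h : ℝ} {v w : Plane} (hv : ‖v‖ ≤ h)
    (hw : ‖w‖ ≤ h) (ν : ProbabilityMeasure (Dom k₁ k₂)) (y : Dom k₁ k₂) :
    ‖V ν (y + pr v + pr w) - V ν (y + pr v) -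
      (V ν (y + pr (-v) + pr w) - V ν (y + pr (-v)))‖ ≤ 10 * C * h ^ 2 := by
  obtain ⟨D, -, hD⟩ := hV.taylor ν
  have hC := hV.nonneg
  have hh : 0 ≤ h := (norm_nonneg v).trans hv
  have key : ∀ u : Plane, ∀ c : ℝ, 0 ≤ c → ‖u‖ ≤ c * h →
      ‖V ν (y + pr u) - V ν y - D y u‖ ≤ C * c ^ 2 * h ^ 2 := fun u c hc hu =>
    (hD y u).trans (by
      rw [mul_assoc, ← mul_pow]
      gcongr)
  have a1 := key (v + w) 2 (by norm_num) ((norm_add_le _ _).trans (by linarith))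
  have a2 := key v 1 (by norm_num) (by linarith)
  have a3 := key (-v + w) 2 (by norm_num) ((norm_add_le _ _).trans (by rw [norm_neg]; linarith))
  have a4 := key (-v) 1 (by norm_num) (by rw [norm_neg]; linarith)
  rw [add_assoc, add_assoc, ← pr_add, ← pr_add]
  have e : V ν (y + pr (v + w)) - V ν (y + pr v) - (V ν (y + pr (-v + w)) - V ν (y + pr (-v))) =
      (V ν (y + pr (v + w)) - V ν y - D y (v + w)) - (V ν (y + pr v) - V ν y - D y v) -
      ((V ν (y + pr (-v + w)) - V ν y - D y (-v + w)) -
        (V ν (y + pr (-v)) - V ν y - D y (-v))) := by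
    simp only [map_add, map_neg]; abel
  rw [e]
  refine (norm_sub_le _ _).trans ((add_le_add (norm_sub_le _ _) (norm_sub_le _ _)).trans ?_)
  linarith

theorem abs_courant_secondDiff_le (hV : V.Regular C) (hτ : 0 ≤ τ) {s h : ℝ}
    (hs : 0 < s) (hh : h ≤ κ * s) {e f : m₁.Index × m₂.Index} {v w : Plane}
    (he : ∀ p, gridPoint m₁ m₂ (p + e) = gridPoint m₁ m₂ p + pr v) (hv : ‖v‖ ≤ h)
    (hf : ∀ p, gridPoint m₁ m₂ (p + f) = gridPoint m₁ m₂ p + pr w) (hw : ‖w‖ ≤ h)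
    (ν : ProbabilityMeasure (Dom k₁ k₂)) (i : Fin 2) (p : m₁.Index × m₂.Index) :
    |courant m₁ m₂ V ν τ s i (p + f + e) - courant m₁ m₂ V ν τ s i (p + f) -
      (courant m₁ m₂ V ν τ s i (p - f + e) - courant m₁ m₂ V ν τ s i (p - f))| ≤
      5 * C * κ * τ * h := by
  have hC := hV.nonneg
  have hh0 : 0 ≤ h := (norm_nonneg v).trans hv
  simp only [courant, he, hf, gridPoint_sub hf]
  rw [← mul_sub, ← mul_sub, ← mul_sub, abs_mul, abs_of_nonneg (by positivity)]
  have h1 := (abs_coord_le _ i).trans (hV.norm_secondDiff_le hw hv ν (gridPoint m₁ m₂ p))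
  simp only [PiLp.sub_apply] at h1
  calc _ ≤ τ / (2 * s) * (10 * C * (h * (κ * s))) := by
        gcongr
        exact h1.trans (by rw [sq]; gcongr)
    _ = _ := by field_simp; ring

/-- The total variation of a grid function. -/
def gridTV (a : GridFun m₁ m₂) : ℝ :=
  gridVar (shift₁ m₁ m₂) (fun p => a p.1 p.2) + gridVar (shift₂ m₁ m₂) (fun p => a p.1 p.2)

/-- Each direction feeds the variation of the other one, so only their sum satisfies a closed
recursion. The source is the mass times the second differences of the velocity; multiplied by the
cell area it is `O(τ)` times the mesh size. -/
theorem gridTV_lfStep_le (hV : V.Regular C) (hV1 : V.BoundedBy C₁) (hκ : 0 ≤ κ)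
    (hc : CFL C₁ lam₀ κ m₁ m₂ τ) {a : GridFun m₁ m₂} (h : IsGridDensity a) (r : Realization) :
    gridTV (lfStep V r τ a) ≤ (1 + 2 * C * κ * τ) * gridTV a +
      20 * C * κ * τ * meshSize m₁ m₂ / (m₁.step * m₂.step) := by
  have hn₁ : ‖disp₁ m₁‖ ≤ meshSize m₁ m₂ := by rw [norm_disp₁]; exact le_max_left _ _
  have hn₂ : ‖disp₂ m₂‖ ≤ meshSize m₁ m₂ := by rw [norm_disp₂]; exact le_max_right _ _
  have hm₁ := hc.meshSize_le_fst hκ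
  have hm₂ := hc.meshSize_le_snd hκ
  have hτ := hc.pos.le
  have hsum := h.hasSum_self
  have habs : ∑' p : m₁.Index × m₂.Index, |a p.1 p.2| = 1 / (m₁.step * m₂.step) := by
    simp only [abs_of_nonneg (h.nonneg _ _)]
    exact hsum.tsum_eq
  have key : ∀ (e : m₁.Index × m₂.Index) (v : Plane),
      (∀ p, gridPoint m₁ m₂ (p + e) = gridPoint m₁ m₂ p + pr v) → ‖v‖ ≤ meshSize m₁ m₂ →
      gridVar e (fun p => lfStep V r τ a p.1 p.2) ≤ gridVar e (fun p => a p.1 p.2) +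
        2 * (C * κ * τ / 2) * gridTV a +
        2 * (5 * C * κ * τ * meshSize m₁ m₂) * (1 / (m₁.step * m₂.step)) := by
    intro e v he hv
    rw [← habs]
    simp only [lfStep_eq h r]
    exact gridVar_gridStep_le (hc.abs_courant_le₁ hV1 _ _) (hc.abs_courant_le₂ hV1 _ _)
      hsum.summable e (abs_courant_sub_le hV hτ m₁.step_pos hm₁ he hv _ _)
      (abs_courant_sub_le hV hτ m₂.step_pos hm₂ he hv _ _)
      (abs_courant_secondDiff_le hV hτ m₁.step_pos hm₁ he hv gridPoint_add_shift₁ hn₁ _ _)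
      (abs_courant_secondDiff_le hV hτ m₂.step_pos hm₂ he hv gridPoint_add_shift₂ hn₂ _ _)
  have k1 := key _ _ gridPoint_add_shift₁ hn₁
  have k2 := key _ _ gridPoint_add_shift₂ hn₂
  refine (add_le_add k1 k2).trans (le_of_eq ?_)
  simp only [gridTV]
  ring

end Scheme

section

section Consistency
variable {k₁ k₂ : Axis} {m₁ : Mesh k₁} {m₂ : Mesh k₂} {V : Velocity k₁ k₂} {C C₁ lam₀ κ τ : ℝ}

/-! ### Consistency of the scheme -/

/-- Integration against the point masses of a Lax–Friedrichs step. -/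
theorem IsGridDensity.hasSum_lfStep {a : GridFun m₁ m₂} (h : IsGridDensity a)
    (hc : CFL C₁ lam₀ κ m₁ m₂ τ) (hV : V.BoundedBy C₁) (r : Realization)
    {ψ : Dom k₁ k₂ → ℝ} (hb : ∃ B, ∀ x, |ψ x| ≤ B) (hm : Measurable ψ) :
    HasSum (fun p : m₁.Index × m₂.Index => a p.1 p.2 * (m₁.step * m₂.step) *
      ((1 / 4 - courant m₁ m₂ V (h.toMeasure r) τ m₁.step 0 p) *
          ψ (gridPoint m₁ m₂ p + pr (-disp₁ m₁)) +
        (1 / 4 + courant m₁ m₂ V (h.toMeasure r) τ m₁.step 0 p) *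
          ψ (gridPoint m₁ m₂ p + pr (disp₁ m₁)) +
        ((1 / 4 - courant m₁ m₂ V (h.toMeasure r) τ m₂.step 1 p) *
          ψ (gridPoint m₁ m₂ p + pr (-disp₂ m₂)) +
        (1 / 4 + courant m₁ m₂ V (h.toMeasure r) τ m₂.step 1 p) *
          ψ (gridPoint m₁ m₂ p + pr (disp₂ m₂)))))
      (∫ x, ψ x ∂(Realization.pointMasses.measure (lfStep V r τ a))) := by
  obtain ⟨B, hB⟩ := hb
  have hS := step_mul_pos m₁ m₂
  have h1 := (h.of_lfStep hc hV r).hasSum_pointMasses ⟨B, hB⟩ hm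
  have hu := hc.abs_courant_le₁ hV (h.toMeasure r) 0
  have hw := hc.abs_courant_le₂ hV (h.toMeasure r) 1
  have h2 := (hasSum_gridStep_mul (e₁ := shift₁ m₁ m₂) (e₂ := shift₂ m₁ m₂) hu hw
    h.hasSum_self.summable (g := fun p => ψ (gridPoint m₁ m₂ p)) (fun p => hB _)).mul_right
    (m₁.step * m₂.step)
  have h3 := h1.unique (h2.congr_fun fun p => by rw [lfStep_eq h r]; ring)
  rw [h3]
  simp only [gridPoint_add_shift₁, gridPoint_add_shift₂, gridPoint_sub gridPoint_add_shift₁,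
    gridPoint_sub gridPoint_add_shift₂]
  rw [← tsum_mul_right]
  refine HasSum.congr_fun (Summable.hasSum ?_) fun p => by ring
  refine ((summable_mul_of_abs_le h.hasSum_self.summable (B := 2 * B)
    (g := fun p => (1 / 4 - courant m₁ m₂ V (h.toMeasure r) τ m₁.step 0 p) *
          ψ (gridPoint m₁ m₂ p + pr (-disp₁ m₁)) +
        (1 / 4 + courant m₁ m₂ V (h.toMeasure r) τ m₁.step 0 p) *
          ψ (gridPoint m₁ m₂ p + pr (disp₁ m₁)) +
        ((1 / 4 - courant m₁ m₂ V (h.toMeasure r) τ m₂.step 1 p) *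
          ψ (gridPoint m₁ m₂ p + pr (-disp₂ m₂)) +
        (1 / 4 + courant m₁ m₂ V (h.toMeasure r) τ m₂.step 1 p) *
          ψ (gridPoint m₁ m₂ p + pr (disp₂ m₂)))) fun p => ?_).mul_right _)
  have key : ∀ c y : ℝ, |c| ≤ 1 / 4 → |y| ≤ B → |(1 / 4 + c) * y| ≤ 1 / 2 * B := fun c y hc hy => by
    rw [abs_mul]
    refine mul_le_mul ?_ hy (abs_nonneg _) (by norm_num)
    have := abs_le.1 hc
    rw [abs_le]; constructor <;> linarith
  have key' : ∀ c y : ℝ, |c| ≤ 1 / 4 → |y| ≤ B → |(1 / 4 - c) * y| ≤ 1 / 2 * B := fun c y hc hy =>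
    key (-c) y (by rwa [abs_neg]) hy
  refine (abs_add_le _ _).trans ((add_le_add
    ((abs_add_le _ _).trans (add_le_add (key' _ _ (hu p) (hB _)) (key _ _ (hu p) (hB _))))
    ((abs_add_le _ _).trans (add_le_add (key' _ _ (hw p) (hB _)) (key _ _ (hw p) (hB _))))).trans
    (le_of_eq (by ring)))

theorem abs_le_of_hasSum_mass {a : GridFun m₁ m₂} (h : IsGridDensity a) {b : m₁.Index × m₂.Index → ℝ}
    {ε s : ℝ} (hs : HasSum (fun p : m₁.Index × m₂.Index => a p.1 p.2 * (m₁.step * m₂.step) * b p) s)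
    (hb : ∀ p, |b p| ≤ ε) : |s| ≤ ε := by
  have h1 := h.hasSum.mul_right ε
  rw [one_mul] at h1
  have h0 : ∀ p : m₁.Index × m₂.Index, 0 ≤ a p.1 p.2 * (m₁.step * m₂.step) := fun p =>
    mul_nonneg (h.nonneg _ _) (step_mul_pos m₁ m₂).le
  rw [abs_le]
  constructor
  · refine hasSum_le (fun p => ?_) h1.neg hs
    nlinarith [(abs_le.1 (hb p)).1, h0 p]
  · exact hasSum_le (fun p => mul_le_mul_of_nonneg_left (abs_le.1 (hb p)).2 (h0 p)) hs h1

/-- A convex combination of four values, with weights `1 / 4 ± u` and `1 / 4 ± w`. -/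
theorem abs_stencil_le {u w y₁ y₂ y₃ y₄ ε : ℝ} (hu : |u| ≤ 1 / 4) (hw : |w| ≤ 1 / 4)
    (h1 : |y₁| ≤ ε) (h2 : |y₂| ≤ ε) (h3 : |y₃| ≤ ε) (h4 : |y₄| ≤ ε) :
    |(1 / 4 - u) * y₁ + (1 / 4 + u) * y₂ + ((1 / 4 - w) * y₃ + (1 / 4 + w) * y₄)| ≤ ε := by
  rw [abs_le] at *
  constructor <;> nlinarith

/-- The new measure is an average of displacements by one cell, so no mass travels farther than the
larger cell length. -/
theorem IsGridDensity.wClose_lfStep {a : GridFun m₁ m₂} (h : IsGridDensity a)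
    (hc : CFL C₁ lam₀ κ m₁ m₂ τ) (hV : V.BoundedBy C₁) (r : Realization) :
    WClose (Realization.pointMasses.measure a) (Realization.pointMasses.measure (lfStep V r τ a))
      (meshSize m₁ m₂) := by
  refine WClose.symm fun ψ hb hl => ?_
  have hm := hl.continuous.measurable
  have hs := (h.hasSum_lfStep hc hV r hb hm).sub (h.hasSum_pointMasses hb hm)
  have hn₁ : ‖disp₁ m₁‖ ≤ meshSize m₁ m₂ := by rw [norm_disp₁]; exact le_max_left _ _
  have hn₂ : ‖disp₂ m₂‖ ≤ meshSize m₁ m₂ := by rw [norm_disp₂]; exact le_max_right _ _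
  have hl' : ∀ x v, ‖v‖ ≤ meshSize m₁ m₂ → |ψ (x + pr v) - ψ x| ≤ meshSize m₁ m₂ := fun x v hv =>
    (hl x v).trans (by rwa [one_mul])
  refine abs_le_of_hasSum_mass h (hs.congr_fun (g := fun p => a p.1 p.2 * (m₁.step * m₂.step) *
    ((1 / 4 - courant m₁ m₂ V (h.toMeasure r) τ m₁.step 0 p) *
          (ψ (gridPoint m₁ m₂ p + pr (-disp₁ m₁)) - ψ (gridPoint m₁ m₂ p)) +
        (1 / 4 + courant m₁ m₂ V (h.toMeasure r) τ m₁.step 0 p) *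
          (ψ (gridPoint m₁ m₂ p + pr (disp₁ m₁)) - ψ (gridPoint m₁ m₂ p)) +
        ((1 / 4 - courant m₁ m₂ V (h.toMeasure r) τ m₂.step 1 p) *
          (ψ (gridPoint m₁ m₂ p + pr (-disp₂ m₂)) - ψ (gridPoint m₁ m₂ p)) +
        (1 / 4 + courant m₁ m₂ V (h.toMeasure r) τ m₂.step 1 p) *
          (ψ (gridPoint m₁ m₂ p + pr (disp₂ m₂)) - ψ (gridPoint m₁ m₂ p))))) fun p => by ring)
    fun p => ?_
  exact abs_stencil_le (hc.abs_courant_le₁ hV _ _ _) (hc.abs_courant_le₂ hV _ _ _)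
    (hl' _ _ (by rwa [norm_neg])) (hl' _ _ hn₁) (hl' _ _ (by rwa [norm_neg])) (hl' _ _ hn₂)

/-- The stencil weights have mean displacement `τ V`, so the linear terms reproduce the flux and the
Taylor remainders of `φ` cost `K` times the squared mesh size. The flux is stated for the point
masses whatever `r` is; passing from the velocity of `r` to theirs costs `C` times their distance,
at most two mesh sizes. -/
theorem IsGridDensity.abs_lfStep_sub_le {a : GridFun m₁ m₂} (h : IsGridDensity a)
    (hR : V.Regular C) (hc : CFL C₁ lam₀ κ m₁ m₂ τ) (hV : V.BoundedBy C₁) (r : Realization)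
    {φ : Dom k₁ k₂ → ℝ} {G : Dom k₁ k₂ → Plane} {L K : ℝ} (hφ : IsC11 φ G L K) :
    |∫ x, φ x ∂(Realization.pointMasses.measure (lfStep V r τ a)) -
      ∫ x, φ x ∂(Realization.pointMasses.measure a) -
      τ * ∫ x, inner ℝ (V (h.toMeasure .pointMasses) x) (G x)
        ∂(Realization.pointMasses.measure a)| ≤
      K * meshSize m₁ m₂ ^ 2 + τ * (C * (2 * meshSize m₁ m₂) * L) := by
  have hm := hφ.continuous.measurable
  have hs := ((h.hasSum_lfStep hc hV r hφ.bdd hm).sub (h.hasSum_pointMasses hφ.bdd hm)).sub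
    ((h.hasSum_pointMasses ⟨_, hR.abs_inner_le hφ (h.toMeasure .pointMasses)⟩
      (hR.lip_inner hφ _).continuous.measurable).mul_left τ)
  have hL := hφ.nonneg_lip
  have hK := hφ.nonneg_taylor
  have hτ := hc.pos
  have hs₁ := m₁.step_pos
  have hs₂ := m₂.step_pos
  have hC := hR.nonneg
  have hn₁ : ‖disp₁ m₁‖ ≤ meshSize m₁ m₂ := by rw [norm_disp₁]; exact le_max_left _ _
  have hn₂ : ‖disp₂ m₂‖ ≤ meshSize m₁ m₂ := by rw [norm_disp₂]; exact le_max_right _ _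
  have hl' : ∀ x v, ‖v‖ ≤ meshSize m₁ m₂ →
      |φ (x + pr v) - φ x - inner ℝ (G x) v| ≤ K * meshSize m₁ m₂ ^ 2 := fun x v hv =>
    (hφ.taylor x v).trans (by gcongr)
  have hi : ∀ g v : Plane, inner ℝ g v = g 0 * v 0 + g 1 * v 1 := fun g v => inner_plane g v
  refine abs_le_of_hasSum_mass h (hs.congr_fun (g := fun p => a p.1 p.2 * (m₁.step * m₂.step) *
    ((1 / 4 - courant m₁ m₂ V (h.toMeasure r) τ m₁.step 0 p) *
          (φ (gridPoint m₁ m₂ p + pr (-disp₁ m₁)) - φ (gridPoint m₁ m₂ p) -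
            inner ℝ (G (gridPoint m₁ m₂ p)) (-disp₁ m₁)) +
        (1 / 4 + courant m₁ m₂ V (h.toMeasure r) τ m₁.step 0 p) *
          (φ (gridPoint m₁ m₂ p + pr (disp₁ m₁)) - φ (gridPoint m₁ m₂ p) -
            inner ℝ (G (gridPoint m₁ m₂ p)) (disp₁ m₁)) +
        ((1 / 4 - courant m₁ m₂ V (h.toMeasure r) τ m₂.step 1 p) *
          (φ (gridPoint m₁ m₂ p + pr (-disp₂ m₂)) - φ (gridPoint m₁ m₂ p) -
            inner ℝ (G (gridPoint m₁ m₂ p)) (-disp₂ m₂)) +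
        (1 / 4 + courant m₁ m₂ V (h.toMeasure r) τ m₂.step 1 p) *
          (φ (gridPoint m₁ m₂ p + pr (disp₂ m₂)) - φ (gridPoint m₁ m₂ p) -
            inner ℝ (G (gridPoint m₁ m₂ p)) (disp₂ m₂))) +
      τ * inner ℝ (V (h.toMeasure r) (gridPoint m₁ m₂ p) -
        V (h.toMeasure .pointMasses) (gridPoint m₁ m₂ p)) (G (gridPoint m₁ m₂ p)))) fun p => ?_)
    fun p => ?_
  · simp only [hi, courant, disp₁, disp₂, PiLp.sub_apply, PiLp.neg_apply]
    simp
    field_simp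
    ring
  · refine (abs_add_le _ _).trans (add_le_add ?_ ?_)
    · exact abs_stencil_le (hc.abs_courant_le₁ hV _ _ _) (hc.abs_courant_le₂ hV _ _ _)
        (hl' _ _ (by rwa [norm_neg])) (hl' _ _ hn₁) (hl' _ _ (by rwa [norm_neg])) (hl' _ _ hn₂)
    · rw [abs_mul, abs_of_pos hτ]
      refine mul_le_mul_of_nonneg_left ((abs_real_inner_le_norm _ _).trans ?_) hτ.le
      refine mul_le_mul ((hR.meas (h.toMeasure r) (h.toMeasure .pointMasses) _ (h.wClose_realization r) _).trans ?_) (hφ.norm_le _)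
        (norm_nonneg _) (by have := (meshSize_pos m₁ m₂).le; positivity)
      refine mul_le_mul_of_nonneg_left ?_ hC
      linarith [le_max_left m₁.step m₂.step, le_max_right m₁.step m₂.step,
        show meshSize m₁ m₂ = max m₁.step m₂.step from rfl]

/-! ### The numerical solution -/

section
variable {μ₀ : ProbabilityMeasure (Dom k₁ k₂)}

theorem isGridDensity_laxFriedrichs (hac : (μ₀ : Measure (Dom k₁ k₂)) ≪ volume)
    (hc : CFL C₁ lam₀ κ m₁ m₂ τ) (hV : V.BoundedBy C₁) (r : Realization) (n : ℕ) :
    IsGridDensity (laxFriedrichs V r m₁ m₂ τ μ₀ n) := by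
  induction n with
  | zero => exact isGridDensity_cellAverages hac
  | succ n ih => exact ih.of_lfStep hc hV r

/-- The constant of the approximate solutions that the scheme produces. -/
def approxConst (C C₁ lam₀ κ : ℝ) : ℝ :=
  κ * C₁ / lam₀ + C + 4 * ((κ * C₁ / lam₀) ^ 2 + 2 * C * (κ * C₁ / lam₀)) +
    24 * C * (κ * C₁ / lam₀)

theorem wClose_laxFriedrichs_succ (hac : (μ₀ : Measure (Dom k₁ k₂)) ≪ volume)
    (hV : V.BoundedBy C₁) (hlam : 0 < lam₀) (hκ : 0 ≤ κ) (hc : CFL C₁ lam₀ κ m₁ m₂ τ)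
    (r : Realization) (n : ℕ) :
    WClose (Realization.pointMasses.measure (laxFriedrichs V r m₁ m₂ τ μ₀ n))
      (Realization.pointMasses.measure (laxFriedrichs V r m₁ m₂ τ μ₀ (n + 1)))
      (κ * C₁ / lam₀ * τ) :=
  ((isGridDensity_laxFriedrichs hac hc hV r n).wClose_lfStep hc hV r).mono
    (hc.meshSize_le_mul hlam hκ)

/-- With the mesh size at most `R τ`, one step is consistent up to `O(τ²)`. The offset `k` serves
the interpolation in time, which combines two consecutive levels. -/
theorem isApprox_laxFriedrichs (hac : (μ₀ : Measure (Dom k₁ k₂)) ≪ volume) (hR : V.Regular C)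
    (hV : V.BoundedBy C₁) (hC₁ : 0 ≤ C₁) (hlam : 0 < lam₀) (hκ : 0 ≤ κ)
    (hc : CFL C₁ lam₀ κ m₁ m₂ τ) (hτ : τ ≤ 1) (r : Realization) (k : ℕ) :
    IsApprox V (approxConst C C₁ lam₀ κ) τ (fun t =>
      (isGridDensity_laxFriedrichs hac hc hV r (k + ⌊t / τ⌋₊)).toMeasure .pointMasses) := by
  have hh := hc.meshSize_le_mul hlam hκ
  have hh0 := (meshSize_pos m₁ m₂).le
  have hC := hR.nonneg
  have hτ0 := hc.pos.le
  set R := κ * C₁ / lam₀ with hRdef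
  have hR0 : 0 ≤ R := by positivity
  refine isApprox_of_steps
    (ν := fun n => (isGridDensity_laxFriedrichs hac hc hV r (k + n)).toMeasure .pointMasses)
    hR hc.pos hτ hR0 (R' := R ^ 2 + 2 * C * R) (by positivity)
    (fun n => wClose_laxFriedrichs_succ hac hV hlam hκ hc r (k + n)) ?_
  intro n φ G L K hφ
  have hL := hφ.nonneg_lip
  have hK := hφ.nonneg_taylor
  refine ((isGridDensity_laxFriedrichs hac hc hV r (k + n)).abs_lfStep_sub_le hR hc hV r hφ).trans
    ?_
  calc _ ≤ K * (R * τ) ^ 2 + τ * (C * (2 * (R * τ)) * L) := by gcongr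
    _ ≤ K * (R * τ) ^ 2 + τ * (C * (2 * (R * τ)) * L) +
        (R ^ 2 * τ ^ 2 * L + 2 * C * R * τ ^ 2 * K) := le_add_of_nonneg_right (by positivity)
    _ = _ := by ring

/-- Adding `10 * meshSize m₁ m₂` absorbs the source, since `20 C κ τ = (2 C κ τ) · 10`. The affine
recursion becomes geometric with ratio `1 + 2 C κ τ`. -/
theorem gridTV_laxFriedrichs_le (hac : (μ₀ : Measure (Dom k₁ k₂)) ≪ volume) (hR : V.Regular C)
    (hV : V.BoundedBy C₁) (hκ : 0 ≤ κ) (hc : CFL C₁ lam₀ κ m₁ m₂ τ) (r : Realization) (n : ℕ) :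
    m₁.step * m₂.step * gridTV (laxFriedrichs V r m₁ m₂ τ μ₀ n) + 10 * meshSize m₁ m₂ ≤
      Real.exp (2 * C * κ * (n * τ)) *
        (m₁.step * m₂.step * gridTV (cellAverages m₁ m₂ μ₀) + 10 * meshSize m₁ m₂) := by
  have hS := step_mul_pos m₁ m₂
  have hC := hR.nonneg
  have hτ0 := hc.pos.le
  have hh0 := (meshSize_pos m₁ m₂).le
  induction n with
  | zero => simp [laxFriedrichs]
  | succ n ih =>
    have h1 := gridTV_lfStep_le hR hV hκ hc (isGridDensity_laxFriedrichs hac hc hV r n) r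
    set X := gridTV (laxFriedrichs V r m₁ m₂ τ μ₀ n)
    set Z := m₁.step * m₂.step * gridTV (cellAverages m₁ m₂ μ₀) + 10 * meshSize m₁ m₂
    have h2 : m₁.step * m₂.step * gridTV (laxFriedrichs V r m₁ m₂ τ μ₀ (n + 1)) ≤
        (1 + 2 * C * κ * τ) * (m₁.step * m₂.step * X) + 20 * C * κ * τ * meshSize m₁ m₂ := by
      calc _ ≤ m₁.step * m₂.step * ((1 + 2 * C * κ * τ) * X +
            20 * C * κ * τ * meshSize m₁ m₂ / (m₁.step * m₂.step)) :=
          mul_le_mul_of_nonneg_left h1 hS.le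
        _ = _ := by rw [mul_add, mul_div_cancel₀ _ hS.ne']; ring
    have h3 : 1 + 2 * C * κ * τ ≤ Real.exp (2 * C * κ * τ) := by
      linarith [Real.add_one_le_exp (2 * C * κ * τ)]
    have h4 : 0 ≤ Real.exp (2 * C * κ * (n * τ)) * Z := by
      have : 0 ≤ gridTV (cellAverages m₁ m₂ μ₀) :=
        add_nonneg (gridVar_nonneg _ _) (gridVar_nonneg _ _)
      positivity
    calc _ ≤ (1 + 2 * C * κ * τ) * (m₁.step * m₂.step * X + 10 * meshSize m₁ m₂) := by linarith
      _ ≤ (1 + 2 * C * κ * τ) * (Real.exp (2 * C * κ * (n * τ)) * Z) := by gcongr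
      _ ≤ Real.exp (2 * C * κ * τ) * (Real.exp (2 * C * κ * (n * τ)) * Z) := by gcongr
      _ = _ := by
        rw [← mul_assoc, ← Real.exp_add]
        push_cast
        ring_nf

end

end Consistency

end

/-! ### Translations of functions of bounded variation -/

section BV
variable {k₁ k₂ : Axis} {f : Dom k₁ k₂ → ℝ}

theorem IsTest.const_mul {φ : Dom k₁ k₂ → ℝ} (h : IsTest φ) (c : ℝ) :
    IsTest fun x => c * φ x :=
  ⟨contDiff_const.mul h.1, h.2.mul_left⟩

theorem IsTest.comp_add_pr {φ : Dom k₁ k₂ → ℝ} (h : IsTest φ) (w : Plane) :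
    IsTest fun x => φ (x + pr w) := by
  refine isTest_of_contDiff ?_ (h.2.comp_homeomorph (Homeomorph.addRight (pr w)))
  have := h.contDiff_plane.comp (contDiff_id.add (contDiff_const (c := w)))
  simpa only [Function.comp_def, pr_add, id] using this

theorem IsC11.comp_add_pr {φ : Dom k₁ k₂ → ℝ} {G : Dom k₁ k₂ → Plane} {L K : ℝ}
    (h : IsC11 φ G L K) (w : Plane) :
    IsC11 (fun x => φ (x + pr w)) (fun x => G (x + pr w)) L K where
  bdd := h.bdd.imp fun _ hB _ => hB _
  lip x v := by
    have := h.lip (x + pr w) v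
    rwa [add_right_comm] at this
  norm_le _ := h.norm_le _
  taylor x v := by
    have := h.taylor (x + pr w) v
    rwa [add_right_comm] at this

/-- The vector field `φ w / |w|` has length at most 1 and divergence `⟨w, ∇φ⟩ / |w|`, so it is
admissible in the total variation. -/
theorem integral_mul_inner_le_totalVariation (hTV : totalVariation f < ⊤) {φ : Dom k₁ k₂ → ℝ}
    {G : Dom k₁ k₂ → Plane} {L K : ℝ} (hφ : IsTest φ) (h : IsC11 φ G L K) (h1 : ∀ x, |φ x| ≤ 1)
    (w : Plane) : ∫ x, f x * inner ℝ w (G x) ≤ ‖w‖ * (totalVariation f).toReal := by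
  rcases eq_or_ne w 0 with rfl | hw
  · simp
  have hn : 0 < ‖w‖ := norm_pos_iff.2 hw
  have hb : ∀ x, (w 0 / ‖w‖ * φ x) ^ 2 + (w 1 / ‖w‖ * φ x) ^ 2 ≤ 1 := fun x => by
    have e : ‖w‖ ^ 2 = w 0 ^ 2 + w 1 ^ 2 := by
      rw [norm_plane, Real.sq_sqrt (by positivity)]
    have : (w 0 / ‖w‖ * φ x) ^ 2 + (w 1 / ‖w‖ * φ x) ^ 2 = φ x ^ 2 := by
      field_simp
      rw [e]
      ring
    rw [this, sq_le_one_iff_abs_le_one]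
    exact h1 x
  have h2 : ENNReal.ofReal (∫ x, f x * (pderiv₁ (fun x => w 0 / ‖w‖ * φ x) x +
      pderiv₂ (fun x => w 1 / ‖w‖ * φ x) x)) ≤ totalVariation f :=
    le_iSup_of_le _ (le_iSup_of_le _ (le_iSup_of_le (hφ.const_mul _) (le_iSup_of_le
      (hφ.const_mul _) (le_iSup_of_le hb le_rfl))))
  have h3 := (ENNReal.ofReal_le_iff_le_toReal hTV.ne).1 h2
  have e : ∫ x, f x * inner ℝ w (G x) = ‖w‖ * ∫ x, f x * (pderiv₁ (fun x => w 0 / ‖w‖ * φ x) x +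
      pderiv₂ (fun x => w 1 / ‖w‖ * φ x) x) := by
    rw [← integral_const_mul]
    refine integral_congr_ae (Filter.Eventually.of_forall fun x => ?_)
    simp only [(h.const_mul _).pderiv₁, (h.const_mul _).pderiv₂, PiLp.smul_apply, smul_eq_mul,
      inner_plane]
    field_simp
  rw [e]
  exact mul_le_mul_of_nonneg_left h3 hn.le

/-- The function `s ↦ ∫ f φ(· + s w)` has derivative `∫ f ⟨w, ∇φ(· + s w)⟩`, which the total
variation bounds. The mean value inequality is applied between 0 and -1, because a shift of `f` by
`w` is a shift of `φ` by `-w`. -/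
theorem integral_mul_shift_sub_le (hf : Integrable f) (hTV : totalVariation f < ⊤)
    {φ : Dom k₁ k₂ → ℝ} {G : Dom k₁ k₂ → Plane} {L K : ℝ} (hφ : IsTest φ) (h : IsC11 φ G L K)
    (h1 : ∀ x, |φ x| ≤ 1) (w : Plane) :
    |∫ x, (f (x + pr w) - f x) * φ x| ≤ (totalVariation f).toReal * ‖w‖ := by
  have hint : ∀ v, Integrable fun x => f x * φ (x + pr v) := fun v =>
    hf.mul_bdd (c := 1) (h.comp_add_pr v).continuous.aestronglyMeasurable
      (Filter.Eventually.of_forall fun x => h1 _)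
  have hintG : ∀ v, Integrable fun x => f x * inner ℝ w (G (x + pr v)) := fun v =>
    hf.mul_bdd (c := ‖w‖ * L)
      (continuous_const.inner (h.comp_add_pr v).continuous_gradient).aestronglyMeasurable
      (Filter.Eventually.of_forall fun x => (abs_real_inner_le_norm _ _).trans
        (mul_le_mul_of_nonneg_left (h.norm_le _) (norm_nonneg _)))
  set H : ℝ → ℝ := fun s => ∫ x, f x * φ (x + pr (s • w)) with hH
  have hd : ∀ s : ℝ, HasDerivAt H (∫ x, f x * inner ℝ w (G (x + pr (s • w)))) s := by
    intro s
    have := hasDerivAt_of_quadratic (f := fun r => H (s + r)) (K := ‖w‖ ^ 2 * K * ∫ x, |f x|)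
      (c := ∫ x, f x * inner ℝ w (G (x + pr (s • w)))) fun r => by
        simp only [hH, add_zero]
        have i1 : Integrable fun x => f x * φ (x + pr ((s + r) • w)) - f x * φ (x + pr (s • w)) :=
          (hint _).sub (hint _)
        rw [← integral_const_mul, ← integral_sub (hint _) (hint _),
          ← integral_sub i1 ((hintG _).const_mul r), ← integral_const_mul, ← integral_mul_const,
          ← Real.norm_eq_abs]
        refine norm_integral_le_of_norm_le ((hf.abs.const_mul _).mul_const _)
          (Filter.Eventually.of_forall fun x => ?_)
        have ht := h.taylor (x + pr (s • w)) (r • w)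
        rw [add_assoc, ← pr_add, ← add_smul, norm_smul, inner_smul_right, mul_pow,
          Real.norm_eq_abs, sq_abs, real_inner_comm] at ht
        have e : f x * φ (x + pr ((s + r) • w)) - f x * φ (x + pr (s • w)) -
            r * (f x * inner ℝ w (G (x + pr (s • w)))) =
            f x * (φ (x + pr ((s + r) • w)) - φ (x + pr (s • w)) -
              r * inner ℝ w (G (x + pr (s • w)))) := by ring
        rw [e, Real.norm_eq_abs, abs_mul]
        calc _ ≤ |f x| * (K * (r ^ 2 * ‖w‖ ^ 2)) := by gcongr
          _ = _ := by ring
    rw [← sub_self s] at this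
    simpa only [add_sub_cancel] using this.comp_sub_const s s
  have hle : ∀ s : ℝ, ‖∫ x, f x * inner ℝ w (G (x + pr (s • w)))‖ ≤
      (totalVariation f).toReal * ‖w‖ := by
    intro s
    have a1 := integral_mul_inner_le_totalVariation hTV (hφ.comp_add_pr (s • w))
      (h.comp_add_pr (s • w)) (fun x => h1 _) w
    have a2 := integral_mul_inner_le_totalVariation hTV (hφ.comp_add_pr (s • w))
      (h.comp_add_pr (s • w)) (fun x => h1 _) (-w)
    simp only [inner_neg_left, mul_neg, integral_neg, norm_neg] at a2
    rw [Real.norm_eq_abs, abs_le]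
    constructor <;> linarith
  have h3 := convex_univ.norm_image_sub_le_of_norm_hasDerivWithin_le (f := H) (x := 0) (y := -1)
    (fun s _ => (hd s).hasDerivWithinAt) (fun s _ => hle s) (Set.mem_univ _) (Set.mem_univ _)
  have e : ∫ x, (f (x + pr w) - f x) * φ x = H (-1) - H 0 := by
    have e1 : H (-1) = ∫ x, f (x + pr w) * φ x := by
      rw [← integral_add_right_eq_self (μ := volume) _ (-pr w : Dom k₁ k₂)]
      simp only [hH, neg_smul, one_smul, pr_neg, neg_add_cancel_right]
    have e2 : H 0 = ∫ x, f x * φ x := by simp [hH, pr_zero]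
    rw [e1, e2, ← integral_sub]
    · simp only [sub_mul]
    · have := (hint (-w)).comp_add_right (pr w)
      simpa [add_assoc, ← pr_add, pr_zero] using this
    · simpa [pr_zero] using hint 0
  rw [e]
  simpa using h3

theorem exists_eq_zero_of_hasCompactSupport {φ : Dom k₁ k₂ → ℝ} (h : HasCompactSupport φ) :
    ∃ R, ∀ x, R ≤ ‖x‖ → φ x = 0 := by
  obtain ⟨R, hR⟩ := h.isCompact.isBounded.exists_norm_le
  refine ⟨R + 1, fun x hx => image_eq_zero_of_notMem_tsupport fun hm => ?_⟩
  linarith [hR x hm]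

/-- Continuous functions with compact support are uniform limits of test functions. -/
theorem exists_isTest_abs_sub_le {ψ : Dom k₁ k₂ → ℝ} (hc : Continuous ψ) (hs : HasCompactSupport ψ)
    (h1 : ∀ x, |ψ x| ≤ 1) {c : ℝ} (hc0 : 0 < c) :
    ∃ φ G L K, IsTest φ ∧ IsC11 φ G L K ∧ (∀ x, |φ x| ≤ 1) ∧ ∀ x, |φ x - ψ x| ≤ 2 * c := by
  have huc := hc.uniformContinuous_of_tendsto_cocompact hs.is_zero_at_infty
  obtain ⟨δ, hδ, hδ'⟩ := Metric.uniformContinuous_iff.1 huc c hc0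
  obtain ⟨η, hη⟩ := exists_isKernel (half_pos hδ)
  obtain ⟨Λ, hΛ0, hΛ⟩ := hη.exists_lip
  have hb : ∃ B, ∀ x, |ψ x| ≤ B := ⟨1, h1⟩
  have hb1 : ∀ x, |moll η ψ x| ≤ 1 := hη.abs_moll_le h1
  have hl := hη.lipC_moll_of_bdd hΛ h1 hc.measurable zero_le_one
  have hm := hl.continuous.measurable
  have hsub : ∀ x, |moll η ψ x - ψ x| ≤ c := fun x =>
    hη.abs_moll_sub_le hb hc.measurable fun w hw => by
      refine (hδ' (a := x + pr w) (b := x) ?_).le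
      rw [dist_eq_norm, add_sub_cancel_left]
      exact ((norm_pr_le w).trans hw).trans_lt (half_lt_self hδ)
  obtain ⟨R, hR⟩ := exists_eq_zero_of_hasCompactSupport hs
  obtain ⟨R', hR'⟩ := exists_eq_zero_of_hasCompactSupport (hη.hasCompactSupport_moll hR)
  -- Two mollifications: the first makes a merely continuous function Lipschitz, and the second
  -- makes the Lipschitz function `C^{1,1}` with explicit constants.
  refine ⟨moll η (moll η ψ), _, _, _, isTest_of_contDiff (hη.contDiff_moll ⟨1, hb1⟩ hm)
    (hη.hasCompactSupport_moll hR'), hη.isC11_moll hΛ hΛ0 ⟨1, hb1⟩ hl, hη.abs_moll_le hb1,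
    fun x => ?_⟩
  have h2 : |moll η (moll η ψ) x - moll η ψ x| ≤ c := by
    rw [← hη.moll_sub ⟨1, hb1⟩ hm hb hc.measurable]
    exact hη.abs_moll_le hsub x
  calc _ ≤ |moll η (moll η ψ) x - moll η ψ x| + |moll η ψ x - ψ x| := abs_sub_le _ _ _
    _ ≤ 2 * c := by linarith [hsub x]

/-- The `L¹` norm is the supremum over test functions. -/
theorem integral_abs_le_of_isTest {g : Dom k₁ k₂ → ℝ} (hg : Integrable g) {c : ℝ}
    (h : ∀ φ G L K, IsTest φ → IsC11 φ G L K → (∀ x, |φ x| ≤ 1) → |∫ x, g x * φ x| ≤ c) :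
    ∫ x, |g x| ≤ c := by
  refine le_of_forall_pos_le_add fun ε hε => ?_
  have hε5 : 0 < ε / 5 := by linarith
  obtain ⟨φ, hφs, hφg, hφc, hφi⟩ := hg.exists_hasCompactSupport_integral_sub_le hε5
  set m := volume.real (tsupport φ)
  set N := ∫ x, |g x|
  have hN : 0 ≤ N := integral_nonneg fun _ => abs_nonneg _
  set δ := ε / 5 / (m + 1) with hδ
  have hm0 : 0 ≤ m := measureReal_nonneg
  have hδ0 : 0 < δ := by positivity
  -- A continuous substitute for the sign of `φ`, with compact support, for which `φ ψ ≥ |φ| - δ`.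
  -- The five parts `ε / 5` are two errors `‖g - φ‖₁`, one `δ m`, and two `c' N` from replacing `ψ`
  -- by a test function.
  set ψ : Dom k₁ k₂ → ℝ := fun x => φ x / (|φ x| + δ) with hψ
  have hpos : ∀ x, 0 < |φ x| + δ := fun x => by positivity
  have hψc : Continuous ψ := hφc.div (hφc.abs.add continuous_const) fun x => (hpos x).ne'
  have hψ1 : ∀ x, |ψ x| ≤ 1 := fun x => by
    rw [hψ, abs_div, abs_of_pos (hpos x), div_le_one (hpos x)]
    linarith
  have hψs : HasCompactSupport ψ := hφs.mono fun x hx => by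
    rw [Function.mem_support] at hx ⊢
    exact fun h0 => hx (by simp [hψ, h0])
  set c' := ε / 5 / (N + 1) with hc'
  obtain ⟨χ, G, L, K, hχt, hχ, hχ1, hχψ⟩ := exists_isTest_abs_sub_le hψc hψs hψ1
    (c := c') (by positivity)
  have iψ : ∀ f : Dom k₁ k₂ → ℝ, Integrable f → Integrable fun x => f x * ψ x := fun f hf =>
    hf.mul_bdd (c := 1) hψc.aestronglyMeasurable (Filter.Eventually.of_forall hψ1)
  have iχ : Integrable fun x => g x * χ x :=
    hg.mul_bdd (c := 1) hχ.continuous.aestronglyMeasurable (Filter.Eventually.of_forall hχ1)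
  have iD : Integrable fun x => ‖g x - φ x‖ := (hg.sub hφi).norm
  have b1 : N ≤ (∫ x, |φ x|) + ∫ x, ‖g x - φ x‖ := by
    rw [← integral_add hφi.abs iD]
    refine integral_mono hg.abs (hφi.abs.add iD) fun x => ?_
    have := abs_add_le (φ x) (g x - φ x)
    rwa [add_sub_cancel] at this
  have b2 : ∫ x, |φ x| ≤ (∫ x, φ x * ψ x) + δ * m := by
    have iS : Integrable ((tsupport φ).indicator fun _ => δ) :=
      (integrable_indicator_iff (isClosed_tsupport φ).measurableSet).2
        (integrableOn_const hφs.isCompact.measure_lt_top.ne)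
    have eS : ∫ x, (tsupport φ).indicator (fun _ => δ) x = δ * m := by
      rw [integral_indicator (isClosed_tsupport φ).measurableSet, setIntegral_const, smul_eq_mul,
        mul_comm]
    rw [← eS, ← integral_add (iψ φ hφi) iS]
    refine integral_mono hφi.abs ((iψ φ hφi).add iS) fun x => ?_
    by_cases hx : φ x = 0
    · simp only [hx, abs_zero, zero_mul, zero_add, hψ]
      exact Set.indicator_nonneg (fun _ _ => hδ0.le) x
    · rw [Set.indicator_of_mem (subset_tsupport _ hx)]
      have e : φ x * ψ x = |φ x| ^ 2 / (|φ x| + δ) := by rw [sq_abs, hψ, sq, mul_div_assoc]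
      rw [e, ← sub_le_iff_le_add, le_div_iff₀ (hpos x)]
      nlinarith [sq_nonneg δ]
  have b3 : ∫ x, φ x * ψ x ≤ (∫ x, g x * ψ x) + ∫ x, ‖g x - φ x‖ := by
    rw [← integral_add (iψ g hg) iD]
    refine integral_mono (iψ φ hφi) ((iψ g hg).add iD) fun x => ?_
    have h1 : |(φ x - g x) * ψ x| ≤ |g x - φ x| * 1 := by
      rw [abs_mul, abs_sub_comm]
      exact mul_le_mul_of_nonneg_left (hψ1 x) (abs_nonneg _)
    have h2 := le_abs_self ((φ x - g x) * ψ x)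
    rw [Real.norm_eq_abs]
    linarith
  have b4 : ∫ x, g x * ψ x ≤ (∫ x, g x * χ x) + 2 * c' * N := by
    rw [← integral_const_mul, ← integral_add iχ (hg.abs.const_mul _)]
    refine integral_mono (iψ g hg) (iχ.add (hg.abs.const_mul _)) fun x => ?_
    have h1 : |g x * (ψ x - χ x)| ≤ |g x| * (2 * c') := by
      rw [abs_mul, abs_sub_comm (ψ x)]
      exact mul_le_mul_of_nonneg_left (hχψ x) (abs_nonneg _)
    have h2 := le_abs_self (g x * (ψ x - χ x))
    linarith
  have b5 := (le_abs_self _).trans (h χ G L K hχt hχ hχ1)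
  have b6 : δ * m ≤ ε / 5 := by
    rw [hδ, div_mul_eq_mul_div, div_le_iff₀ (by positivity)]; nlinarith
  have b7 : c' * N ≤ ε / 5 := by
    rw [hc', div_mul_eq_mul_div, div_le_iff₀ (by positivity)]; nlinarith
  linarith

/-- Functions of bounded variation are Lipschitz continuous under translations in `L¹`. -/
theorem IsBV.shiftBound (h : IsBV f) : ShiftBound f (totalVariation f).toReal := fun w =>
  integral_abs_le_of_isTest ((h.1.comp_add_right (pr w)).sub h.1) fun _ _ _ _ hφ hC h1 =>
    integral_mul_shift_sub_le h.1 h.2 hφ hC h1 w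

end BV

/-! ### Translations of piecewise constant functions -/

section ShiftAxes
variable {k₁ k₂ : Axis} {f : Dom k₁ k₂ → ℝ}

theorem integrable_shift_sub (hf : Integrable f) (v w : Dom k₁ k₂) :
    Integrable fun x => |f (x + v) - f (x + w)| :=
  ((hf.comp_add_right v).sub (hf.comp_add_right w)).abs

theorem integral_shift_add_le (hf : Integrable f) (v w : Plane) :
    ∫ x, |f (x + pr (v + w)) - f x| ≤
      (∫ x, |f (x + pr v) - f x|) + ∫ x, |f (x + pr w) - f x| := by
  have i1 := integrable_shift_sub hf (pr (v + w)) (pr v)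
  have i2 := integrable_shift_sub hf (pr v) 0
  have i3 := integrable_shift_sub hf (pr (v + w)) 0
  simp only [add_zero] at i2 i3
  have e : ∫ x, |f (x + pr w) - f x| = ∫ x, |f (x + pr (v + w)) - f (x + pr v)| := by
    rw [← integral_add_right_eq_self (μ := volume) _ (pr v : Dom k₁ k₂)]
    simp only [pr_add, add_assoc]
  rw [e, ← integral_add i2 i1]
  refine integral_mono i3 (i2.add i1) fun x => ?_
  exact (abs_sub_le _ (f (x + pr v)) _).trans_eq (add_comm _ _)

theorem integral_shift_neg (v : Plane) :
    ∫ x, |f (x + pr (-v)) - f x| = ∫ x, |f (x + pr v) - f x| := by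
  rw [← integral_add_right_eq_self (μ := volume) _ (pr v : Dom k₁ k₂)]
  simp only [pr_neg, add_neg_cancel_right]
  simp only [abs_sub_comm]

theorem integral_shift_nsmul_le (hf : Integrable f) (v : Plane) (n : ℕ) :
    ∫ x, |f (x + pr ((n : ℝ) • v)) - f x| ≤ n * ∫ x, |f (x + pr v) - f x| := by
  induction n with
  | zero => simp [pr_zero]
  | succ n ih =>
    push_cast
    rw [add_smul, one_smul, add_mul, one_mul]
    exact (integral_shift_add_le hf _ _).trans (add_le_add_left ih _)

/-- Bounds of short translations in a direction extend to all translations in that direction. -/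
theorem integral_shift_smul_le (hf : Integrable f) {e : Plane} {s M : ℝ} (hs : 0 < s)
    (h : ∀ v : ℝ, 0 ≤ v → v ≤ s → ∫ x, |f (x + pr (v • e)) - f x| ≤ M * v) (v : ℝ) :
    ∫ x, |f (x + pr (v • e)) - f x| ≤ M * |v| := by
  have key : ∀ v : ℝ, 0 ≤ v → ∫ x, |f (x + pr (v • e)) - f x| ≤ M * v := fun v hv => by
    obtain ⟨n, hn⟩ := exists_nat_gt (v / s)
    have hn0 : (0 : ℝ) < n := (div_nonneg hv hs.le).trans_lt hn
    have h1 := integral_shift_nsmul_le hf ((v / n) • e) n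
    rw [smul_smul, mul_div_cancel₀ _ hn0.ne'] at h1
    have h2 := h (v / n) (by positivity) (by
      rw [div_lt_iff₀ hs] at hn
      rw [div_le_iff₀ hn0]; linarith)
    refine h1.trans ((mul_le_mul_of_nonneg_left h2 hn0.le).trans (le_of_eq ?_))
    field_simp
  rcases le_total 0 v with hv | hv
  · rw [abs_of_nonneg hv]; exact key v hv
  · rw [abs_of_nonpos hv, ← integral_shift_neg, ← neg_smul]
    exact key (-v) (by linarith)

theorem shiftBound_of_axes (hf : Integrable f) {s₁ s₂ M : ℝ} (hs₁ : 0 < s₁) (hs₂ : 0 < s₂)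
    (hM : 0 ≤ M)
    (h1 : ∀ v : ℝ, 0 ≤ v → v ≤ s₁ → ∫ x, |f (x + pr (!₂[v, 0])) - f x| ≤ M * v)
    (h2 : ∀ v : ℝ, 0 ≤ v → v ≤ s₂ → ∫ x, |f (x + pr (!₂[0, v])) - f x| ≤ M * v) :
    ShiftBound f (2 * M) := by
  have e1 : ∀ v : ℝ, (!₂[v, 0] : Plane) = v • !₂[1, 0] := fun v => by
    ext i; fin_cases i <;> simp
  have e2 : ∀ v : ℝ, (!₂[0, v] : Plane) = v • !₂[0, 1] := fun v => by
    ext i; fin_cases i <;> simp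
  have h1' : ∀ v : ℝ, 0 ≤ v → v ≤ s₁ → ∫ x, |f (x + pr (v • !₂[1, 0])) - f x| ≤ M * v :=
    fun v hv hvs => by rw [← e1]; exact h1 v hv hvs
  have h2' : ∀ v : ℝ, 0 ≤ v → v ≤ s₂ → ∫ x, |f (x + pr (v • !₂[0, 1])) - f x| ≤ M * v :=
    fun v hv hvs => by rw [← e2]; exact h2 v hv hvs
  intro w
  have ew : w = w 0 • !₂[1, 0] + w 1 • !₂[0, 1] := by
    ext i; fin_cases i <;> simp
  have a1 := integral_shift_smul_le hf hs₁ h1' (w 0)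
  have a2 := integral_shift_smul_le hf hs₂ h2' (w 1)
  have a3 := integral_shift_add_le hf (w 0 • !₂[1, 0]) (w 1 • !₂[0, 1])
  rw [← ew] at a3
  have b0 := mul_le_mul_of_nonneg_left (abs_coord_le w 0) hM
  have b1 := mul_le_mul_of_nonneg_left (abs_coord_le w 1) hM
  linarith

end ShiftAxes

section GridShift
variable {k₁ k₂ : Axis} {m₁ : Mesh k₁} {m₂ : Mesh k₂} {a : GridFun m₁ m₂}

theorem IsGridDensity.integrable_piecewiseConst (h : IsGridDensity a) :
    Integrable (piecewiseConst a) := by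
  have := h.isProbabilityMeasure .cellwise
  rw [cellwise_eq] at this
  exact integrable_of_densityMeasure (measurable_piecewiseConst a)
    fun x => by rw [piecewiseConst_eq]; exact h.nonneg _ _

/-- If a short translation by `v` moves a point of the cell `p` out of the set `T p` at most to the
cell `p + e`, then the translation is controlled by the variation in the direction `e`. -/
theorem IsGridDensity.integral_shift_le (h : IsGridDensity a) (e : m₁.Index × m₂.Index) {v : Plane}
    {c : ℝ} (hc : 0 ≤ c) (T : m₁.Index × m₂.Index → Set (Dom k₁ k₂))
    (hT : ∀ p, T p ⊆ gridCell m₁ m₂ p) (hTv : ∀ p, volume (T p) ≤ ENNReal.ofReal c)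
    (h0 : ∀ p, ∀ x ∈ gridCell m₁ m₂ p \ T p, x + pr v ∈ gridCell m₁ m₂ p)
    (h1 : ∀ p, ∀ x ∈ T p, x + pr v ∈ gridCell m₁ m₂ (p + e)) :
    ∫ x, |piecewiseConst a (x + pr v) - piecewiseConst a x| ≤
      gridVar e (fun p => a p.1 p.2) * c := by
  have hi := integrable_shift_sub h.integrable_piecewiseConst (pr v) 0
  simp only [add_zero] at hi
  refine hasSum_le (fun p => ?_) (hasSum_gridCell (m₁ := m₁) (m₂ := m₂) hi)
    ((hasSum_gridVar h.hasSum_self.summable e).mul_right c)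
  have hres := setIntegral_eq_of_subset_of_forall_sdiff_eq_zero (μ := volume)
    (f := fun x => |piecewiseConst a (x + pr v) - piecewiseConst a x|) (measurableSet_gridCell p)
    (hT p) fun x hx => by
      rw [piecewiseConst_of_mem a (h0 p x hx), piecewiseConst_of_mem a hx.1, sub_self, abs_zero]
  rw [hres]
  have h2 : volume (T p) < ⊤ := (hTv p).trans_lt ENNReal.ofReal_lt_top
  refine (Real.le_norm_self _).trans ((norm_setIntegral_le_of_norm_le_const h2
    (C := |a (p + e).1 (p + e).2 - a p.1 p.2|) fun x hx => ?_).trans ?_)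
  · rw [Real.norm_eq_abs, abs_abs, piecewiseConst_of_mem a (h1 p x hx),
      piecewiseConst_of_mem a (hT p hx)]
  · exact mul_le_mul_of_nonneg_left (ENNReal.toReal_le_of_le_ofReal hc (hTv p)) (abs_nonneg _)

theorem IsGridDensity.integral_shift_fst_le (h : IsGridDensity a) {v : ℝ} (hv : 0 ≤ v)
    (hvs : v ≤ m₁.step) :
    ∫ x, |piecewiseConst a (x + pr (!₂[v, 0])) - piecewiseConst a x| ≤
      gridVar (shift₁ m₁ m₂) (fun p => a p.1 p.2) * (v * m₂.step) := by
  refine h.integral_shift_le _ (mul_nonneg hv m₂.step_pos.le)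
    (fun p => m₁.strip v p.1 ×ˢ m₂.cell p.2) (fun p => Set.prod_mono Set.inter_subset_left le_rfl)
    (fun p => ?_) (fun p x hx => ?_) fun p x hx => ?_
  · rw [Measure.volume_eq_prod, Measure.prod_prod, m₂.volume_cell, ENNReal.ofReal_mul hv]
    gcongr
    exact m₁.volume_strip_le hv hvs _
  · rw [add_pr_fst]
    refine ⟨(m₁.mem_cell_iff _ _).2 ?_, hx.1.2⟩
    by_contra hne
    exact hx.2 ⟨⟨hx.1.1, hne⟩, hx.1.2⟩
  · rw [add_pr_fst]
    refine ⟨(m₁.mem_cell_iff _ _).2 (m₁.index_of_mem_strip hv hvs hx.1).1, ?_⟩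
    simpa [shift₁] using hx.2

theorem IsGridDensity.integral_shift_snd_le (h : IsGridDensity a) {v : ℝ} (hv : 0 ≤ v)
    (hvs : v ≤ m₂.step) :
    ∫ x, |piecewiseConst a (x + pr (!₂[0, v])) - piecewiseConst a x| ≤
      gridVar (shift₂ m₁ m₂) (fun p => a p.1 p.2) * (v * m₁.step) := by
  refine h.integral_shift_le _ (mul_nonneg hv m₁.step_pos.le)
    (fun p => m₁.cell p.1 ×ˢ m₂.strip v p.2) (fun p => Set.prod_mono le_rfl Set.inter_subset_left)
    (fun p => ?_) (fun p x hx => ?_) fun p x hx => ?_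
  · rw [Measure.volume_eq_prod, Measure.prod_prod, m₁.volume_cell, mul_comm, ENNReal.ofReal_mul hv]
    gcongr
    exact m₂.volume_strip_le hv hvs _
  · rw [add_pr_snd]
    refine ⟨hx.1.1, (m₂.mem_cell_iff _ _).2 ?_⟩
    by_contra hne
    exact hx.2 ⟨hx.1.1, ⟨hx.1.2, hne⟩⟩
  · rw [add_pr_snd]
    refine ⟨?_, (m₂.mem_cell_iff _ _).2 (m₂.index_of_mem_strip hv hvs hx.2).1⟩
    simpa [shift₂] using hx.1

/-- A translation by `v` in one direction costs `v` times the transverse cell length times the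
variation. Dividing the hypothesis by the other cell length replaces the mesh size by `κ`. -/
theorem IsGridDensity.shiftBound (h : IsGridDensity a) {κ B : ℝ}
    (h₁ : meshSize m₁ m₂ ≤ κ * m₁.step) (h₂ : meshSize m₁ m₂ ≤ κ * m₂.step) (hB : 0 ≤ B)
    (hTV : m₁.step * m₂.step * gridTV a ≤ B * meshSize m₁ m₂) :
    ShiftBound (piecewiseConst a) (2 * (B * κ)) := by
  have hs₁ := m₁.step_pos
  have hs₂ := m₂.step_pos
  have hκ : 0 ≤ κ := by
    have := (meshSize_pos m₁ m₂).trans_le h₁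
    exact (pos_of_mul_pos_left this hs₁.le).le
  have g₁ := gridVar_nonneg (shift₁ m₁ m₂) (fun p => a p.1 p.2)
  have g₂ := gridVar_nonneg (shift₂ m₁ m₂) (fun p => a p.1 p.2)
  have k₁ : m₂.step * gridVar (shift₁ m₁ m₂) (fun p => a p.1 p.2) ≤ B * κ := by
    refine le_of_mul_le_mul_left ?_ hs₁
    have : m₁.step * m₂.step * gridVar (shift₁ m₁ m₂) (fun p => a p.1 p.2) ≤
        m₁.step * m₂.step * gridTV a := by gcongr; exact le_add_of_nonneg_right g₂
    nlinarith
  have k₂ : m₁.step * gridVar (shift₂ m₁ m₂) (fun p => a p.1 p.2) ≤ B * κ := by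
    refine le_of_mul_le_mul_left ?_ hs₂
    have : m₁.step * m₂.step * gridVar (shift₂ m₁ m₂) (fun p => a p.1 p.2) ≤
        m₁.step * m₂.step * gridTV a := by gcongr; exact le_add_of_nonneg_left g₁
    nlinarith
  refine shiftBound_of_axes h.integrable_piecewiseConst hs₁ hs₂ (mul_nonneg hB hκ)
    (fun v hv hvs => (h.integral_shift_fst_le hv hvs).trans ?_)
    (fun v hv hvs => (h.integral_shift_snd_le hv hvs).trans ?_)
  · have := mul_le_mul_of_nonneg_right k₁ hv
    linarith
  · have := mul_le_mul_of_nonneg_right k₂ hv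
    linarith

end GridShift

/-! ### The variation of the cell averages -/

section CellAverages
variable {k₁ k₂ : Axis} {m₁ : Mesh k₁} {m₂ : Mesh k₂} {μ₀ : ProbabilityMeasure (Dom k₁ k₂)}

/-- The translation by `v` carries the cell `p` onto the cell `p + e`, so a difference of cell
averages is the average of a difference over one cell. -/
theorem gridVar_cellAverages_le (hi : Integrable (density μ₀))
    {e : m₁.Index × m₂.Index} {v : Plane}
    (he : ∀ (x : Dom k₁ k₂) p, x + pr v ∈ gridCell m₁ m₂ (p + e) ↔ x ∈ gridCell m₁ m₂ p) :
    m₁.step * m₂.step * gridVar e (fun p => cellAverages m₁ m₂ μ₀ p.1 p.2) ≤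
      ∫ x, |density μ₀ (x + pr v) - density μ₀ x| := by
  have hS := step_mul_pos m₁ m₂
  have hd := integrable_shift_sub hi (pr v) 0
  simp only [add_zero] at hd
  have hs := hasSum_gridCell (m₁ := m₁) (m₂ := m₂) hd
  have hterm : ∀ p : m₁.Index × m₂.Index, m₁.step * m₂.step *
      |cellAverages m₁ m₂ μ₀ (p + e).1 (p + e).2 - cellAverages m₁ m₂ μ₀ p.1 p.2| ≤
      ∫ x in gridCell m₁ m₂ p, |density μ₀ (x + pr v) - density μ₀ x| := by
    intro p
    have h1 : ∀ q : m₁.Index × m₂.Index, m₁.step * m₂.step * cellAverages m₁ m₂ μ₀ q.1 q.2 =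
        ∫ x in gridCell m₁ m₂ q, density μ₀ x := fun q => mul_div_cancel₀ _ hS.ne'
    have h2 : ∫ x in gridCell m₁ m₂ (p + e), density μ₀ x =
        ∫ x in gridCell m₁ m₂ p, density μ₀ (x + pr v) := by
      rw [← integral_indicator (measurableSet_gridCell _),
        ← integral_indicator (measurableSet_gridCell _),
        ← integral_add_right_eq_self (μ := volume) _ (pr v : Dom k₁ k₂)]
      refine integral_congr_ae (Filter.Eventually.of_forall fun x => ?_)
      by_cases hx : x ∈ gridCell m₁ m₂ p
      · simp only [Set.indicator_of_mem hx, Set.indicator_of_mem ((he x p).2 hx)]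
      · simp only [Set.indicator_of_notMem hx, Set.indicator_of_notMem (mt (he x p).1 hx)]
    have h3 : Integrable (fun x => density μ₀ (x + pr v)) := hi.comp_add_right _
    have h4 : ∀ c d : ℝ, m₁.step * m₂.step * |c - d| =
        |m₁.step * m₂.step * c - m₁.step * m₂.step * d| := fun c d => by
      rw [← mul_sub, abs_mul, abs_of_pos hS]
    rw [h4, h1, h1, h2, ← integral_sub h3.integrableOn hi.integrableOn]
    exact abs_integral_le_integral_abs
  rw [gridVar, ← tsum_mul_left, ← hs.tsum_eq]
  refine Summable.tsum_le_tsum hterm (Summable.of_nonneg_of_le (fun p => ?_) hterm hs.summable)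
    hs.summable
  positivity

theorem mem_gridCell_add_shift₁ (x : Dom k₁ k₂) (p : m₁.Index × m₂.Index) :
    x + pr (disp₁ m₁) ∈ gridCell m₁ m₂ (p + shift₁ m₁ m₂) ↔ x ∈ gridCell m₁ m₂ p := by
  rw [disp₁, add_pr_fst, mem_gridCell_iff, mem_gridCell_iff, m₁.index_add_proj_step]
  simp [Prod.ext_iff, shift₁]

theorem mem_gridCell_add_shift₂ (x : Dom k₁ k₂) (p : m₁.Index × m₂.Index) :
    x + pr (disp₂ m₂) ∈ gridCell m₁ m₂ (p + shift₂ m₁ m₂) ↔ x ∈ gridCell m₁ m₂ p := by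
  rw [disp₂, add_pr_snd, mem_gridCell_iff, mem_gridCell_iff, m₂.index_add_proj_step]
  simp [Prod.ext_iff, shift₂]

theorem gridTV_cellAverages_le (hi : Integrable (density μ₀)) {M : ℝ} (hM : 0 ≤ M)
    (h : ShiftBound (density μ₀) M) :
    m₁.step * m₂.step * gridTV (cellAverages m₁ m₂ μ₀) ≤ 2 * M * meshSize m₁ m₂ := by
  have h1 := (gridVar_cellAverages_le hi (mem_gridCell_add_shift₁ (m₁ := m₁) (m₂ := m₂))).trans
    (h _)
  have h2 := (gridVar_cellAverages_le hi (mem_gridCell_add_shift₂ (m₁ := m₁) (m₂ := m₂))).trans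
    (h _)
  rw [norm_disp₁] at h1
  rw [norm_disp₂] at h2
  have b1 : M * m₁.step ≤ M * meshSize m₁ m₂ := by gcongr; exact le_max_left _ _
  have b2 : M * m₂.step ≤ M * meshSize m₁ m₂ := by gcongr; exact le_max_right _ _
  rw [gridTV, mul_add]
  linarith

end CellAverages

/-! ### Curves of densities -/

section DensityCurve
variable {k₁ k₂ : Axis}

/-- An approximate solution that consists of densities of uniformly bounded variation. -/
structure IsDensityCurve (V : Velocity k₁ k₂) (μ₀ : ProbabilityMeasure (Dom k₁ k₂)) (A : ℝ)
    (M : ℝ → ℝ) (h : ℝ) (f : ℝ → Dom k₁ k₂ → ℝ) : Prop where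
  measurable : ∀ t, Measurable (f t)
  nonneg : ∀ t x, 0 ≤ f t x
  prob : ∀ t, IsProbabilityMeasure (densityMeasure (f t))
  approx : IsApprox V A h fun t => ⟨densityMeasure (f t), prob t⟩
  initial : WClose (densityMeasure (f 0)) (μ₀ : Measure (Dom k₁ k₂)) h
  shift : ∀ T t, 0 ≤ t → t ≤ T → ShiftBound (f t) (M T)

variable {V : Velocity k₁ k₂} {μ₀ : ProbabilityMeasure (Dom k₁ k₂)} {A C h : ℝ} {M : ℝ → ℝ}
  {f g : ℝ → Dom k₁ k₂ → ℝ}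

theorem IsDensityCurve.integrable (hf : IsDensityCurve V μ₀ A M h f) (t : ℝ) : Integrable (f t) :=
  have := hf.prob t
  integrable_of_densityMeasure (hf.measurable t) (hf.nonneg t)

theorem IsDensityCurve.mono (hf : IsDensityCurve V μ₀ A M h f) (hh : 0 ≤ h) {A' h' : ℝ}
    {M' : ℝ → ℝ} (hA : A ≤ A') (hA0 : 0 ≤ A') (hM : ∀ T, M T ≤ M' T) (hh' : h ≤ h') :
    IsDensityCurve V μ₀ A' M' h' f where
  measurable := hf.measurable
  nonneg := hf.nonneg
  prob := hf.prob
  approx := hf.approx.mono hh hA hA0 hh'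
  initial := hf.initial.mono hh'
  shift T t ht htT := (hf.shift T t ht htT).mono (hM T)

/-- Stability in `L¹`. -/
theorem exists_integral_sub_le_of_isDensityCurve (hV : V.Regular C) (hA : 0 ≤ A) {T ε : ℝ}
    (hT : 0 ≤ T) (hM : 0 ≤ M T) (hε : 0 < ε) :
    ∃ η > 0, ∀ h, 0 ≤ h → h ≤ η → ∀ f g, IsDensityCurve V μ₀ A M h f →
      IsDensityCurve V μ₀ A M h g → ∀ t, 0 ≤ t → t ≤ T → ∫ x, |f t x - g t x| ≤ ε := by
  obtain ⟨d, hd, hclose⟩ := exists_integral_abs_sub_le (k₁ := k₁) (k₂ := k₂) hM hε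
  obtain ⟨η, hη, hstab⟩ := exists_stability (k₁ := k₁) (k₂ := k₂) hV hA hT hd
  refine ⟨η / 2, half_pos hη, fun h hh hhη f g hf hg t ht htT => ?_⟩
  have := hf.prob t
  have := hg.prob t
  refine hclose (f t) (g t) (hf.measurable t) (hg.measurable t) (hf.nonneg t) (hg.nonneg t)
    inferInstance inferInstance (hf.shift T t ht htT) (hg.shift T t ht htT) ?_
  exact hstab h η hh (by linarith) le_rfl _ _ hf.approx hg.approx
    ((hf.initial.trans hg.initial.symm).mono (by linarith)) t ht htT

/-- A perturbation of each measure by `d` merely adds `d` to the error. Thus consistency, proved for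
point masses, carries over to piecewise constant densities. -/
theorem IsApprox.of_wClose (hV : V.Regular C) {ν ν' : ℝ → ProbabilityMeasure (Dom k₁ k₂)}
    {d : ℝ} (hA : 0 ≤ A) (hh : 0 ≤ h) (hν : IsApprox V A h ν)
    (hd : ∀ t, WClose (ν' t : Measure (Dom k₁ k₂)) (ν t) d) :
    IsApprox V (A + 6 * C + 2) (h + d) ν' where
  close s t hs hst := by
    have hd0 := (hd 0).nonneg
    have hC := hV.nonneg
    have hst' : 0 ≤ t - s := sub_nonneg.2 hst
    refine (((hd s).trans (hν.close s t hs hst)).trans (hd t).symm).mono ?_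
    have : 0 ≤ A * d + (6 * C + 2) * (t - s + h) + 6 * C * d := by positivity
    nlinarith
  step s t hs hst hts φ G L K hφ := by
    have hd0 := (hd 0).nonneg
    have hC := hV.nonneg
    have hL := hφ.nonneg_lip
    have hK := hφ.nonneg_taylor
    have hst' : 0 ≤ t - s := sub_nonneg.2 hst
    have h1 := hν.step s t hs hst hts φ G L K hφ
    have h2 := (hd t).integral_le hφ.bdd hφ.lip
    have h3 := (hd s).integral_le hφ.bdd hφ.lip
    have h4 := hV.abs_flux_sub_le hφ (hd s)
    set F := ∫ x, inner ℝ (V (ν s) x) (G x) ∂(ν s : Measure (Dom k₁ k₂))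
    set F' := ∫ x, inner ℝ (V (ν' s) x) (G x) ∂(ν' s : Measure (Dom k₁ k₂))
    have h5 : |(t - s) * F' - (t - s) * F| ≤ 6 * C * (L + K) * d := by
      rw [← mul_sub, abs_mul, abs_of_nonneg hst']
      have : (t - s) * |F' - F| ≤ 1 * |F' - F| := by gcongr; linarith
      linarith
    have h6 : 0 ≤ (A * d + (6 * C + 2) * ((t - s) ^ 2 + h)) * (L + K) + 2 * d * K := by positivity
    rw [abs_le] at *
    constructor <;> linarith [h1.1, h1.2, h2.1, h2.2, h3.1, h3.2, h5.1, h5.2]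

end DensityCurve

/-! ### The numerical solution as a curve of densities -/

section
variable {k₁ k₂ : Axis} {m₁ : Mesh k₁} {m₂ : Mesh k₂} {V : Velocity k₁ k₂} {C C₁ lam₀ κ τ : ℝ}
  {μ₀ : ProbabilityMeasure (Dom k₁ k₂)}

/-- The bound of the variation of the numerical solutions up to time `T`. -/
def variationConst (C κ B T : ℝ) : ℝ := 2 * (Real.exp (2 * C * κ * (T + 1)) * (2 * B + 10) * κ)

/-- The consistency error of the numerical solutions. -/
def consistencyError (C₁ lam₀ κ : ℝ) (m₁ : Mesh k₁) (m₂ : Mesh k₂) (τ : ℝ) : ℝ :=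
  τ + κ * C₁ / lam₀ * τ + 4 * meshSize m₁ m₂

/-- The levels `k = 0` and `k = 1` are the two that the interpolation in time combines. For `k = 1`
the curve starts one step late, which the term `κ * C₁ / lam₀ * τ` of the error covers. -/
theorem isDensityCurve_laxFriedrichs (hac : (μ₀ : Measure (Dom k₁ k₂)) ≪ volume)
    (hBV : IsBV (density μ₀)) (hR : V.Regular C) (hV : V.BoundedBy C₁) (hC₁ : 0 ≤ C₁)
    (hlam : 0 < lam₀) (hκ : 0 ≤ κ) (hc : CFL C₁ lam₀ κ m₁ m₂ τ) (hτ : τ ≤ 1) (r : Realization)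
    {k : ℕ} (hk : k ≤ 1) :
    IsDensityCurve V μ₀ (approxConst C C₁ lam₀ κ + 6 * C + 2)
      (variationConst C κ (totalVariation (density μ₀)).toReal)
      (consistencyError C₁ lam₀ κ m₁ m₂ τ)
      (fun t => piecewiseConst (laxFriedrichs V r m₁ m₂ τ μ₀ (k + ⌊t / τ⌋₊))) := by
  have hg := isGridDensity_laxFriedrichs hac hc hV r
  have hh0 := (meshSize_pos m₁ m₂).le
  have hC := hR.nonneg
  have hτ0 := hc.pos.le
  have hs : m₁.step + m₂.step ≤ 2 * meshSize m₁ m₂ := by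
    linarith [le_max_left m₁.step m₂.step, le_max_right m₁.step m₂.step,
      show meshSize m₁ m₂ = max m₁.step m₂.step from rfl]
  have hR0 : 0 ≤ κ * C₁ / lam₀ := by positivity
  have hA0 : 0 ≤ approxConst C C₁ lam₀ κ := by
    rw [approxConst]; positivity
  have hprob : ∀ n, IsProbabilityMeasure (densityMeasure
      (piecewiseConst (laxFriedrichs V r m₁ m₂ τ μ₀ n))) := fun n =>
    (hg n).isProbabilityMeasure .cellwise
  have hpm : ∀ n, WClose (densityMeasure (piecewiseConst (laxFriedrichs V r m₁ m₂ τ μ₀ n)))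
      (Realization.pointMasses.measure (laxFriedrichs V r m₁ m₂ τ μ₀ n)) (2 * meshSize m₁ m₂) :=
    fun n => ((hg n).wClose_realization .cellwise).mono hs
  have hstep := wClose_laxFriedrichs_succ hac hV hlam hκ hc r
  refine ⟨fun t => measurable_piecewiseConst _, fun t x => ?_, fun t => hprob _, ?_, ?_, ?_⟩
  · rw [piecewiseConst_eq]; exact (hg _).nonneg _ _
  · have := IsApprox.of_wClose hR (ν' := fun t => ⟨_, hprob (k + ⌊t / τ⌋₊)⟩) hA0 hτ0
      (isApprox_laxFriedrichs hac hR hV hC₁ hlam hκ hc hτ r k) fun t => hpm _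
    refine this.mono (by positivity) le_rfl (by positivity) ?_
    rw [consistencyError]
    have : 0 ≤ κ * C₁ / lam₀ * τ := by positivity
    linarith
  · have h0 : WClose (Realization.pointMasses.measure (laxFriedrichs V r m₁ m₂ τ μ₀ k))
        (Realization.pointMasses.measure (laxFriedrichs V r m₁ m₂ τ μ₀ 0))
        (κ * C₁ / lam₀ * τ) := by
      interval_cases k
      · exact (WClose.refl _).mono (by positivity)
      · exact (hstep 0).symm
    have h1 : WClose (Realization.pointMasses.measure (laxFriedrichs V r m₁ m₂ τ μ₀ 0))
        (μ₀ : Measure (Dom k₁ k₂)) (2 * meshSize m₁ m₂) :=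
      (wClose_cellAverages hac).symm.mono hs
    simp only [zero_div, Nat.floor_zero, add_zero]
    refine ((hpm k).trans (h0.trans h1)).mono ?_
    rw [consistencyError]
    linarith
  · intro T t ht htT
    set B := (totalVariation (density μ₀)).toReal
    have hB : 0 ≤ B := ENNReal.toReal_nonneg
    refine (hg _).shiftBound (hc.meshSize_le_fst hκ) (hc.meshSize_le_snd hκ) (by positivity) ?_
    have h1 := gridTV_laxFriedrichs_le hac hR hV hκ hc r (k + ⌊t / τ⌋₊)
    have h2 := gridTV_cellAverages_le (m₁ := m₁) (m₂ := m₂) hBV.1 hB hBV.shiftBound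
    have h3 : ((k + ⌊t / τ⌋₊ : ℕ) : ℝ) * τ ≤ T + 1 := by
      have a1 := Nat.floor_le (div_nonneg ht hτ0)
      rw [le_div_iff₀ hc.pos] at a1
      have a2 : (k : ℝ) ≤ 1 := by exact_mod_cast hk
      have a3 : (k : ℝ) * τ ≤ 1 * 1 := mul_le_mul a2 hτ hτ0 zero_le_one
      push_cast
      linarith
    calc _ ≤ Real.exp (2 * C * κ * (((k + ⌊t / τ⌋₊ : ℕ) : ℝ) * τ)) *
          (m₁.step * m₂.step * gridTV (cellAverages m₁ m₂ μ₀) + 10 * meshSize m₁ m₂) := by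
            linarith
      _ ≤ Real.exp (2 * C * κ * (T + 1)) * (2 * B * meshSize m₁ m₂ + 10 * meshSize m₁ m₂) := by
            have : 0 ≤ gridTV (cellAverages m₁ m₂ μ₀) :=
              add_nonneg (gridVar_nonneg _ _) (gridVar_nonneg _ _)
            have := step_mul_pos m₁ m₂
            gcongr
      _ = _ := by ring

end

/-! ### Limits of density curves -/

section Limits
variable {k₁ k₂ : Axis} {V : Velocity k₁ k₂} {μ₀ : ProbabilityMeasure (Dom k₁ k₂)} {A C : ℝ}

/-- Each defining inequality involves only the two times `s` and `t`. Approximation at two times is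
enough, and no uniformity in time is required. -/
theorem IsApprox.of_forall_wClose (hV : V.Regular C) (hA : 0 ≤ A)
    {ν : ℝ → ProbabilityMeasure (Dom k₁ k₂)}
    (h : ∀ s t, 0 ≤ s → 0 ≤ t → ∀ ε > 0, ∃ h ν', 0 ≤ h ∧ h ≤ ε ∧ IsApprox V A h ν' ∧
      WClose (ν' s : Measure (Dom k₁ k₂)) (ν s) ε ∧ WClose (ν' t : Measure (Dom k₁ k₂)) (ν t) ε) :
    IsApprox V A 0 ν where
  close s t hs hst := by
    refine fun ψ hb hl => le_of_forall_pos_le_add fun ε hε => ?_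
    obtain ⟨h, ν', hh, hhε, hν, hs', ht'⟩ := h s t hs (hs.trans hst) (ε / (A + 2)) (by positivity)
    have := ((hs'.symm.trans (hν.close s t hs hst)).trans ht') ψ hb hl
    refine this.trans ?_
    have e : (A + 2) * (ε / (A + 2)) = ε := mul_div_cancel₀ _ (by positivity)
    have : A * h ≤ A * (ε / (A + 2)) := by gcongr
    linarith
  step s t hs hst hts φ G L K hφ := by
    have hC := hV.nonneg
    have hL := hφ.nonneg_lip
    have hK := hφ.nonneg_taylor
    have hst' : 0 ≤ t - s := sub_nonneg.2 hst
    refine le_of_forall_pos_le_add fun ε hε => ?_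
    set D := A * (L + K) + 2 * L + 6 * C * (L + K) + 1 with hD
    have hD0 : 0 < D := by positivity
    obtain ⟨h, ν', hh, hhε, hν, hs', ht'⟩ := h s t hs (hs.trans hst) (ε / D) (by positivity)
    have e : D * (ε / D) = ε := mul_div_cancel₀ _ hD0.ne'
    set d := ε / D with hd
    have hd0 : 0 < d := by positivity
    have h1 := hν.step s t hs hst hts φ G L K hφ
    have h2 := hs'.integral_le hφ.bdd hφ.lip
    have h3 := ht'.integral_le hφ.bdd hφ.lip
    have h4 := hV.abs_flux_sub_le hφ hs'
    set F := ∫ x, inner ℝ (V (ν s) x) (G x) ∂(ν s : Measure (Dom k₁ k₂))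
    set F' := ∫ x, inner ℝ (V (ν' s) x) (G x) ∂(ν' s : Measure (Dom k₁ k₂))
    have h5 : |(t - s) * F' - (t - s) * F| ≤ 6 * C * (L + K) * d := by
      rw [← mul_sub, abs_mul, abs_of_nonneg hst']
      have : (t - s) * |F' - F| ≤ 1 * |F' - F| := by gcongr; linarith
      linarith
    have h6 : A * h * (L + K) ≤ A * d * (L + K) := by gcongr
    have h7 : ε = A * d * (L + K) + 2 * (L * d) + 6 * C * (L + K) * d + d := by
      rw [← e, hD]; ring
    rw [abs_le] at *
    constructor <;> linarith [h1.1, h1.2, h2.1, h2.2, h3.1, h3.2, h5.1, h5.2]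

theorem ShiftBound.of_tendsto {F : ℕ → Dom k₁ k₂ → ℝ} {g : Dom k₁ k₂ → ℝ} {M : ℝ}
    (hF : ∀ n, Integrable (F n)) (hg : Integrable g)
    (hlim : Filter.Tendsto (fun n => ∫ x, |F n x - g x|) Filter.atTop (nhds 0))
    (h : ∀ n, ShiftBound (F n) M) : ShiftBound g M := by
  intro w
  have hb : ∀ n, ∫ x, |g (x + pr w) - g x| ≤ M * ‖w‖ + 2 * ∫ x, |F n x - g x| := by
    intro n
    have i0 : Integrable fun x => |F n x - g x| := ((hF n).sub hg).abs
    have i1 : Integrable fun x => |F n (x + pr w) - g (x + pr w)| := i0.comp_add_right (pr w)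
    have i2 : Integrable fun x => |F n (x + pr w) - F n x| :=
      (((hF n).comp_add_right (pr w)).sub (hF n)).abs
    have i3 : Integrable fun x => |F n (x + pr w) - g (x + pr w)| + |F n (x + pr w) - F n x| :=
      i1.add i2
    have e1 : ∫ x, |F n (x + pr w) - g (x + pr w)| = ∫ x, |F n x - g x| :=
      integral_add_right_eq_self (μ := volume) (fun x => |F n x - g x|) (pr w)
    have : ∫ x, |g (x + pr w) - g x| ≤
        ∫ x, (|F n (x + pr w) - g (x + pr w)| + |F n (x + pr w) - F n x| + |F n x - g x|) := by
      refine integral_mono ((hg.comp_add_right (pr w)).sub hg).abs (i3.add i0) fun x => ?_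
      have a1 := abs_sub_le (g (x + pr w)) (F n (x + pr w)) (g x)
      have a2 := abs_sub_le (F n (x + pr w)) (F n x) (g x)
      rw [abs_sub_comm (g (x + pr w)) (F n (x + pr w))] at a1
      linarith
    rw [integral_add i3 i0, integral_add i1 i2, e1] at this
    linarith [h n w]
  have := (hlim.const_mul 2).const_add (M * ‖w‖)
  rw [mul_zero, add_zero] at this
  exact ge_of_tendsto' this hb

/-- Completeness of `L¹`, for nonnegative functions. -/
theorem exists_limit_of_cauchy {F : ℕ → Dom k₁ k₂ → ℝ} (hF : ∀ n, Integrable (F n))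
    (h0 : ∀ n x, 0 ≤ F n x)
    (hc : ∀ ε > 0, ∃ N, ∀ n ≥ N, ∀ m ≥ N, ∫ x, |F n x - F m x| ≤ ε) :
    ∃ g : Dom k₁ k₂ → ℝ, Measurable g ∧ (∀ x, 0 ≤ g x) ∧ Integrable g ∧
      Filter.Tendsto (fun n => ∫ x, |F n x - g x|) Filter.atTop (nhds 0) := by
  have hdist : ∀ n m, dist ((hF n).toL1 (F n)) ((hF m).toL1 (F m)) = ∫ x, |F n x - F m x| :=
    fun n m => by
      rw [dist_eq_norm, ← Integrable.toL1_sub, L1.norm_of_fun_eq_integral_norm]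
      rfl
  have hcs : CauchySeq fun n => (hF n).toL1 (F n) := by
    refine Metric.cauchySeq_iff.2 fun ε hε => ?_
    obtain ⟨N, hN⟩ := hc (ε / 2) (half_pos hε)
    exact ⟨N, fun n hn m hm => by rw [hdist]; exact (hN n hn m hm).trans_lt (half_lt_self hε)⟩
  obtain ⟨G, hG⟩ := cauchySeq_tendsto_of_complete hcs
  have hGi := L1.integrable_coeFn G
  have hGm : Measurable (G : Dom k₁ k₂ → ℝ) := (Lp.stronglyMeasurable G).measurable
  -- The chosen representative of the limit might be negative on a null set. Its positive part is
  -- nonnegative everywhere and no farther from the nonnegative `F n`.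
  refine ⟨fun x => max (G x) 0, hGm.max measurable_const, fun x => le_max_right _ _,
    hGi.pos_part, ?_⟩
  have hG' := tendsto_iff_dist_tendsto_zero.1 hG
  refine squeeze_zero (fun n => integral_nonneg fun x => abs_nonneg _) (fun n => ?_) hG'
  have e : dist ((hF n).toL1 (F n)) G = ∫ x, |F n x - G x| := by
    rw [dist_eq_norm, L1.norm_eq_integral_norm]
    refine integral_congr_ae ?_
    filter_upwards [Lp.coeFn_sub ((hF n).toL1 (F n)) G, (hF n).coeFn_toL1] with x hx hx'
    rw [hx, Pi.sub_apply, hx', Real.norm_eq_abs]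
  rw [e]
  refine integral_mono ((hF n).sub hGi.pos_part).abs ((hF n).sub hGi).abs fun x => ?_
  have := abs_max_sub_max_le_abs (F n x) (G x) 0
  rwa [max_eq_left (h0 n x)] at this

theorem tendsto_integral_densityMeasure {F : ℕ → Dom k₁ k₂ → ℝ} {g : Dom k₁ k₂ → ℝ}
    (hF : ∀ n, Integrable (F n)) (hFm : ∀ n, Measurable (F n)) (hF0 : ∀ n x, 0 ≤ F n x)
    (hg : Integrable g) (hgm : Measurable g) (hg0 : ∀ x, 0 ≤ g x)
    (hlim : Filter.Tendsto (fun n => ∫ x, |F n x - g x|) Filter.atTop (nhds 0))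
    {ψ : Dom k₁ k₂ → ℝ} (hb : ∃ B, ∀ x, |ψ x| ≤ B) (hψ : Measurable ψ) :
    Filter.Tendsto (fun n => ∫ x, ψ x ∂(densityMeasure (F n))) Filter.atTop
      (nhds (∫ x, ψ x ∂(densityMeasure g))) := by
  obtain ⟨B, hB⟩ := hb
  have hi : ∀ f : Dom k₁ k₂ → ℝ, Integrable f → Integrable fun x => f x * ψ x := fun f hf =>
    hf.mul_bdd (c := B) hψ.aestronglyMeasurable (Filter.Eventually.of_forall hB)
  have := hlim.mul_const B
  rw [zero_mul] at this
  refine tendsto_iff_dist_tendsto_zero.2 (squeeze_zero (fun _ => dist_nonneg) (fun n => ?_) this)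
  rw [integral_densityMeasure (hFm n) (hF0 n), integral_densityMeasure hgm hg0, Real.dist_eq,
    ← integral_sub (hi _ (hF n)) (hi _ hg), ← integral_mul_const, ← Real.norm_eq_abs]
  refine norm_integral_le_of_norm_le (((hF n).sub hg).abs.mul_const B)
    (Filter.Eventually.of_forall fun x => ?_)
  rw [← sub_mul, norm_mul]
  exact mul_le_mul_of_nonneg_left (hB x) (norm_nonneg _)

/-- Existence of an exact solution from arbitrarily accurate approximations. -/
theorem exists_isDensityCurve (hV : V.Regular C) (hA : 0 ≤ A) {M : ℝ → ℝ} (hM : ∀ T, 0 ≤ T → 0 ≤ M T)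
    (h : ∀ η > 0, ∃ h f, 0 ≤ h ∧ h ≤ η ∧ IsDensityCurve V μ₀ A M h f) :
    ∃ f, IsDensityCurve V μ₀ A M 0 f := by
  have hη : ∀ n : ℕ, (0 : ℝ) < 1 / ((n : ℝ) + 1) := fun n => by positivity
  choose h F hh0 hh hF using fun n : ℕ => h _ (hη n)
  have hmono : ∀ {N n : ℕ}, N ≤ n → h n ≤ 1 / ((N : ℝ) + 1) := fun hn =>
    (hh _).trans (Nat.one_div_le_one_div hn)
  have hF' : ∀ {N n : ℕ}, N ≤ n → IsDensityCurve V μ₀ A M (1 / ((N : ℝ) + 1)) (F n) := fun hn =>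
    (hF _).mono (hh0 _) le_rfl hA (fun _ => le_rfl) (hmono hn)
  -- Stability in `L¹`, applied to two members of the sequence, shows that it is Cauchy at every
  -- time, so no subsequence is extracted.
  have hL1 : ∀ t : ℝ≥0, ∀ ε > 0, ∃ N, ∀ n ≥ N, ∀ m ≥ N, ∫ x, |F n t x - F m t x| ≤ ε := by
    intro t ε hε
    obtain ⟨η, hη, hst⟩ := exists_integral_sub_le_of_isDensityCurve (μ₀ := μ₀) hV hA t.2
      (hM t t.2) hε
    obtain ⟨N, hN⟩ := exists_nat_one_div_lt hη
    exact ⟨N, fun n hn m hm => hst _ (by positivity) hN.le _ _ (hF' hn) (hF' hm) t t.2 le_rfl⟩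
  -- Closeness in `L¹` controls `∫ ψ` only through the bound of `ψ`. The Wasserstein estimate is
  -- uniform in `ψ` and is therefore carried along separately.
  have hW : ∀ t : ℝ≥0, ∀ ε > 0, ∃ N, ∀ n ≥ N, ∀ m ≥ N,
      WClose (densityMeasure (F n t)) (densityMeasure (F m t)) ε := by
    intro t ε hε
    obtain ⟨η, hη, hst⟩ := exists_stability (k₁ := k₁) (k₂ := k₂) hV hA t.2 hε
    obtain ⟨N, hN⟩ := exists_nat_one_div_lt (half_pos hη)
    have hN2 : 1 / ((N : ℝ) + 1) ≤ η := hN.le.trans (half_le_self hη.le)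
    exact ⟨N, fun n hn m hm => hst _ η (by positivity) hN2 le_rfl _ _ (hF' hn).approx
      (hF' hm).approx (((hF' hn).initial.trans (hF' hm).initial.symm).mono (by linarith)) t t.2
      le_rfl⟩
  choose g hgm hg0 hgi hglim using fun t : ℝ≥0 =>
    exists_limit_of_cauchy (fun n => (hF n).integrable t) (fun n => (hF n).nonneg t) (hL1 t)
  have hlim : ∀ (t : ℝ≥0) {ψ : Dom k₁ k₂ → ℝ}, (∃ B, ∀ x, |ψ x| ≤ B) → Measurable ψ →
      Filter.Tendsto (fun n => ∫ x, ψ x ∂(densityMeasure (F n t))) Filter.atTop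
        (nhds (∫ x, ψ x ∂(densityMeasure (g t)))) := fun t _ hb hψ =>
    tendsto_integral_densityMeasure (fun n => (hF n).integrable t)
      (fun n => (hF n).measurable t) (fun n => (hF n).nonneg t) (hgi t) (hgm t) (hg0 t) (hglim t)
      hb hψ
  have hprob : ∀ t, IsProbabilityMeasure (densityMeasure (g t)) := by
    intro t
    have h1 := hlim t (ψ := fun _ => 1) ⟨1, by simp⟩ measurable_const
    have h2 : ∀ n, ∫ _, (1 : ℝ) ∂(densityMeasure (F n t)) = 1 := fun n => by
      have := (hF n).prob t
      simp
    simp only [h2] at h1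
    have h3 := tendsto_nhds_unique tendsto_const_nhds h1
    rw [integral_densityMeasure (hgm t) (hg0 t)] at h3
    simp only [mul_one] at h3
    refine ⟨?_⟩
    rw [withDensity_apply _ MeasurableSet.univ, Measure.restrict_univ,
      ← ofReal_integral_eq_lintegral_ofReal (hgi t) (Filter.Eventually.of_forall (hg0 t)), ← h3,
      ENNReal.ofReal_one]
  have hWg : ∀ t : ℝ≥0, ∀ ε > 0, ∃ N, ∀ n ≥ N,
      WClose (densityMeasure (F n t)) (densityMeasure (g t)) ε := by
    intro t ε hε
    obtain ⟨N, hN⟩ := hW t ε hε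
    refine ⟨N, fun n hn ψ hb hl => ?_⟩
    have h1 := ((hlim t hb hl.continuous.measurable).const_sub
      (∫ x, ψ x ∂(densityMeasure (F n t)))).abs
    refine le_of_tendsto h1 ?_
    filter_upwards [Filter.eventually_ge_atTop N] with m hm
    exact hN n hn m hm ψ hb hl
  refine ⟨fun t => g t.toNNReal, fun t => hgm _, fun t => hg0 _, fun t => hprob _, ?_, ?_, ?_⟩
  · refine IsApprox.of_forall_wClose hV hA fun s t hs ht ε hε => ?_
    obtain ⟨N₁, hN₁⟩ := hWg s.toNNReal ε hε
    obtain ⟨N₂, hN₂⟩ := hWg t.toNNReal ε hε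
    obtain ⟨N₃, hN₃⟩ := exists_nat_one_div_lt hε
    set n := max N₁ (max N₂ N₃)
    have e1 := hN₁ n (le_max_left _ _)
    have e2 := hN₂ n ((le_max_left _ _).trans (le_max_right _ _))
    rw [Real.coe_toNNReal _ hs] at e1
    rw [Real.coe_toNNReal _ ht] at e2
    exact ⟨h n, _, hh0 n, (hmono ((le_max_right _ _).trans (le_max_right _ _))).trans hN₃.le,
      (hF n).approx, e1, e2⟩
  · refine fun ψ hb hl => le_of_forall_pos_le_add fun ε hε => ?_
    obtain ⟨N, hN⟩ := hWg 0 (ε / 2) (half_pos hε)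
    obtain ⟨N', hN'⟩ := exists_nat_one_div_lt (half_pos hε)
    have e1 := hN (max N N') (le_max_left _ _)
    have e2 := (hF (max N N')).initial.mono (hmono (le_max_right N N'))
    rw [NNReal.coe_zero] at e1
    rw [Real.toNNReal_zero]
    exact ((e1.symm.trans e2).mono (by linarith)) ψ hb hl
  · intro T t ht htT
    refine ShiftBound.of_tendsto (fun n => (hF n).integrable t) (hgi _) ?_
      fun n => (hF n).shift T t ht htT
    have := hglim t.toNNReal
    rwa [Real.coe_toNNReal _ ht] at this

end Limits

/-! ### Existence -/

section Existence
variable {k₁ k₂ : Axis}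

/-- The mesh with cells of length `2π / (n + 1)`. -/
def uniformMesh (k : Axis) (n : ℕ) : Mesh k where
  step := 2 * Real.pi / (n + 1)
  step_pos := by positivity
  origin := 0
  cells := match k with
    | .line => 0
    | .circle => n + 1
  cells_mul_step := by
    cases k
    · simp [Axis.period]
    · simp only [Axis.period]
      push_cast
      field_simp

variable {V : Velocity k₁ k₂} {C C₁ lam₀ κ : ℝ} {μ₀ : ProbabilityMeasure (Dom k₁ k₂)}

/-- The time step attains the upper CFL bound, so `lam₀ = 1 / 2` and `κ = 1` are admissible. This
one family of meshes suffices for existence. -/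
theorem CFL.uniformMesh (hC₁ : 0 < C₁) (n : ℕ) : CFL C₁ (1 / 2) 1 (uniformMesh k₁ n)
    (uniformMesh k₂ n) (2 * Real.pi / (n + 1) / (2 * C₁)) := by
  have h : 2 * Real.pi / ((n : ℝ) + 1) / (2 * C₁) / (2 * Real.pi / (n + 1)) * C₁ = 1 / 2 := by
    field_simp
  refine ⟨by positivity, ?_, ?_, ?_⟩ <;> simp only [NonlocalLF.uniformMesh, min_self, max_self]
  · rw [one_mul]
  · exact h.ge
  · exact h.le

theorem CFL.le_meshSize {m₁ : Mesh k₁} {m₂ : Mesh k₂} {τ : ℝ} (hc : CFL C₁ lam₀ κ m₁ m₂ τ)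
    (hC₁ : 0 < C₁) : τ ≤ meshSize m₁ m₂ / (2 * C₁) := by
  rw [le_div_iff₀ (by positivity)]
  have h1 := hc.mul_le_min
  have h2 : min m₁.step m₂.step ≤ meshSize m₁ m₂ := min_le_max
  linarith

/-- Fine meshes have small time steps and a small consistency error. -/
theorem exists_consistencyError_le (hC₁ : 0 < C₁) (hlam : 0 < lam₀) (hκ : 0 ≤ κ) {η : ℝ}
    (hη : 0 < η) : ∃ δ > 0, ∀ (m₁ : Mesh k₁) (m₂ : Mesh k₂) (τ : ℝ), CFL C₁ lam₀ κ m₁ m₂ τ →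
      meshSize m₁ m₂ < δ → τ ≤ 1 ∧ consistencyError C₁ lam₀ κ m₁ m₂ τ ≤ η := by
  set R := κ * C₁ / lam₀
  have hR : 0 ≤ R := by positivity
  set D := (1 + R) / (2 * C₁) + 4
  have hD : 0 < D := by positivity
  refine ⟨min (2 * C₁) (η / D), by positivity, fun m₁ m₂ τ hc hm => ?_⟩
  have hτ := hc.le_meshSize hC₁
  constructor
  · refine hτ.trans ?_
    rw [div_le_one (by positivity)]
    exact hm.le.trans (min_le_left _ _)
  · have h1 := hm.le.trans (min_le_right _ _)
    rw [le_div_iff₀ hD] at h1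
    have h2 : (1 + R) * τ ≤ (1 + R) * (meshSize m₁ m₂ / (2 * C₁)) := by gcongr
    have h3 : meshSize m₁ m₂ * D =
        (1 + R) * (meshSize m₁ m₂ / (2 * C₁)) + 4 * meshSize m₁ m₂ := by
      simp only [D]; ring
    change τ + R * τ + 4 * meshSize m₁ m₂ ≤ η
    linarith

theorem consistencyError_nonneg {m₁ : Mesh k₁} {m₂ : Mesh k₂} {τ : ℝ}
    (hc : CFL C₁ lam₀ κ m₁ m₂ τ) (hC₁ : 0 ≤ C₁) (hlam : 0 < lam₀) (hκ : 0 ≤ κ) :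
    0 ≤ consistencyError C₁ lam₀ κ m₁ m₂ τ := by
  have := (meshSize_pos m₁ m₂).le
  have := hc.pos.le
  rw [consistencyError]
  positivity

theorem variationConst_nonneg (hκ : 0 ≤ κ) {B : ℝ} (hB : 0 ≤ B) (T : ℝ) :
    0 ≤ variationConst C κ B T := by
  rw [variationConst]; positivity

theorem approxConst_nonneg (hC : 0 ≤ C) (hC₁ : 0 ≤ C₁) (hlam : 0 < lam₀) (hκ : 0 ≤ κ) :
    0 ≤ approxConst C C₁ lam₀ κ := by
  rw [approxConst]; positivity

/-- Existence of an exact solution with densities of bounded variation. -/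
theorem exists_exact_isDensityCurve (hac : (μ₀ : Measure (Dom k₁ k₂)) ≪ volume)
    (hBV : IsBV (density μ₀)) (hR : V.Regular C) (hV : V.BoundedBy C₁) (hC₁ : 0 < C₁) :
    ∃ A M f, 0 ≤ A ∧ (∀ T, 0 ≤ M T) ∧ IsDensityCurve V μ₀ A M 0 f := by
  have hA := approxConst_nonneg hR.nonneg hC₁.le (lam₀ := 1 / 2) (κ := 1) (by norm_num)
    zero_le_one
  have hC := hR.nonneg
  have hM := variationConst_nonneg (C := C) (κ := 1) zero_le_one
    (ENNReal.toReal_nonneg (a := totalVariation (density μ₀)))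
  have hA' : 0 ≤ approxConst C C₁ (1 / 2) 1 + 6 * C + 2 := by positivity
  obtain ⟨f, hf⟩ := exists_isDensityCurve (μ₀ := μ₀) hR hA' (fun T _ => hM T) fun η hη => by
    obtain ⟨δ, hδ, h⟩ := exists_consistencyError_le (k₁ := k₁) (k₂ := k₂) hC₁
      (lam₀ := 1 / 2) (κ := 1) (by norm_num) zero_le_one hη
    obtain ⟨n, hn⟩ := exists_nat_one_div_lt (show 0 < δ / (2 * Real.pi) by positivity)
    have hc := CFL.uniformMesh (k₁ := k₁) (k₂ := k₂) hC₁ n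
    obtain ⟨hτ, hh⟩ := h _ _ _ hc (by
      rw [lt_div_iff₀ (by positivity), div_mul_eq_mul_div, one_mul] at hn
      simpa [meshSize, uniformMesh] using hn)
    exact ⟨_, _, consistencyError_nonneg hc hC₁.le (by norm_num) zero_le_one, hh,
      isDensityCurve_laxFriedrichs hac hBV hR hV hC₁.le (by norm_num) zero_le_one hc hτ
        .pointMasses zero_le_one⟩
  exact ⟨_, _, f, hA', hM, hf⟩

end Existence

/-! ### Convergence -/

section Convergence
variable {k₁ k₂ : Axis} {V : Velocity k₁ k₂} {C C₁ : ℝ} {μ₀ : ProbabilityMeasure (Dom k₁ k₂)}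

theorem density_ae_eq {f : Dom k₁ k₂ → ℝ} (hf : Measurable f) (h0 : ∀ x, 0 ≤ f x)
    (h : IsProbabilityMeasure (densityMeasure f)) :
    density ⟨densityMeasure f, h⟩ =ᵐ[volume] f := by
  filter_upwards [Measure.rnDeriv_withDensity volume hf.ennreal_ofReal] with x hx
  change ((densityMeasure f).rnDeriv volume x).toReal = f x
  rw [hx, ENNReal.toReal_ofReal (h0 x)]

theorem eLpNorm_one_le_ofReal {g : Dom k₁ k₂ → ℝ} (hg : Integrable g) {ε : ℝ}
    (h : ∫ x, |g x| ≤ ε) : eLpNorm g 1 volume ≤ ENNReal.ofReal ε := by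
  rw [eLpNorm_one_eq_lintegral_enorm, ← ofReal_integral_norm_eq_lintegral_enorm hg]
  exact ENNReal.ofReal_le_ofReal h

/-- With the larger of their constants, the numerical and the exact curve belong to the same class,
and stability in `L¹` puts both time levels within `ε` of `f t`. The interpolation in time is a
convex combination of the two levels. -/
theorem IsDensityCurve.exists_eLpNorm_approxSolution_le {A : ℝ} {M : ℝ → ℝ}
    {f : ℝ → Dom k₁ k₂ → ℝ} (hf : IsDensityCurve V μ₀ A M 0 f) (hA : 0 ≤ A) (hM : ∀ T, 0 ≤ M T)
    (hac : (μ₀ : Measure (Dom k₁ k₂)) ≪ volume) (hBV : IsBV (density μ₀)) (hR : V.Regular C)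
    (hV : V.BoundedBy C₁) (hC₁ : 0 < C₁) (r : Realization) {lam₀ κ T ε : ℝ} (hlam : 0 < lam₀)
    (hκ : 0 ≤ κ) (hT : 0 ≤ T) (hε : 0 < ε) :
    ∃ δ > 0, ∀ (m₁ : Mesh k₁) (m₂ : Mesh k₂) (τ : ℝ), CFL C₁ lam₀ κ m₁ m₂ τ →
      meshSize m₁ m₂ < δ → ∀ t, 0 ≤ t → t ≤ T →
      eLpNorm (fun x => approxSolution V r m₁ m₂ τ μ₀ t x - f t x) 1 volume ≤
        ENNReal.ofReal ε := by
  have hC := hR.nonneg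
  set A' := approxConst C C₁ lam₀ κ + 6 * C + 2
  have hA' : 0 ≤ A' := by
    have := approxConst_nonneg hC hC₁.le hlam hκ
    positivity
  set M' := variationConst C κ (totalVariation (density μ₀)).toReal
  have hAm : 0 ≤ max A A' := le_max_of_le_left hA
  obtain ⟨η, hη, hst⟩ := exists_integral_sub_le_of_isDensityCurve (μ₀ := μ₀) (A := max A A')
    (M := fun T => max (M T) (M' T)) hR hAm hT (le_max_of_le_left (hM T)) hε
  obtain ⟨δ, hδ, h⟩ := exists_consistencyError_le (k₁ := k₁) (k₂ := k₂) hC₁ hlam hκ hη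
  refine ⟨δ, hδ, fun m₁ m₂ τ hc hm t ht htT => ?_⟩
  obtain ⟨hτ, hh⟩ := h m₁ m₂ τ hc hm
  have hh0 := consistencyError_nonneg hc hC₁.le hlam hκ
  have hf' := hf.mono le_rfl (le_max_left A A') hAm (M' := fun T => max (M T) (M' T))
    (fun T => le_max_left _ _) hη.le
  have hF : ∀ k : ℕ, k ≤ 1 → Integrable (piecewiseConst
        (laxFriedrichs V r m₁ m₂ τ μ₀ (k + ⌊t / τ⌋₊))) ∧
      ∫ x, |piecewiseConst (laxFriedrichs V r m₁ m₂ τ μ₀ (k + ⌊t / τ⌋₊)) x - f t x| ≤ ε := by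
    intro k hk
    have hd := (isDensityCurve_laxFriedrichs hac hBV hR hV hC₁.le hlam hκ hc hτ r hk).mono hh0
      (le_max_right A A') hAm (M' := fun T => max (M T) (M' T)) (fun T => le_max_right _ _) hh
    exact ⟨hd.integrable t, hst η hη.le le_rfl _ _ hd hf' t ht htT⟩
  obtain ⟨i0, e0⟩ := hF 0 zero_le_one
  obtain ⟨i1, e1⟩ := hF 1 le_rfl
  rw [zero_add] at i0 e0
  rw [add_comm] at i1 e1
  have hft := hf.integrable t
  have hτ0 := hc.pos
  have hn := Nat.floor_le (div_nonneg ht hτ0.le)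
  have hn' := Nat.lt_floor_add_one (t / τ)
  rw [le_div_iff₀ hτ0] at hn
  rw [div_lt_iff₀ hτ0] at hn'
  set F := piecewiseConst (laxFriedrichs V r m₁ m₂ τ μ₀ ⌊t / τ⌋₊)
  set F' := piecewiseConst (laxFriedrichs V r m₁ m₂ τ μ₀ (⌊t / τ⌋₊ + 1))
  set a := (((⌊t / τ⌋₊ : ℕ) + 1 : ℝ) * τ - t) / τ with ha
  set b := (t - (⌊t / τ⌋₊ : ℕ) * τ) / τ with hb
  have ha0 : 0 ≤ a := div_nonneg (by linarith) hτ0.le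
  have hb0 : 0 ≤ b := div_nonneg (by linarith) hτ0.le
  have hab : a + b = 1 := by rw [ha, hb]; field_simp; ring
  have heq : (fun x => approxSolution V r m₁ m₂ τ μ₀ t x - f t x) =
      fun x => a * (F x - f t x) + b * (F' x - f t x) := by
    ext x
    have : approxSolution V r m₁ m₂ τ μ₀ t x = a * F x + b * F' x := rfl
    rw [this]
    linear_combination (f t x) * hab
  rw [heq]
  have j0 : Integrable fun x => F x - f t x := i0.sub hft
  have j1 : Integrable fun x => F' x - f t x := i1.sub hft
  refine eLpNorm_one_le_ofReal ((j0.const_mul a).add (j1.const_mul b)) ?_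
  calc ∫ x, |a * (F x - f t x) + b * (F' x - f t x)|
      ≤ ∫ x, (a * |F x - f t x| + b * |F' x - f t x|) := by
        refine integral_mono ((j0.const_mul a).add (j1.const_mul b)).abs
          ((j0.abs.const_mul a).add (j1.abs.const_mul b)) fun x => ?_
        refine (abs_add_le _ _).trans (le_of_eq ?_)
        rw [abs_mul, abs_mul, abs_of_nonneg ha0, abs_of_nonneg hb0]
    _ = a * (∫ x, |F x - f t x|) + b * ∫ x, |F' x - f t x| := by
        rw [integral_add (j0.abs.const_mul a) (j1.abs.const_mul b), integral_const_mul,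
          integral_const_mul]
    _ ≤ a * ε + b * ε := by gcongr
    _ = ε := by rw [← add_mul, hab, one_mul]

end Convergence

end NonlocalLF

end

/-! ### Existence, uniqueness, absolute continuity and convergence put together. -/

theorem theorem2p11 (k₁ k₂ : NonlocalLF.Axis) (V : NonlocalLF.Velocity k₁ k₂)
    (C₁ C₂ C₃ C₄ : ℝ) (hC₁ : 0 < C₁) (hC₂ : 0 < C₂) (hC₃ : 0 < C₃) (hC₄ : 0 < C₄)
    (hA1 : V.BoundedBy C₁) (hA2 : V.SpaceLipschitz C₂)
    (hA3 : V.MeasureLipschitz C₃) (hA4 : V.GradientLipschitz C₄)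
    (μ₀ : ProbabilityMeasure (NonlocalLF.Dom k₁ k₂))
    (hsupp : ∃ K : Set (NonlocalLF.Dom k₁ k₂), IsCompact K ∧
      (μ₀ : Measure (NonlocalLF.Dom k₁ k₂)) Kᶜ = 0)
    (hac : (μ₀ : Measure (NonlocalLF.Dom k₁ k₂)) ≪ volume)
    (hBV : NonlocalLF.IsBV (NonlocalLF.density μ₀)) :
    ∃ μ : ℝ≥0 → ProbabilityMeasure (NonlocalLF.Dom k₁ k₂),
      NonlocalLF.IsMeasureValuedSolution V μ₀ μ ∧
      (∀ μ' : ℝ≥0 → ProbabilityMeasure (NonlocalLF.Dom k₁ k₂),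
        NonlocalLF.IsMeasureValuedSolution V μ₀ μ' → μ' = μ) ∧
      (∀ t : ℝ≥0, (μ t : Measure (NonlocalLF.Dom k₁ k₂)) ≪ volume) ∧
      ∀ (r : NonlocalLF.Realization) (lam₀ κ T ε : ℝ), 0 < lam₀ → 0 < κ → 0 < T → 0 < ε →
        ∃ δ : ℝ, 0 < δ ∧
          ∀ (m₁ : NonlocalLF.Mesh k₁) (m₂ : NonlocalLF.Mesh k₂) (τ : ℝ), 0 < τ →
            m₁.step < δ → m₂.step < δ →
            max m₁.step m₂.step ≤ κ * min m₁.step m₂.step →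
            lam₀ ≤ τ / min m₁.step m₂.step * C₁ →
            τ / min m₁.step m₂.step * C₁ ≤ 1 / 2 →
            (⨆ (t : ℝ≥0) (_ : (t : ℝ) ≤ T),
              eLpNorm (fun x => NonlocalLF.approxSolution V r m₁ m₂ τ μ₀ t x
                - NonlocalLF.density (μ t) x) 1 volume) ≤ ENNReal.ofReal ε := by
  have hV : V.Regular (max 1 (max (max C₁ C₂) (max C₃ C₄))) :=
    NonlocalLF.Velocity.regular_of hC₂ hC₃ hC₄ hA1 hA2 hA3 hA4 (le_max_left _ _)
      (((le_max_left _ _).trans (le_max_left _ _)).trans (le_max_right _ _))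
      (((le_max_right _ _).trans (le_max_left _ _)).trans (le_max_right _ _))
      (((le_max_left _ _).trans (le_max_right _ _)).trans (le_max_right _ _))
      (((le_max_right _ _).trans (le_max_right _ _)).trans (le_max_right _ _))
  obtain ⟨A, M, f, hA, hM, hf⟩ := NonlocalLF.exists_exact_isDensityCurve hac hBV hV hA1 hC₁
  let μ : ℝ≥0 → ProbabilityMeasure (NonlocalLF.Dom k₁ k₂) := fun t =>
    ⟨NonlocalLF.densityMeasure (f t), hf.prob t⟩
  have happ : NonlocalLF.IsApprox V A 0 fun t => μ t.toNNReal := by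
    constructor
    · intro s t hs hst
      have := hf.approx.close s t hs hst
      simpa only [μ, Real.coe_toNNReal _ hs, Real.coe_toNNReal _ (hs.trans hst)] using this
    · intro s t hs hst hts φ G L K hφ
      have := hf.approx.step s t hs hst hts φ G L K hφ
      simpa only [μ, Real.coe_toNNReal _ hs, Real.coe_toNNReal _ (hs.trans hst)] using this
  -- The exact curve starts at Wasserstein distance 0 from `μ₀`, hence at `μ₀`.
  have h0 : μ 0 = μ₀ := NonlocalLF.eq_of_wClose fun ε hε => hf.initial.mono hε.le
  have hsol : NonlocalLF.IsMeasureValuedSolution V μ₀ μ := by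
    have := happ.isMeasureValuedSolution hV hA
    rwa [h0] at this
  refine ⟨μ, hsol, fun μ' hμ' => hsol.unique hV hμ', fun t => withDensity_absolutelyContinuous _ _,
    fun r lam₀ κ T ε hlam hκ hT hε => ?_⟩
  obtain ⟨δ, hδ, h⟩ := hf.exists_eLpNorm_approxSolution_le hA hM hac hBV hV hA1 hC₁ r hlam hκ.le
    hT.le hε
  refine ⟨δ, hδ, fun m₁ m₂ τ hτ hm₁ hm₂ hratio hlower hupper => iSup₂_le fun t ht => ?_⟩
  refine le_trans (le_of_eq (eLpNorm_congr_ae ?_))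
    (h m₁ m₂ τ ⟨hτ, hratio, hlower, hupper⟩ (max_lt hm₁ hm₂) t t.2 ht)
  filter_upwards [NonlocalLF.density_ae_eq (hf.measurable t) (hf.nonneg t) (hf.prob t)] with x hx
  rw [hx]
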